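/- Graphs are finite and undirected; multiple edges (and loops) are allowed unless the graph is called simple. For a tree $T$ with bounded degrees, let $\rho(T)$ be the spectral radius of its adjacency operator $(A_Tf)(v)=\sum_{u\sim v}f(u)$ on $\ell^2(V(T))$. The family of $T$ consists of all finite graphs $G$ such that $T$ is the universal covering tree of every connected component of $G$. A graph $G$ in this family, with adjacency eigenvalues $\lambda_n\le\dots\le\lambda_2\le\lambda_1$, is called bipartite-Ramanujan if it is bipartite and $\lambda_2,\dots,\lambda_{n-1}\in[-\rho(T),\rho(T)]$. (1) Let $T$ be a tree. If the family of $T$ contains a bipartite-Ramanujan graph $G$ on $n$ vertices, then for every integer $r\ge 1$ it contains a bipartite-Ramanujan graph $H$ on $nr$ vertices, and $H$ can be chosen simple if $G$ is simple. If $T$ is infinite and $G$ is connected, then $H$ can moreover be chosen connected. (2) For all integers $k,r\ge 1$ there is a simple $k$-regular bipartite-Ramanujan graph on $2kr$ vertices; it can be chosen connected if $k\ge 2$. (3) For all integers $k,\ell,r\ge 1$ there is a simple $(k,\ell)$-biregular bipartite-Ramanujan graph on $(k+\ell)r$ vertices (bipartite, with all degrees equal to $k$ on one side and to $\ell$ on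 the other side); it can be chosen connected if $k,\ell\ge 2$. -/

import Mathlib

/-- An undirected graph with vertex set `V`, in which multiple edges and loops are allowed.
Every undirected edge is represented by its two orientations `e` and `rev e`
(so that a loop is represented by two different directed edges). -/
structure Multigraph (V : Type*) where
  /-- the directed edges -/
  Dart : Type*
  /-- the starting vertex of a directed edge -/
  src : Dart → V
  /-- the same edge with the opposite orientation -/
  rev : Dart → Dart
  rev_rev : ∀ e, rev (rev e) = e
  rev_ne : ∀ e, rev e ≠ e

namespace Multigraph

/-- The end vertex of a directed edge. -/
def tgt {V : Type*} (G : Multigraph V) (e : G.Dart) : V := G.src (G.rev e)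

/-- A simple graph, regarded as a graph in the above sense. -/
def ofSimple {V : Type*} (G : SimpleGraph V) : Multigraph V where
  Dart := G.Dart
  src d := d.fst
  rev d := d.symm
  rev_rev d := d.symm_symm
  rev_ne d := d.symm_ne

/-- A graph is simple if it has neither loops nor multiple edges. -/
def IsSimple {V : Type*} (G : Multigraph V) : Prop :=
  (∀ e, G.src e ≠ G.tgt e) ∧ ∀ e e', G.src e = G.src e' → G.tgt e = G.tgt e' → e = e'

/-- A graph is bipartite if its vertices have a colouring by two colours for which the two ends of
every edge have different colours. -/
def IsBipartite {V : Type*} (G : Multigraph V) : Prop :=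
  ∃ c : V → Bool, ∀ e, c (G.src e) ≠ c (G.tgt e)

/-- A graph is connected if it is not empty and any two vertices are joined by a path. -/
def Connected {V : Type*} (G : Multigraph V) : Prop :=
  Nonempty V ∧
    ∀ u v, Relation.ReflTransGen (fun x y => ∃ e, G.src e = x ∧ G.tgt e = y) u v

/-- A morphism of graphs `G → H` which maps the star of every vertex `v` (the set of the directed
edges starting at `v`) bijectively onto the star of the image of `v`.
If `G` is connected, its image is a connected component of `H`, and this is a covering map
of `G` onto this component. -/
structure Covering {V W : Type*} (G : Multigraph V) (H : Multigraph W) where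
  onVert : V → W
  onDart : G.Dart → H.Dart
  src_onDart : ∀ e, H.src (onDart e) = onVert (G.src e)
  rev_onDart : ∀ e, H.rev (onDart e) = onDart (G.rev e)
  bijOn_star : ∀ v, Set.BijOn onDart {e | G.src e = v} {e | H.src e = onVert v}

/-- The adjacency matrix: the entry at `(u, v)` is the number of directed edges from `u` to `v`. -/
noncomputable def adjMatrix {V : Type*} (G : Multigraph V) : Matrix V V ℝ :=
  Matrix.of fun u v => (Nat.card {e : G.Dart // G.src e = u ∧ G.tgt e = v} : ℝ)

theorem adjMatrix_isHermitian {V : Type*} (G : Multigraph V) : G.adjMatrix.IsHermitian := by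
  ext u v
  simp only [adjMatrix, Matrix.conjTranspose_apply, Matrix.of_apply, star_trivial, Nat.cast_inj]
  refine Nat.card_congr ⟨fun e => ⟨G.rev e.1, e.2.2, ?_⟩, fun e => ⟨G.rev e.1, e.2.2, ?_⟩, ?_, ?_⟩
  · rw [tgt, G.rev_rev]; exact e.2.1
  · rw [tgt, G.rev_rev]; exact e.2.1
  · intro e; exact Subtype.ext (G.rev_rev _)
  · intro e; exact Subtype.ext (G.rev_rev _)

open Classical in
/-- The eigenvalues `λ₀ ≥ λ₁ ≥ … ≥ λ_{n-1}` of the adjacency matrix of a graph on `n` vertices,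
in decreasing order and with their multiplicities. -/
noncomputable def eigenvalue {V : Type*} [Fintype V] (G : Multigraph V) :
    Fin (Fintype.card V) → ℝ :=
  G.adjMatrix_isHermitian.eigenvalues₀

end Multigraph

/-- The Hilbert space `ℓ²(V)` of the square-summable complex functions on `V`. -/
abbrev EllTwo (V : Type*) : Type _ := lp (fun _ : V => ℂ) 2

/-- `A` is the adjacency operator `(A f)(v) = ∑_{u ∼ v} f(u)` of `T` on `ℓ²(V)`. -/
def SimpleGraph.IsAdjOperator {V : Type*} (T : SimpleGraph V)
    (A : EllTwo V →L[ℂ] EllTwo V) : Prop :=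
  ∀ (f : EllTwo V) (v : V), HasSum (fun u : T.neighborSet v => f u) (A f v)

/-- Schur's test: the adjacency operator of a graph of bounded degree exists as a bounded operator
on `ℓ²(V)`. -/
theorem SimpleGraph.exists_isAdjOperator {V : Type*} (T : SimpleGraph V) (D : ℕ)
    (hfin : ∀ v, (T.neighborSet v).Finite) (hD : ∀ v, (T.neighborSet v).ncard ≤ D) :
    ∃ A : EllTwo V →L[ℂ] EllTwo V, T.IsAdjOperator A := by
  classical
  have key : ∀ (f : EllTwo V) (s : Finset V),
      ∑ v ∈ s, ‖∑ u ∈ (hfin v).toFinset, f u‖ ^ 2 ≤ (D * ‖f‖) ^ 2 := by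
    intro f s
    have hcard : ∀ v, ((hfin v).toFinset.card : ℝ) ≤ D := fun v => by
      rw [← Set.ncard_eq_toFinset_card _ (hfin v)]; exact_mod_cast hD v
    have h1 : ∀ v, ‖∑ u ∈ (hfin v).toFinset, f u‖ ^ 2 ≤
        D * ∑ u ∈ (hfin v).toFinset, ‖f u‖ ^ 2 := fun v =>
      calc ‖∑ u ∈ (hfin v).toFinset, f u‖ ^ 2
          ≤ (∑ u ∈ (hfin v).toFinset, ‖f u‖) ^ 2 := by
            gcongr; exact norm_sum_le _ _
        _ ≤ (hfin v).toFinset.card * ∑ u ∈ (hfin v).toFinset, ‖f u‖ ^ 2 :=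
            sq_sum_le_card_mul_sum_sq
        _ ≤ _ := by
            exact mul_le_mul_of_nonneg_right (hcard v) (Finset.sum_nonneg fun _ _ => by positivity)
    have hnorm : ∀ t : Finset V, ∑ u ∈ t, ‖f u‖ ^ 2 ≤ ‖f‖ ^ 2 := fun t => by
      have := lp.sum_rpow_le_norm_rpow (p := 2) (by norm_num) f t
      simpa using this
    set B := s.biUnion fun v => (hfin v).toFinset with hB
    calc ∑ v ∈ s, ‖∑ u ∈ (hfin v).toFinset, f u‖ ^ 2
        ≤ ∑ v ∈ s, D * ∑ u ∈ (hfin v).toFinset, ‖f u‖ ^ 2 := Finset.sum_le_sum fun v _ => h1 v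
      _ = D * ∑ v ∈ s, ∑ u ∈ (hfin v).toFinset, ‖f u‖ ^ 2 := by rw [Finset.mul_sum]
      _ = D * ∑ u ∈ B, ∑ v ∈ s with T.Adj v u, ‖f u‖ ^ 2 := by
          congr 1
          refine Finset.sum_comm' fun v u => ?_
          simp only [Set.Finite.mem_toFinset, SimpleGraph.mem_neighborSet, Finset.mem_filter, hB,
            Finset.mem_biUnion]
          constructor
          · rintro ⟨h, h'⟩; exact ⟨⟨h, h'⟩, v, h, h'⟩
          · rintro ⟨h, -⟩; exact h
      _ ≤ D * ∑ u ∈ B, D * ‖f u‖ ^ 2 := by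
          gcongr with u _
          rw [Finset.sum_const, nsmul_eq_mul]
          refine mul_le_mul_of_nonneg_right (le_trans ?_ (hcard u)) (by positivity)
          refine Nat.cast_le.2 (Finset.card_le_card fun v hv => ?_)
          simpa using (Finset.mem_filter.1 hv).2.symm
      _ = D ^ 2 * ∑ u ∈ B, ‖f u‖ ^ 2 := by rw [← Finset.mul_sum]; ring
      _ ≤ D ^ 2 * ‖f‖ ^ 2 := by gcongr; exact hnorm B
      _ = _ := by ring
  have hmem : ∀ f : EllTwo V, Memℓp (fun v => ∑ u ∈ (hfin v).toFinset, f u) 2 := fun f =>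
    memℓp_gen' (C := (D * ‖f‖) ^ 2) fun s => by simpa using key f s
  let L : EllTwo V →ₗ[ℂ] EllTwo V :=
    { toFun := fun f => ⟨_, hmem f⟩
      map_add' := fun f g => by
        ext v
        exact Finset.sum_add_distrib
      map_smul' := fun c f => by
        ext v
        exact (Finset.mul_sum _ _ _).symm }
  refine ⟨L.mkContinuous D fun f => ?_, fun f v => ?_⟩
  · refine lp.norm_le_of_forall_sum_le (p := 2) (by norm_num) (by positivity) fun s => ?_
    have h := key f s
    simp only [ENNReal.toReal_ofNat, Real.rpow_ofNat]
    exact h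
  · change HasSum (fun u : T.neighborSet v => f u) (∑ u ∈ (hfin v).toFinset, f u)
    have := (hfin v).fintype
    have h := hasSum_fintype fun u : T.neighborSet v => f u
    convert h using 1
    exact (Finset.sum_subtype _ (by simp) _)

open Classical in
/-- The adjacency operator of `T` on `ℓ²(V)` (which exists if the degrees of `T` are bounded). -/
noncomputable def SimpleGraph.adjOperator {V : Type*} (T : SimpleGraph V) :
    EllTwo V →L[ℂ] EllTwo V :=
  if h : ∃ A, T.IsAdjOperator A then h.choose else 0

/-- The spectral radius of `T`, i.e. of its adjacency operator on `ℓ²(V)`. -/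
noncomputable def SimpleGraph.specRadius {V : Type*} (T : SimpleGraph V) : ℝ :=
  (spectralRadius ℂ T.adjOperator).toReal

namespace Multigraph

/-- `G` is a finite graph and `T` is a tree that is the universal covering tree of (every connected
component of) `G`: `G` belongs to the family of the finite graphs covered by `T`. -/
structure IsInFamily {V W : Type*} (T : SimpleGraph W) (G : Multigraph V) : Prop where
  isTree : T.IsTree
  finite_vert : Finite V
  finite_dart : Finite G.Dart
  covered : ∀ v, ∃ p : Covering (ofSimple T) G, v ∈ Set.range p.onVert

/-- `G` belongs to the family of the finite graphs covered by the tree `T`, it is bipartite, and all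
its eigenvalues but the largest and the smallest one lie in `[-ρ, ρ]`, where `ρ` is the spectral
radius of the universal covering tree `T` of `G`. -/
structure IsBipartiteRamanujan {V W : Type*} [Fintype V] (T : SimpleGraph W)
    (G : Multigraph V) : Prop where
  isInFamily : G.IsInFamily T
  isBipartite : G.IsBipartite
  eigenvalue_mem : ∀ i : Fin (Fintype.card V), 0 < (i : ℕ) → (i : ℕ) + 1 < Fintype.card V →
    G.eigenvalue i ∈ Set.Icc (-T.specRadius) T.specRadius

end Multigraph

/-- Every vertex of `G` has exactly `k` neighbours. -/
def SimpleGraph.IsKRegular {V : Type*} (G : SimpleGraph V) (k : ℕ) : Prop :=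
  ∀ v, (G.neighborSet v).Finite ∧ (G.neighborSet v).ncard = k

/-- `G` is bipartite, every vertex on one side has exactly `k` neighbours, and every vertex on
the other side has exactly `l` neighbours. -/
def SimpleGraph.IsBiregular {V : Type*} (G : SimpleGraph V) (k l : ℕ) : Prop :=
  ∃ c : V → Bool, (∀ u v, G.Adj u v → c u ≠ c v) ∧
    ∀ v, (G.neighborSet v).Finite ∧ (G.neighborSet v).ncard = if c v then k else l

/-! Write `r = d + 1` and let `G` be bipartite. An `r`-sheeted cover of `G` is given by one
permutation per edge. Its characteristic polynomial is that of `G` times a new factor, in which each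
permutation acts through the `d`-dimensional standard representation. By the symmetry of bipartite
spectra, it suffices to find a cover whose new factor is positive on `(ρ(T), ∞)`: the number of
eigenvalues above `ρ(T)`, at most one for `G`, is then unchanged.

Interlacing reduces this to an average. A uniform permutation is a product of independent random
transpositions, and conjugating a symmetric matrix by a transposition subtracts one rank-one
positive matrix and adds another. So the two outcomes of each random step have expected
characteristic polynomials with a common interlacer, and one of them is positive above `ρ` if their
mean is (`LowerInterlaces.pos_or_pos`, `exists_charpoly_pos`). The steps act on full permutation
matrices, so the old factor is present as well; a penalty on the functions that are constant on
fibres pushes its roots below `ρ`.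

The average is computed by an exchange: for a determinant, a uniform element of the symmetric group
on `d + 1` points in the standard representation has the same average as a uniform signed
permutation matrix of size `d` (`average_stdMatrix_eq_average_signedPermMatrix`). Applied edge by
edge, this turns the average new factor into an average, over `d`-sheeted covers of `G`, of
characteristic polynomials of randomly signed adjacency matrices, that is, of matching polynomials.

These covers have the same universal covering tree `T`. For `x > ρ(T)` the resolvent of the
adjacency operator gives a positive `g` on `T` with `A g < x g`. Comparing ratios of matching
polynomials with ratios of values of `g` through the matching recursion shows that the matching
polynomials are positive at `x` (`IsInFamily.pos_of_recursion`).

Connectedness: if a connected `G` has an eigenvalue above `ρ(T)`, a disconnected cover would have it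
at least twice. If it has none, neither has any cover, and for infinite `T` a cyclic shift on an
edge that is not a bridge gives a connected cover. For the regular and biregular graphs one starts
from a complete bipartite graph, whose adjacency matrix has rank at most two. -/

/-! ### Stable polynomials and common interlacing -/

open Polynomial in
/-- A real polynomial without zeros in the open upper half plane. -/
def Polynomial.Stable (f : ℝ[X]) : Prop := ∀ z : ℂ, 0 < z.im → aeval z f ≠ 0

namespace Polynomial

open Filter Topology

/-- By the Cauchy–Riemann equations the derivative along the real axis is the upward derivative of
the imaginary part. That part vanishes on the axis and is nonnegative above it. -/
theorem monotoneOn_div_of_im_nonneg {g h : ℝ[X]} {a : ℝ}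
    (him : ∀ z : ℂ, 0 < z.im → 0 ≤ (aeval z h / aeval z g).im)
    (hx : ∀ x, a ≤ x → g.eval x ≠ 0) :
    MonotoneOn (fun x => h.eval x / g.eval x) (Set.Ici a) := by
  set φ' : ℝ → ℝ := fun x =>
    (h.derivative.eval x * g.eval x - h.eval x * g.derivative.eval x) / g.eval x ^ 2 with hφ'
  have hd : ∀ x, a ≤ x → HasDerivAt (fun x => h.eval x / g.eval x) (φ' x) x := fun x hax =>
    (h.hasDerivAt x).div (g.hasDerivAt x) (hx x hax)
  have hcast : ∀ (q : ℝ[X]) (x : ℝ), aeval (x : ℂ) q = ((q.eval x : ℝ) : ℂ) := fun q x =>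
    (aeval_algebraMap_apply ℂ x q).trans (by rw [coe_aeval_eq_eval]; rfl)
  have hpos : ∀ x, a ≤ x → 0 ≤ φ' x := by
    intro x hax
    have hgx : aeval (x : ℂ) g ≠ 0 := by
      rw [hcast]; exact_mod_cast hx x hax
    have hw : HasDerivAt (fun z : ℂ => aeval z h / aeval z g) ((φ' x : ℝ) : ℂ) (x : ℂ) := by
      have := (h.hasDerivAt_aeval (x : ℂ)).div (g.hasDerivAt_aeval (x : ℂ)) hgx
      refine this.congr_deriv ?_
      simp only [hφ', hcast]
      push_cast
      rfl
    have hl : HasDerivAt (fun t : ℝ => (x : ℂ) + t * Complex.I) Complex.I 0 := by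
      have := ((hasDerivAt_id (0 : ℝ)).ofReal_comp.mul_const Complex.I).const_add (x : ℂ)
      simpa using this
    have hw' : HasDerivAt (fun z : ℂ => aeval z h / aeval z g) ((φ' x : ℝ) : ℂ)
        ((x : ℂ) + (0 : ℝ) * Complex.I) := by simpa using hw
    have hc := hw'.comp (0 : ℝ) hl
    have hi : HasDerivAt (fun t : ℝ => (aeval ((x : ℂ) + t * Complex.I) h /
        aeval ((x : ℂ) + t * Complex.I) g).im) (φ' x) 0 := by
      have := (Complex.imCLM.hasFDerivAt.comp_hasDerivAt (0 : ℝ) hc)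
      simpa [Function.comp_def] using this
    have hs := hi.tendsto_slope.mono_left
      (nhdsWithin_mono 0 (fun t (ht : t ∈ Set.Ioi (0 : ℝ)) => ne_of_gt ht))
    refine ge_of_tendsto hs ?_
    filter_upwards [self_mem_nhdsWithin] with t ht
    have ht : 0 < t := ht
    rw [slope_def_field]
    have h0 : (aeval ((x : ℂ) + (0 : ℝ) * Complex.I) h /
        aeval ((x : ℂ) + (0 : ℝ) * Complex.I) g).im = 0 := by
      simp only [Complex.ofReal_zero, zero_mul, add_zero, hcast]
      rw [← Complex.ofReal_div, Complex.ofReal_im]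
    rw [h0, sub_zero, sub_zero]
    exact div_nonneg (him _ (by simpa using ht)) ht.le
  refine monotoneOn_of_deriv_nonneg (convex_Ici a) ?_ ?_ ?_
  · exact fun x hax => (hd x hax).continuousAt.continuousWithinAt
  · intro x hax
    rw [interior_Ici] at hax
    exact (hd x (le_of_lt hax)).differentiableAt.differentiableWithinAt
  · intro x hax
    rw [interior_Ici] at hax
    rw [(hd x (le_of_lt hax)).deriv]
    exact hpos x (le_of_lt hax)

theorem exists_forall_ge_eval_pos {g : ℝ[X]} (hg : 0 < g.leadingCoeff) :
    ∃ a, ∀ x, a ≤ x → 0 < g.eval x := by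
  by_cases hd : 0 < g.degree
  · exact eventually_atTop.1
      ((tendsto_atTop_of_leadingCoeff_nonneg g hd hg.le).eventually_gt_atTop 0)
  · rw [eq_C_of_degree_le_zero (not_lt.1 hd)] at hg ⊢
    exact ⟨0, fun x _ => by simpa using hg⟩

/-- A nonzero real value of `h / g` in the upper half plane would be a zero of some `g + s h`. If
the quotient is not constant its image is open, so it also avoids `0`, since otherwise it would
contain small positive reals. The imaginary part then has constant sign by connectedness. -/
theorem Stable.eval_ne_zero_im_sign {g h : ℝ[X]} (hst : ∀ s : ℝ, (g + C s * h).Stable) :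
    (∀ z : ℂ, 0 < z.im → 0 ≤ (aeval z h / aeval z g).im) ∨
    (∀ z : ℂ, 0 < z.im → (aeval z h / aeval z g).im ≤ 0) := by
  set U : Set ℂ := {z | 0 < z.im} with hU
  set w : ℂ → ℂ := fun z => aeval z h / aeval z g with hw
  have hg0 : ∀ z ∈ U, aeval z g ≠ 0 := fun z hz => by simpa using hst 0 z hz
  have hreal : ∀ z ∈ U, (w z).im = 0 → w z = 0 := by
    intro z hz him
    by_contra hne
    have hwr : w z = (((w z).re : ℝ) : ℂ) := Complex.ext rfl (by simpa using him)
    set a := (w z).re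
    have ha : (a : ℂ) ≠ 0 := hwr ▸ hne
    refine hst (-a⁻¹) z hz ?_
    have hmul : aeval z h = a * aeval z g := by
      rw [← hwr, hw]; field_simp [hg0 z hz]
    simp only [map_add, map_mul, aeval_C, hmul]
    simp
    field_simp
    ring
  have hpre : IsPreconnected U := (convex_halfSpace_im_gt 0).isPreconnected
  have hopen : IsOpen U := isOpen_lt continuous_const Complex.continuous_im
  have hdiff : DifferentiableOn ℂ w U := fun z hz =>
    ((h.differentiable_aeval z).div (g.differentiable_aeval z) (hg0 z hz)).differentiableWithinAt
  rcases (hdiff.analyticOnNhd hopen).is_constant_or_isOpen hpre with ⟨c, hc⟩ | hop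
  · rcases le_total 0 c.im with hci | hci
    · exact Or.inl fun z hz => by rw [show aeval z h / aeval z g = c from hc z hz]; exact hci
    · exact Or.inr fun z hz => by rw [show aeval z h / aeval z g = c from hc z hz]; exact hci
  · have himg := hop U subset_rfl hopen
    have hne : ∀ z ∈ U, (w z).im ≠ 0 := by
      intro z hz him
      have h0 := hreal z hz him
      have hmem : (0 : ℂ) ∈ w '' U := ⟨z, hz, h0⟩
      obtain ⟨ε, hε, hball⟩ := Metric.isOpen_iff.1 himg 0 hmem
      have : ((ε / 2 : ℝ) : ℂ) ∈ w '' U := hball (by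
        rw [Metric.mem_ball, dist_zero_right, Complex.norm_real, Real.norm_eq_abs,
          abs_of_pos (by positivity)]
        linarith)
      obtain ⟨z', hz', hwz'⟩ := this
      have h1 := hreal z' hz' (by rw [hwz']; exact Complex.ofReal_im _)
      rw [hwz'] at h1
      have : ε / 2 = 0 := by exact_mod_cast h1
      linarith
    have hcont : ContinuousOn (fun z => (w z).im) U :=
      Complex.continuous_im.comp_continuousOn hdiff.continuousOn
    have hpc := hpre.image _ hcont
    by_contra hcon
    push Not at hcon
    obtain ⟨⟨z1, hz1, h1⟩, z2, hz2, h2⟩ := hcon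
    have := hpc.ordConnected.out ⟨z1, hz1, rfl⟩ ⟨z2, hz2, rfl⟩ ⟨h1.le, h2.le⟩
    obtain ⟨z, hz, hz0⟩ := this
    exact hne z hz hz0

/-- The negative leading coefficient decides the sign: in the other case `-h / g` would be
increasing near infinity, while it is positive there and tends to `0`. -/
theorem Stable.im_div_nonneg {g h : ℝ[X]} (hg : g.Monic) (hdeg : h.degree < g.degree)
    (hlc : h = 0 ∨ h.leadingCoeff < 0) (hst : ∀ s : ℝ, (g + C s * h).Stable) :
    ∀ z : ℂ, 0 < z.im → 0 ≤ (aeval z h / aeval z g).im := by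
  rcases hlc with rfl | hlc
  · intro z _; simp
  rcases Stable.eval_ne_zero_im_sign hst with hs | hs
  · exact hs
  exfalso
  obtain ⟨a, ha⟩ := exists_forall_ge_eval_pos (g := g) (by rw [hg.leadingCoeff]; exact one_pos)
  obtain ⟨b, hb⟩ := exists_forall_ge_eval_pos (g := -h) (by rw [leadingCoeff_neg]; linarith)
  have hmono := monotoneOn_div_of_im_nonneg (g := g) (h := -h) (a := max a b) (fun z hz => by
    have := hs z hz
    rw [map_neg, neg_div, Complex.neg_im]
    linarith) (fun x hx => (ha x (le_trans (le_max_left _ _) hx)).ne')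
  have hlim : Tendsto (fun x => (-h).eval x / g.eval x) atTop (𝓝 0) :=
    div_tendsto_atTop_zero_of_degree_lt _ _ (by rwa [degree_neg])
  set m := max a b
  have hm : 0 < (-h).eval m / g.eval m :=
    div_pos (hb m (le_max_right _ _)) (ha m (le_max_left _ _))
  have : (-h).eval m / g.eval m ≤ 0 := by
    refine ge_of_tendsto hlim ?_
    filter_upwards [eventually_ge_atTop m] with x hx
    exact hmono (Set.mem_Ici.2 le_rfl) (Set.mem_Ici.2 hx) hx
  linarith

/-- `g` interlaces `g + h` from below. -/
structure LowerInterlaces (g h : ℝ[X]) : Prop where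
  monic : g.Monic
  degree_lt : h.degree < g.degree
  sign : h = 0 ∨ h.leadingCoeff < 0
  stable : ∀ s : ℝ, (g + C s * h).Stable

/-- At a zero in the upper half plane, the quotients `w₁`, `w₂` of `h₁`, `h₂` by `g` satisfy `p w₁ +
q w₂ = -1`. Both imaginary parts are nonnegative, so each term is real. But a real quotient must be
`0`, as `g + s h` is stable for all `s`. -/
theorem LowerInterlaces.stable_combination {g h₁ h₂ : ℝ[X]} (H₁ : LowerInterlaces g h₁)
    (H₂ : LowerInterlaces g h₂) {p q : ℝ} (hp : 0 ≤ p) (hq : 0 ≤ q) (hpq : p + q = 1) :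
    (C p * (g + h₁) + C q * (g + h₂)).Stable := by
  intro z hz h0
  have hg0 : aeval z g ≠ 0 := by simpa using H₁.stable 0 z hz
  set w₁ := aeval z h₁ / aeval z g with hw₁
  set w₂ := aeval z h₂ / aeval z g with hw₂
  have e₁ : aeval z h₁ = w₁ * aeval z g := by rw [hw₁]; field_simp
  have e₂ : aeval z h₂ = w₂ * aeval z g := by rw [hw₂]; field_simp
  have i₁ : 0 ≤ w₁.im := Stable.im_div_nonneg H₁.monic H₁.degree_lt H₁.sign H₁.stable z hz
  have i₂ : 0 ≤ w₂.im := Stable.im_div_nonneg H₂.monic H₂.degree_lt H₂.sign H₂.stable z hz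
  have hpq' : (p : ℂ) + q = 1 := by exact_mod_cast hpq
  have hsum : (p : ℂ) * w₁ + q * w₂ = -1 := by
    simp only [map_add, map_mul, aeval_C, e₁, e₂, Complex.coe_algebraMap] at h0
    have : aeval z g * ((p + q) + (p * w₁ + q * w₂)) = 0 := by linear_combination h0
    rcases mul_eq_zero.1 this with h | h
    · exact absurd h hg0
    · rw [hpq'] at h; linear_combination h
  have him := congrArg Complex.im hsum
  simp at him
  have key : ∀ (h : ℝ[X]) (w : ℂ), (∀ s : ℝ, (g + C s * h).Stable) →
      aeval z h = w * aeval z g → w.im = 0 → w = 0 := by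
    intro h w hs e hi
    by_contra hne
    have hwr : w = ((w.re : ℝ) : ℂ) := Complex.ext rfl (by simpa using hi)
    refine hs (-(w.re)⁻¹) z hz ?_
    have hr : (w.re : ℂ) ≠ 0 := hwr ▸ hne
    rw [map_add, map_mul, aeval_C, e, hwr]
    simp
    field_simp
    ring
  have k₁ : p * w₁.im = 0 := by nlinarith [mul_nonneg hp i₁, mul_nonneg hq i₂]
  have k₂ : q * w₂.im = 0 := by nlinarith [mul_nonneg hp i₁, mul_nonneg hq i₂]
  have z₁ : (p : ℂ) * w₁ = 0 := by
    rcases mul_eq_zero.1 k₁ with h | h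
    · simp [h]
    · simp [key h₁ w₁ H₁.stable e₁ h]
  have z₂ : (q : ℂ) * w₂ = 0 := by
    rcases mul_eq_zero.1 k₂ with h | h
    · simp [h]
    · simp [key h₂ w₂ H₂.stable e₂ h]
  rw [z₁, z₂] at hsum
  norm_num at hsum

theorem LowerInterlaces.monotoneOn {g h : ℝ[X]} (H : LowerInterlaces g h) {a : ℝ}
    (ha : ∀ x, a ≤ x → 0 < g.eval x) :
    MonotoneOn (fun x => h.eval x / g.eval x) (Set.Ici a) :=
  monotoneOn_div_of_im_nonneg (Stable.im_div_nonneg H.monic H.degree_lt H.sign H.stable)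
    fun x hx => (ha x hx).ne'

/-- Beyond `a` the quotient `h / g` increases to its limit `0`, so `h` is nonpositive there and by
continuity at `a`. -/
theorem LowerInterlaces.eval_nonpos {g h : ℝ[X]} (H : LowerInterlaces g h) {a : ℝ}
    (ha : ∀ x, a < x → 0 < g.eval x) : h.eval a ≤ 0 := by
  have hpos : ∀ x, a < x → h.eval x ≤ 0 := by
    intro x hx
    have hm := H.monotoneOn (a := x) fun y hy => ha y (lt_of_lt_of_le hx hy)
    have hlim := div_tendsto_atTop_zero_of_degree_lt _ _ H.degree_lt
    have : h.eval x / g.eval x ≤ 0 := by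
      refine ge_of_tendsto hlim ?_
      filter_upwards [eventually_ge_atTop x] with y hy
      exact hm (Set.mem_Ici.2 le_rfl) (Set.mem_Ici.2 hy) hy
    by_contra hcon
    exact absurd (div_pos (not_le.1 hcon) (ha x hx)) (not_lt.2 this)
  have hc : Tendsto (fun x => h.eval x) (𝓝[>] a) (𝓝 (h.eval a)) :=
    h.continuous.continuousAt.mono_left nhdsWithin_le_nhds
  refine le_of_tendsto hc ?_
  filter_upwards [self_mem_nhdsWithin] with x hx
  exact hpos x hx

/-- If a convex combination of two monic polynomials with a common lower interlacer is positive
beyond `ρ`, then so is one of the two. -/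
theorem LowerInterlaces.pos_or_pos {g h₁ h₂ : ℝ[X]} (H₁ : LowerInterlaces g h₁)
    (H₂ : LowerInterlaces g h₂) {p q : ℝ} (hp : 0 ≤ p) (hq : 0 ≤ q) {ρ : ℝ}
    (hpos : ∀ x, ρ < x → 0 < p * (g + h₁).eval x + q * (g + h₂).eval x) :
    (∀ x, ρ < x → 0 < (g + h₁).eval x) ∨ (∀ x, ρ < x → 0 < (g + h₂).eval x) := by
  by_contra hcon
  push Not at hcon
  obtain ⟨⟨x₁, hx₁, h₁n⟩, x₂, hx₂, h₂n⟩ := hcon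
  obtain ⟨b, hb⟩ := exists_forall_ge_eval_pos (g := g)
    (by rw [H₁.monic.leadingCoeff]; exact one_pos)
  set m := min x₁ x₂ with hm
  have hρm : ρ < m := lt_min hx₁ hx₂
  -- If `g` is nonpositive somewhere beyond `m`, then at the last such point `γ` both `h₁` and `h₂`
  -- are nonpositive too, so the combination is not positive at `γ`. Otherwise `h₁ / g` and `h₂ / g`
  -- increase from `m` on, and the failures at `x₁` and `x₂` propagate down to `m`.
  by_cases hroot : ∃ x, m ≤ x ∧ g.eval x ≤ 0
  · set S : Set ℝ := {x | m ≤ x ∧ g.eval x ≤ 0} with hS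
    have hbdd : BddAbove S := ⟨b, fun x hx => by
      by_contra hcon
      exact absurd (hb x (not_le.1 hcon).le) (not_lt.2 hx.2)⟩
    have hclosed : IsClosed S :=
      isClosed_Ici.inter (isClosed_le g.continuous continuous_const)
    have hmem : sSup S ∈ S := hclosed.csSup_mem hroot hbdd
    set γ := sSup S
    have hgt : ∀ x, γ < x → 0 < g.eval x := by
      intro x hx
      by_contra hcon
      exact absurd (le_csSup hbdd (show x ∈ S from
        ⟨le_trans hmem.1 hx.le, not_lt.1 hcon⟩)) (not_le.2 hx)
    have a₁ := H₁.eval_nonpos hgt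
    have a₂ := H₂.eval_nonpos hgt
    have := hpos γ (lt_of_lt_of_le hρm hmem.1)
    simp only [eval_add] at this
    nlinarith [hmem.2, mul_nonneg hp (neg_nonneg.2 a₁), mul_nonneg hq (neg_nonneg.2 a₂),
      mul_nonneg hp (neg_nonneg.2 hmem.2), mul_nonneg hq (neg_nonneg.2 hmem.2)]
  · push Not at hroot
    have key : ∀ {h : ℝ[X]} (x : ℝ), LowerInterlaces g h → m ≤ x → (g + h).eval x ≤ 0 →
        (g + h).eval m ≤ 0 := by
      intro h x H hmx hn
      have hmon := H.monotoneOn hroot (Set.mem_Ici.2 le_rfl) (Set.mem_Ici.2 hmx) hmx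
      simp only at hmon
      have gx := hroot x hmx
      have gm := hroot m le_rfl
      rw [eval_add] at hn ⊢
      have h1 : h.eval x / g.eval x ≤ -1 := by
        rw [div_le_iff₀ gx]; linarith
      have h2 : h.eval m / g.eval m ≤ -1 := hmon.trans h1
      rw [div_le_iff₀ gm] at h2
      linarith
    have a₁ := key x₁ H₁ (min_le_left _ _) h₁n
    have a₂ := key x₂ H₂ (min_le_right _ _) h₂n
    have := hpos m hρm
    nlinarith [mul_nonneg hp (neg_nonneg.2 a₁), mul_nonneg hq (neg_nonneg.2 a₂)]

end Polynomial

/-! ### Rank-one perturbations and transpositions -/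

-- By the Schur complement this is the determinant of a bordered matrix in which `s` occurs only in
-- the last row, and affinely.
open Polynomial in
theorem Matrix.exists_det_add_smul_vecMulVec {R n : Type*} [CommRing R] [Fintype n] [DecidableEq n]
    (K : Matrix n n R) (u v : n → R) :
    ∃ α β : R, ∀ s : R, (K + s • Matrix.vecMulVec u v).det = α + s * β := by
  set B : Matrix n Unit R := Matrix.replicateCol Unit u
  set Cr : Matrix Unit n R := Matrix.replicateRow Unit v
  set M : Matrix (n ⊕ Unit) (n ⊕ Unit) R := Matrix.fromBlocks K B 0 1 with hM
  refine ⟨(M.updateRow (Sum.inr ()) (Sum.elim 0 1)).det,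
    (M.updateRow (Sum.inr ()) (Sum.elim (-v) 0)).det, fun s => ?_⟩
  have h1 : (K + s • Matrix.vecMulVec u v).det = (Matrix.fromBlocks K B (-(s • Cr)) 1).det := by
    rw [Matrix.det_fromBlocks_one₂₂, Matrix.mul_neg, sub_neg_eq_add, Matrix.mul_smul,
      Matrix.vecMulVec_eq Unit]
  have h2 : Matrix.fromBlocks K B (-(s • Cr)) 1 = M.updateRow (Sum.inr ())
      (Sum.elim (0 : n → R) (1 : Unit → R) + s • Sum.elim (-v) (0 : Unit → R)) := by
    ext i j
    rcases i with i | i <;> rcases j with j | j <;>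
      simp [hM, Matrix.updateRow_apply, Cr]
  rw [h1, h2, Matrix.det_updateRow_add, Matrix.det_updateRow_smul]

open Polynomial in
theorem Matrix.charpoly_add_smul_vecMulVec {n : Type*} [Fintype n] [DecidableEq n]
    (B : Matrix n n ℝ) (v : n → ℝ) (s : ℝ) :
    (B + s • Matrix.vecMulVec v v).charpoly =
      B.charpoly + s • ((B + Matrix.vecMulVec v v).charpoly - B.charpoly) := by
  obtain ⟨α, β, h⟩ := Matrix.exists_det_add_smul_vecMulVec B.charmatrix
    (fun i => -C (v i)) (fun i => C (v i))
  have key : ∀ s : ℝ, (B + s • Matrix.vecMulVec v v).charpoly = α + C s * β := by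
    intro s
    rw [← h, Matrix.charpoly]
    congr 1
    ext1 i j
    simp only [Matrix.charmatrix, Matrix.sub_apply, Matrix.add_apply, Matrix.smul_apply,
      Matrix.vecMulVec_apply, RingHom.mapMatrix_apply, Matrix.map_apply, smul_eq_mul, C_add, C_mul]
    ring
  have h0 := key 0
  have h1 := key 1
  simp only [zero_smul, add_zero, one_smul, C_0, C_1, zero_mul, one_mul] at h0 h1
  rw [key, h0, h1, smul_eq_C_mul]
  ring

/-- A transposition is the reflection `1 - δ δᵀ` with `δ` the difference of two standard basis
vectors. Conjugation by it changes `A` by `-(δ yᵀ + y δᵀ)`, and polarization writes this as a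
difference of two squares. -/
theorem Matrix.IsSymm.exists_submatrix_swap {n : Type*} [DecidableEq n]
    {A : Matrix n n ℝ} (hA : A.IsSymm) (a b : n) :
    ∃ v w : n → ℝ, A.submatrix (Equiv.swap a b) (Equiv.swap a b) =
      A - Matrix.vecMulVec v v + Matrix.vecMulVec w w := by
  set δ : n → ℝ := fun i => (if i = a then 1 else 0) - (if i = b then 1 else 0) with hδ
  have key : ∀ (f : n → ℝ) (i : n), f (Equiv.swap a b i) = f i - δ i * (f a - f b) := by
    intro f i
    simp only [hδ, Equiv.swap_apply_def]
    split_ifs <;> subst_vars <;> simp_all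
  -- This is `A δ - (δᵀ A δ / 2) δ`: the last term splits the `δ δᵀ` contribution evenly between `δ
  -- yᵀ` and `y δᵀ`.
  set y : n → ℝ := fun i => (A a i - A b i) - (A a a - 2 * A a b + A b b) / 2 * δ i with hy
  have h2 : (√2 / 2 : ℝ) ^ 2 = 1 / 2 := by
    rw [div_pow, Real.sq_sqrt (by norm_num)]; norm_num
  refine ⟨fun i => √2 / 2 * (δ i + y i), fun i => √2 / 2 * (δ i - y i), ?_⟩
  ext i j
  have s1 : ∀ i j, A i j = A j i := fun i j => by
    have := congrFun (congrFun hA j) i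
    simpa using this
  have e : A.submatrix (Equiv.swap a b) (Equiv.swap a b) i j =
      A i j - δ i * y j - y i * δ j := by
    rw [Matrix.submatrix_apply, key (fun k => A k (Equiv.swap a b j)) i, key (A i) j, key (A a) j,
      key (A b) j, s1 i a, s1 i b, s1 b a]
    simp only [hy]
    ring
  rw [e]
  simp only [Matrix.add_apply, Matrix.sub_apply, Matrix.vecMulVec_apply]
  linear_combination (2 * (δ i * y j + y i * δ j)) * h2

open Polynomial in
theorem Matrix.IsSymm.stable_charpoly {n : Type*} [Fintype n] [DecidableEq n]
    {A : Matrix n n ℝ} (hA : A.IsSymm) : A.charpoly.Stable := by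
  have hH : A.IsHermitian := by
    rw [Matrix.IsHermitian, Matrix.conjTranspose_eq_transpose_of_trivial]; exact hA
  intro z hz h0
  rw [hH.charpoly_eq, map_prod, Finset.prod_eq_zero_iff] at h0
  obtain ⟨i, -, hi⟩ := h0
  have := congrArg Complex.im hi
  simp at this
  linarith

/-! ### Finite random walks on a group -/

section RandomWalk

variable {Γ M : Type*} [Group Γ] [AddCommGroup M] [Module ℝ M]

/-- The averaging operator of a finite random walk: for each entry `(s, p)` of the list, the walk
is multiplied on the left by `s` with probability `p`. -/
def walkAverage : List (Γ × ℝ) → (Γ → M) →ₗ[ℝ] (Γ → M)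
  | [] => LinearMap.id
  | (s, p) :: L =>
    (1 - p) • walkAverage L + p • (LinearMap.funLeft ℝ M (s * ·) ∘ₗ walkAverage L)

theorem walkAverage_cons (s : Γ) (p : ℝ) (L : List (Γ × ℝ)) (φ : Γ → M) (γ : Γ) :
    walkAverage ((s, p) :: L) φ γ =
      (1 - p) • walkAverage L φ γ + p • walkAverage L φ (s * γ) := rfl

theorem walkAverage_append (L L' : List (Γ × ℝ)) (φ : Γ → M) (γ : Γ) :
    walkAverage (L ++ L') φ γ = walkAverage L (walkAverage L' φ) γ := by
  induction L generalizing γ with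
  | nil => rfl
  | cons x L ih =>
    obtain ⟨s, p⟩ := x
    rw [List.cons_append, walkAverage_cons, walkAverage_cons, ih, ih]

theorem walkAverage_mul_right (L : List (Γ × ℝ)) (φ : Γ → M) (γ δ : Γ) :
    walkAverage L φ (γ * δ) = walkAverage L (fun x => φ (x * δ)) γ := by
  induction L generalizing γ with
  | nil => rfl
  | cons x L ih =>
    obtain ⟨s, p⟩ := x
    rw [walkAverage_cons, walkAverage_cons, ← mul_assoc, ih, ih]

/-- Used for coefficients of characteristic polynomials that are not changed by conjugating the
summands: averaging preserves a constant. -/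
theorem walkAverage_apply_of_forall {N : Type*} [AddCommGroup N] [Module ℝ N] (ℓ : M →ₗ[ℝ] N)
    (c : N) {φ : Γ → M} (h : ∀ γ, ℓ (φ γ) = c) (L : List (Γ × ℝ)) (γ : Γ) :
    ℓ (walkAverage L φ γ) = c := by
  induction L generalizing γ with
  | nil => exact h γ
  | cons x L ih =>
    obtain ⟨s, p⟩ := x
    rw [walkAverage_cons, map_add, map_smul, map_smul, ih, ih, ← add_smul]
    simp

end RandomWalk

/-! ### Expected characteristic polynomials of randomly conjugated families -/

section Interlacing

open Polynomial

variable {ι U Γ : Type*} [Group Γ]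
  (θ : ι → Γ →* Equiv.Perm U)

/-- The action of `Γ` on families of matrices by conjugation with permutation matrices. -/
def conjFamily (γ : Γ) (A : ι → Matrix U U ℝ) : ι → Matrix U U ℝ :=
  fun e => (A e).submatrix (θ e γ).symm (θ e γ).symm

theorem conjFamily_mul (γ δ : Γ) (A : ι → Matrix U U ℝ) :
    conjFamily θ (γ * δ) A = conjFamily θ γ (conjFamily θ δ A) := by
  ext e i j
  simp [conjFamily, Equiv.Perm.mul_def, map_mul]

theorem conjFamily_one (A : ι → Matrix U U ℝ) : conjFamily θ 1 A = A := by
  ext e i j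
  simp [conjFamily, Equiv.Perm.one_def]

variable [Fintype ι] [Fintype U] [DecidableEq U]

/-- The expected characteristic polynomial of the sum of a randomly conjugated family. -/
noncomputable def expectedCharpoly (L : List (Γ × ℝ)) (A : ι → Matrix U U ℝ) : ℝ[X] :=
  walkAverage L (fun γ => (∑ e, conjFamily θ γ A e).charpoly) 1

/-- Conditioning on the first step: as the walk commutes with right translations, a first step `s`
amounts to starting from the family conjugated by `s`. -/
theorem expectedCharpoly_cons (s : Γ) (p : ℝ) (L : List (Γ × ℝ)) (A : ι → Matrix U U ℝ) :
    expectedCharpoly θ ((s, p) :: L) A =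
      C (1 - p) * expectedCharpoly θ L A + C p * expectedCharpoly θ L (conjFamily θ s A) := by
  rw [expectedCharpoly, walkAverage_cons, ← smul_eq_C_mul, ← smul_eq_C_mul, mul_one,
    ← one_mul s, walkAverage_mul_right, one_mul]
  simp only [conjFamily_mul]
  rfl

theorem coeff_card_expectedCharpoly (L : List (Γ × ℝ)) (A : ι → Matrix U U ℝ) :
    (expectedCharpoly θ L A).coeff (Fintype.card U) = 1 := by
  refine walkAverage_apply_of_forall (lcoeff ℝ (Fintype.card U)) 1 (fun γ => ?_) L 1
  rw [lcoeff_apply, ← Matrix.charpoly_natDegree_eq_dim (∑ e, conjFamily θ γ A e)]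
  exact Matrix.charpoly_monic _

theorem coeff_expectedCharpoly_of_lt (L : List (Γ × ℝ)) (A : ι → Matrix U U ℝ) {n : ℕ}
    (hn : Fintype.card U < n) : (expectedCharpoly θ L A).coeff n = 0 := by
  refine walkAverage_apply_of_forall (lcoeff ℝ n) 0 (fun γ => ?_) L 1
  rw [lcoeff_apply]
  refine coeff_eq_zero_of_natDegree_lt ?_
  rwa [Matrix.charpoly_natDegree_eq_dim]

theorem natDegree_expectedCharpoly (L : List (Γ × ℝ)) (A : ι → Matrix U U ℝ) :
    (expectedCharpoly θ L A).natDegree = Fintype.card U :=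
  le_antisymm (natDegree_le_iff_coeff_eq_zero.2 fun _ hn => coeff_expectedCharpoly_of_lt θ L A hn)
    (le_natDegree_of_ne_zero (by rw [coeff_card_expectedCharpoly]; exact one_ne_zero))

theorem monic_expectedCharpoly (L : List (Γ × ℝ)) (A : ι → Matrix U U ℝ) :
    (expectedCharpoly θ L A).Monic := by
  rw [Monic, leadingCoeff, natDegree_expectedCharpoly, coeff_card_expectedCharpoly]

theorem coeff_pred_expectedCharpoly [Nonempty U] (L : List (Γ × ℝ)) (A : ι → Matrix U U ℝ) :
    (expectedCharpoly θ L A).coeff (Fintype.card U - 1) = -∑ e, (A e).trace := by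
  refine walkAverage_apply_of_forall (lcoeff ℝ _) _ (fun γ => ?_) L 1
  rw [lcoeff_apply, eq_neg_iff_add_eq_zero, add_comm, ← eq_neg_iff_add_eq_zero,
    ← Matrix.trace_eq_neg_charpoly_coeff, Matrix.trace_sum]
  refine Finset.sum_congr rfl fun e _ => ?_
  exact (Equiv.sum_comp (θ e γ).symm fun i => A e i i).symm

variable [DecidableEq ι]

/-- Conjugation keeps the perturbation of rank at most one, so each characteristic polynomial is
affine in `s`, and so is their average. -/
theorem expectedCharpoly_update_add_smul (L : List (Γ × ℝ)) (A : ι → Matrix U U ℝ) (e : ι)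
    (v : U → ℝ) (s : ℝ) :
    expectedCharpoly θ L (Function.update A e (A e + s • Matrix.vecMulVec v v)) =
      expectedCharpoly θ L A + C s *
        (expectedCharpoly θ L (Function.update A e (A e + Matrix.vecMulVec v v)) -
          expectedCharpoly θ L A) := by
  have key : ∀ (s : ℝ) (γ : Γ), ∑ e', conjFamily θ γ
      (Function.update A e (A e + s • Matrix.vecMulVec v v)) e' =
        ∑ e', conjFamily θ γ A e' + s • Matrix.vecMulVec (v ∘ (θ e γ).symm) (v ∘ (θ e γ).symm) := by
    intro s γ
    rw [← Finset.add_sum_erase _ _ (Finset.mem_univ e),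
      ← Finset.add_sum_erase _ (fun e' => conjFamily θ γ A e') (Finset.mem_univ e)]
    have h1 : ∀ e' ∈ Finset.univ.erase e, conjFamily θ γ
        (Function.update A e (A e + s • Matrix.vecMulVec v v)) e' = conjFamily θ γ A e' := by
      intro e' he'
      simp [conjFamily, Function.update_of_ne (Finset.ne_of_mem_erase he')]
    rw [Finset.sum_congr rfl h1]
    have h2 : conjFamily θ γ (Function.update A e (A e + s • Matrix.vecMulVec v v)) e =
        conjFamily θ γ A e +
          s • Matrix.vecMulVec (v ∘ (θ e γ).symm) (v ∘ (θ e γ).symm) := by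
      ext i j
      simp [conjFamily, Matrix.vecMulVec_apply]
    rw [h2]
    abel
  have k1 := key 1
  simp only [one_smul] at k1
  rw [← smul_eq_C_mul]
  simp only [expectedCharpoly, key, k1]
  simp_rw [fun γ => Matrix.charpoly_add_smul_vecMulVec (∑ e', conjFamily θ γ A e')
    (v ∘ (θ e γ).symm) s]
  change walkAverage L ((fun γ => (∑ e', conjFamily θ γ A e').charpoly) + s •
    ((fun γ => (∑ e', conjFamily θ γ A e' +
      Matrix.vecMulVec (v ∘ (θ e γ).symm) (v ∘ (θ e γ).symm)).charpoly) -
      (fun γ => (∑ e', conjFamily θ γ A e').charpoly))) 1 = _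
  rw [map_add, map_smul, map_sub]
  rfl

/-- By affinity, `g + s h` is itself the expected characteristic polynomial of a symmetric family,
hence stable. The sign comes from the second coefficient, which is minus the total trace and drops
by `∑ v i ^ 2`. -/
theorem lowerInterlaces_expectedCharpoly {L : List (Γ × ℝ)}
    (hst : ∀ A : ι → Matrix U U ℝ, (∀ e, (A e).IsSymm) → (expectedCharpoly θ L A).Stable)
    (A : ι → Matrix U U ℝ) (hA : ∀ e, (A e).IsSymm) (e : ι) (v : U → ℝ) :
    LowerInterlaces (expectedCharpoly θ L A)
      (expectedCharpoly θ L (Function.update A e (A e + Matrix.vecMulVec v v)) -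
        expectedCharpoly θ L A) := by
  have hvs : (Matrix.vecMulVec v v).IsSymm := by
    ext i j; simp [Matrix.vecMulVec_apply, mul_comm]
  refine ⟨monic_expectedCharpoly θ L A, ?_, ?_, fun s => ?_⟩
  · refine degree_sub_lt_right ?_ (monic_expectedCharpoly θ L A).ne_zero ?_
    · rw [degree_eq_natDegree (monic_expectedCharpoly θ L _).ne_zero,
        degree_eq_natDegree (monic_expectedCharpoly θ L _).ne_zero, natDegree_expectedCharpoly,
        natDegree_expectedCharpoly]
    · rw [(monic_expectedCharpoly θ L _).leadingCoeff, (monic_expectedCharpoly θ L _).leadingCoeff]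
  · rcases eq_or_ne v 0 with rfl | hv
    · left
      simp
    · right
      obtain ⟨i, hi⟩ := Function.ne_iff.1 hv
      have : Nonempty U := ⟨i⟩
      set h := expectedCharpoly θ L (Function.update A e (A e + Matrix.vecMulVec v v)) -
        expectedCharpoly θ L A with hh
      have hc : h.coeff (Fintype.card U - 1) = -∑ i, v i * v i := by
        rw [hh, coeff_sub, coeff_pred_expectedCharpoly, coeff_pred_expectedCharpoly,
          ← Finset.add_sum_erase _ _ (Finset.mem_univ e),
          ← Finset.add_sum_erase _ (fun e' => (A e').trace) (Finset.mem_univ e)]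
        rw [Finset.sum_congr rfl (g := fun e' => (A e').trace) fun e' he' => by
          rw [Function.update_of_ne (Finset.ne_of_mem_erase he')]]
        rw [Function.update_self, Matrix.trace_add, Matrix.trace_vecMulVec, dotProduct]
        ring
      have hneg : h.coeff (Fintype.card U - 1) < 0 := by
        rw [hc, neg_lt_zero]
        refine Finset.sum_pos' (fun i _ => mul_self_nonneg _) ⟨i, Finset.mem_univ _, ?_⟩
        exact mul_self_pos.2 (by simpa using hi)
      have hle : h.natDegree ≤ Fintype.card U - 1 := by
        refine natDegree_le_iff_coeff_eq_zero.2 fun m hm => ?_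
        rcases (show Fintype.card U ≤ m by omega).eq_or_lt with rfl | hlt
        · simp [hh, coeff_card_expectedCharpoly]
        · simp [hh, coeff_expectedCharpoly_of_lt θ L _ hlt]
      rw [leadingCoeff, le_antisymm hle (le_natDegree_of_ne_zero hneg.ne)]
      exact hneg
  · rw [← expectedCharpoly_update_add_smul]
    refine hst _ fun e' => ?_
    rcases eq_or_ne e' e with rfl | hne
    · rw [Function.update_self]
      exact (hA e').add (hvs.smul s)
    · rw [Function.update_of_ne hne]; exact hA e'

/-- The elements which act as a transposition on one matrix of a family and trivially on the
others. -/
def IsSwapStep (s : Γ) : Prop :=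
  ∃ e a b, θ e s = Equiv.swap a b ∧ ∀ e', e' ≠ e → θ e' s = 1

/-- The common interlacer belongs to the family with `A e` lowered to `A e - v vᵀ`. Adding `v vᵀ`
restores the family, and adding `w wᵀ` gives its conjugate by the transposition. -/
theorem IsSwapStep.exists_interlacer {s : Γ} (hs : IsSwapStep θ s) {L : List (Γ × ℝ)}
    (hst : ∀ A : ι → Matrix U U ℝ, (∀ e, (A e).IsSymm) → (expectedCharpoly θ L A).Stable)
    (A : ι → Matrix U U ℝ) (hA : ∀ e, (A e).IsSymm) :
    ∃ g h₁ h₂, LowerInterlaces g h₁ ∧ LowerInterlaces g h₂ ∧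
      expectedCharpoly θ L A = g + h₁ ∧ expectedCharpoly θ L (conjFamily θ s A) = g + h₂ := by
  obtain ⟨e, a, b, hab, htriv⟩ := hs
  obtain ⟨v, w, hvw⟩ := (hA e).exists_submatrix_swap a b
  have hvs : ∀ v : U → ℝ, (Matrix.vecMulVec v v).IsSymm := fun v => by
    ext i j; simp [Matrix.vecMulVec_apply, mul_comm]
  set B := Function.update A e (A e - Matrix.vecMulVec v v) with hB
  have hBs : ∀ e', (B e').IsSymm := by
    intro e'
    rcases eq_or_ne e' e with rfl | hne
    · rw [hB, Function.update_self]
      exact (hA e').sub (hvs v)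
    · rw [hB, Function.update_of_ne hne]; exact hA e'
  have h1 : Function.update B e (B e + Matrix.vecMulVec v v) = A := by
    rw [hB]; simp
  have h2 : Function.update B e (B e + Matrix.vecMulVec w w) = conjFamily θ s A := by
    ext1 e'
    rcases eq_or_ne e' e with rfl | hne
    · rw [Function.update_self, hB, Function.update_self, ← hvw, conjFamily, hab, Equiv.symm_swap]
    · rw [Function.update_of_ne hne, hB, Function.update_of_ne hne, conjFamily, htriv e' hne]
      rfl
  refine ⟨expectedCharpoly θ L B, _, _, lowerInterlaces_expectedCharpoly θ hst B hBs e v,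
    lowerInterlaces_expectedCharpoly θ hst B hBs e w, ?_, ?_⟩
  · rw [h1]; ring
  · rw [h2]; ring

/-- The induction must treat all symmetric families at once, because the interlacer for one family
comes from another, perturbed one. -/
theorem stable_expectedCharpoly (L : List (Γ × ℝ))
    (hL : ∀ x ∈ L, IsSwapStep θ x.1 ∧ 0 ≤ x.2 ∧ x.2 ≤ 1) :
    ∀ A : ι → Matrix U U ℝ, (∀ e, (A e).IsSymm) → (expectedCharpoly θ L A).Stable := by
  induction L with
  | nil =>
    intro A hA
    change (∑ e, conjFamily θ 1 A e).charpoly.Stable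
    rw [conjFamily_one]
    refine Matrix.IsSymm.stable_charpoly ?_
    rw [Matrix.IsSymm, Matrix.transpose_sum]
    exact Finset.sum_congr rfl fun e _ => hA e
  | cons x L ih =>
    obtain ⟨s, p⟩ := x
    intro A hA
    obtain ⟨hs, hp0, hp1⟩ := hL _ (List.mem_cons_self ..)
    have ih' := ih fun x hx => hL x (List.mem_cons_of_mem _ hx)
    obtain ⟨g, h₁, h₂, H₁, H₂, e₁, e₂⟩ := hs.exists_interlacer θ ih' A hA
    rw [expectedCharpoly_cons, e₁, e₂]
    exact H₁.stable_combination H₂ (by simpa using hp1) hp0 (by ring)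

/-- If the expected characteristic polynomial is positive beyond `ρ`, then so is the characteristic
polynomial of some conjugated family. -/
theorem exists_charpoly_pos (L : List (Γ × ℝ))
    (hL : ∀ x ∈ L, IsSwapStep θ x.1 ∧ 0 ≤ x.2 ∧ x.2 ≤ 1) (ρ : ℝ) :
    ∀ A : ι → Matrix U U ℝ, (∀ e, (A e).IsSymm) →
      (∀ x, ρ < x → 0 < (expectedCharpoly θ L A).eval x) →
      ∃ γ, ∀ x, ρ < x → 0 < (∑ e, conjFamily θ γ A e).charpoly.eval x := by
  induction L with
  | nil => exact fun A hA hpos => ⟨1, hpos⟩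
  | cons x L ih =>
    obtain ⟨s, p⟩ := x
    intro A hA hpos
    obtain ⟨hs, hp0, hp1⟩ := hL _ (List.mem_cons_self ..)
    have hL' : ∀ x ∈ L, IsSwapStep θ x.1 ∧ 0 ≤ x.2 ∧ x.2 ≤ 1 :=
      fun x hx => hL x (List.mem_cons_of_mem _ hx)
    obtain ⟨g, h₁, h₂, H₁, H₂, e₁, e₂⟩ :=
      hs.exists_interlacer θ (stable_expectedCharpoly θ L hL') A hA
    rcases H₁.pos_or_pos H₂ (p := 1 - p) (q := p) (by simpa using hp1) hp0 (ρ := ρ) (fun x hx => by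
      have := hpos x hx
      rw [expectedCharpoly_cons, e₁, e₂] at this
      simpa only [eval_add, eval_mul, eval_C] using this) with h | h
    · rw [← e₁] at h
      exact ih hL' A hA h
    · rw [← e₂] at h
      obtain ⟨γ, hγ⟩ := ih hL' (conjFamily θ s A) (fun e => (hA e).submatrix _) h
      refine ⟨γ * s, ?_⟩
      rwa [conjFamily_mul]

end Interlacing

/-! ### Uniform permutations as products of random transpositions -/

theorem Fintype.sum_sum_update {ι β M : Type*} [Fintype ι] [DecidableEq ι] [Fintype β]
    [AddCommMonoid M] (e : ι) (F : (ι → β) → M) :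
    ∑ h : β, ∑ g : ι → β, F (Function.update g e h) = Fintype.card β • ∑ g, F g := by
  let E : β × (ι → β) ≃ β × (ι → β) :=
    { toFun := fun x => (x.2 e, Function.update x.2 e x.1)
      invFun := fun x => (x.2 e, Function.update x.2 e x.1)
      left_inv := fun x => by simp
      right_inv := fun x => by simp }
  rw [← Fintype.sum_prod_type' (f := fun h g => F (Function.update g e h)),
    ← E.sum_comp]
  simp [E, Fintype.sum_prod_type]

/-- The permutations of `Fin (n + 1)` fixing `0`. -/
def Equiv.Perm.finSuccHom (n : ℕ) : Equiv.Perm (Fin n) →* Equiv.Perm (Fin (n + 1)) where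
  toFun e := Equiv.Perm.decomposeFin.symm (0, e)
  map_one' := by
    ext1 x
    refine Fin.cases ?_ (fun i => ?_) x <;> simp
  map_mul' e f := by
    ext1 x
    refine Fin.cases ?_ (fun i => ?_) x <;> simp

theorem Equiv.Perm.finSuccHom_zero {n : ℕ} (e : Equiv.Perm (Fin n)) :
    Equiv.Perm.finSuccHom n e 0 = 0 :=
  Equiv.Perm.decomposeFin_symm_apply_zero 0 e

theorem Equiv.Perm.finSuccHom_succ {n : ℕ} (e : Equiv.Perm (Fin n)) (i : Fin n) :
    Equiv.Perm.finSuccHom n e i.succ = (e i).succ := by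
  simp [Equiv.Perm.finSuccHom]

theorem Equiv.Perm.finSuccHom_swap {n : ℕ} (a b : Fin n) :
    Equiv.Perm.finSuccHom n (Equiv.swap a b) = Equiv.swap a.succ b.succ := by
  ext1 x
  refine Fin.cases ?_ (fun i => ?_) x
  · rw [Equiv.Perm.finSuccHom_zero, Equiv.swap_apply_of_ne_of_ne (Fin.succ_ne_zero a).symm
      (Fin.succ_ne_zero b).symm]
  · rw [Equiv.Perm.finSuccHom_succ, (Fin.succ_injective n).swap_apply]

theorem Equiv.Perm.sum_fin_succ {n : ℕ} {M : Type*} [AddCommMonoid M]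
    (F : Equiv.Perm (Fin (n + 1)) → M) :
    ∑ σ, F σ = ∑ a, ∑ e, F (Equiv.swap 0 a * Equiv.Perm.finSuccHom n e) := by
  rw [← Equiv.Perm.decomposeFin.symm.sum_comp, Fintype.sum_prod_type]
  refine Finset.sum_congr rfl fun a _ => Finset.sum_congr rfl fun e _ => congrArg F ?_
  ext1 x
  refine Fin.cases ?_ (fun i => ?_) x <;>
    simp [Equiv.Perm.finSuccHom_zero, Equiv.Perm.finSuccHom_succ]

theorem Equiv.Perm.sum_apply_zero {n : ℕ} {M : Type*} [AddCommMonoid M] (F : Fin (n + 1) → M) :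
    ∑ σ : Equiv.Perm (Fin (n + 1)), F (σ 0) = n.factorial • ∑ a, F a := by
  rw [Equiv.Perm.sum_fin_succ, Finset.smul_sum]
  refine Finset.sum_congr rfl fun a _ => ?_
  simp [Equiv.Perm.finSuccHom_zero, Fintype.card_perm]

/-- This identifies the double coset of `(0 1)` for the stabilizer of `0`: conjugating yields all
the transpositions that represent the nontrivial cosets. -/
theorem Equiv.Perm.finSuccHom_conj {m : ℕ} (h : Equiv.Perm (Fin (m + 1))) :
    Equiv.Perm.finSuccHom (m + 1) h * Equiv.swap 0 1 * (Equiv.Perm.finSuccHom (m + 1) h)⁻¹ =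
      Equiv.swap 0 (h 0).succ := by
  rw [mul_inv_eq_iff_eq_mul, Equiv.mul_swap_eq_swap_mul, Equiv.Perm.finSuccHom_zero]
  rw [show (1 : Fin (m + 2)) = (0 : Fin (m + 1)).succ from rfl, Equiv.Perm.finSuccHom_succ]

section UniformWalk

variable {Γ M : Type*} [Group Γ] [AddCommGroup M] [Module ℝ M]

/-- The uniform distribution on a symmetric group is a product of independent steps, each of which
either does nothing or applies a transposition. -/
theorem exists_walkAverage_perm (P : Γ → Prop) (n : ℕ) :
    ∀ j : Equiv.Perm (Fin n) →* Γ, (∀ a b, a ≠ b → P (j (Equiv.swap a b))) →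
      ∃ L : List (Γ × ℝ), (∀ x ∈ L, P x.1 ∧ 0 ≤ x.2 ∧ x.2 ≤ 1) ∧
        ∀ (φ : Γ → M) (γ : Γ), walkAverage L φ γ =
          (n.factorial : ℝ)⁻¹ • ∑ h, φ (j h * γ) := by
  induction n with
  | zero =>
    intro j _
    refine ⟨[], by simp, fun φ γ => ?_⟩
    simp [walkAverage, Subsingleton.elim (default : Equiv.Perm (Fin 0)) 1]
  | succ n ih =>
    intro j hj
    rcases n with _ | m
    · refine ⟨[], by simp, fun φ γ => ?_⟩
      simp [walkAverage, Subsingleton.elim (default : Equiv.Perm (Fin 1)) 1]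
    · set ι := Equiv.Perm.finSuccHom (m + 1) with hι
      obtain ⟨L, hL, hav⟩ := ih (j.comp ι) fun a b hab => by
        rw [MonoidHom.comp_apply, hι, Equiv.Perm.finSuccHom_swap]
        exact hj _ _ fun h => hab (Fin.succ_injective _ h)
      set s : Γ := j (Equiv.swap 0 1) with hs
      -- The symmetric group is the disjoint union of the stabilizer `S` of `0` and the double coset
      -- `S (0 1) S`, which contains the fraction `(m + 1) / (m + 2)` of all elements. So a uniform
      -- element of `S`, then `(0 1)` with this probability, then another uniform element of `S`
      -- give the uniform distribution.
      set p : ℝ := (m + 1) / (m + 2) with hp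
      have hp1 : p ≤ 1 := by rw [hp, div_le_one (by positivity)]; linarith
      refine ⟨L ++ (s, p) :: L, ?_, fun φ γ => ?_⟩
      · intro x hx
        rw [List.mem_append, List.mem_cons] at hx
        rcases hx with hx | rfl | hx
        · exact hL x hx
        · exact ⟨hj 0 1 (by simp), by positivity, hp1⟩
        · exact hL x hx
      · have hU : ∀ (γ : Γ) (k : Equiv.Perm (Fin (m + 1))), ∑ h, φ (j (ι h) * (j (ι k) * γ)) =
            ∑ h, φ (j (ι h) * γ) := by
          intro γ k
          rw [← Equiv.sum_comp (Equiv.mulRight k) (fun h => φ (j (ι h) * γ))]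
          simp [mul_assoc]
        have hS : ∑ k, ∑ h, φ (j (ι h) * (s * (j (ι k) * γ))) =
            m.factorial • ∑ a : Fin (m + 1), ∑ k, φ (j (Equiv.swap 0 a.succ * ι k) * γ) := by
          rw [Finset.sum_comm, ← Equiv.Perm.sum_apply_zero
            (fun a => ∑ k, φ (j (Equiv.swap 0 a.succ * ι k) * γ))]
          refine Finset.sum_congr rfl fun h _ => ?_
          rw [← Equiv.sum_comp (Equiv.mulLeft h⁻¹)]
          refine Finset.sum_congr rfl fun k _ => ?_
          rw [← Equiv.Perm.finSuccHom_conj h, ← hι]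
          simp [hs, mul_assoc]
        have hT : ∑ h, φ (j h * γ) = ∑ h, φ (j (ι h) * γ) +
            ∑ a : Fin (m + 1), ∑ k, φ (j (Equiv.swap 0 a.succ * ι k) * γ) := by
          rw [Equiv.Perm.sum_fin_succ (fun h => φ (j h * γ)), Fin.sum_univ_succ]
          simp [Equiv.swap_self, ← Equiv.Perm.one_def, hι]
        rw [walkAverage_append, hav]
        simp only [walkAverage_cons, hav, MonoidHom.comp_apply, hU]
        rw [Finset.sum_add_distrib, Finset.sum_const, ← Finset.smul_sum, ← Finset.smul_sum, hS, hT]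
        simp only [Finset.card_univ, Fintype.card_perm, Fintype.card_fin]
        rw [← Nat.cast_smul_eq_nsmul ℝ, ← Nat.cast_smul_eq_nsmul ℝ m.factorial, smul_add, smul_add]
        simp only [smul_smul]
        have hf : (m.factorial : ℝ) ≠ 0 := by positivity
        have hm1 : (m + 1 : ℝ) ≠ 0 := by positivity
        have hm2 : (m + 2 : ℝ) ≠ 0 := by positivity
        congr 2
        · rw [hp, Nat.factorial_succ (m + 1), Nat.factorial_succ m]
          push_cast
          field_simp
          ring
        · rw [hp, Nat.factorial_succ (m + 1), Nat.factorial_succ m]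
          push_cast
          field_simp
          ring

/-- The uniform distribution on a power of a symmetric group is a product of independent steps, each
of which either does nothing or applies a transposition in one coordinate. -/
theorem exists_walkAverage_pi {ι : Type*} [Fintype ι] [DecidableEq ι] (r : ℕ) :
    ∃ L : List ((ι → Equiv.Perm (Fin r)) × ℝ),
      (∀ x ∈ L, (∃ (e : ι) (a b : Fin r), x.1 = Pi.mulSingle e (Equiv.swap a b)) ∧ 0 ≤ x.2 ∧ x.2 ≤ 1) ∧
        ∀ (φ : (ι → Equiv.Perm (Fin r)) → M) γ, walkAverage L φ γ =
          (Fintype.card (ι → Equiv.Perm (Fin r)) : ℝ)⁻¹ • ∑ g, φ (g * γ) := by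
  set P : (ι → Equiv.Perm (Fin r)) → Prop :=
    fun x => ∃ (e : ι) (a b : Fin r), x = Pi.mulSingle e (Equiv.swap a b) with hP
  -- The coordinates in `s` are randomized uniformly and the others are left alone; coordinates are
  -- added one at a time.
  have key : ∀ s : Finset ι, ∃ L : List ((ι → Equiv.Perm (Fin r)) × ℝ),
      (∀ x ∈ L, P x.1 ∧ 0 ≤ x.2 ∧ x.2 ≤ 1) ∧
        ∀ (φ : (ι → Equiv.Perm (Fin r)) → M) γ, walkAverage L φ γ =
          (Fintype.card (ι → Equiv.Perm (Fin r)) : ℝ)⁻¹ •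
            ∑ g : ι → Equiv.Perm (Fin r), φ fun e => if e ∈ s then g e * γ e else γ e := by
    intro s
    induction s using Finset.induction_on with
    | empty =>
      refine ⟨[], by simp, fun φ γ => ?_⟩
      simp only [walkAverage, LinearMap.id_apply, Finset.notMem_empty, if_false, Finset.sum_const,
        Finset.card_univ]
      rw [← Nat.cast_smul_eq_nsmul ℝ, smul_smul, inv_mul_cancel₀, one_smul]
      exact Nat.cast_ne_zero.2 Fintype.card_ne_zero
    | insert e s he ih =>
      obtain ⟨L, hL, hav⟩ := ih
      obtain ⟨L', hL', hav'⟩ := exists_walkAverage_perm (M := M) P r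
        (MonoidHom.mulSingle (fun _ : ι => Equiv.Perm (Fin r)) e) fun a b _ => ⟨e, a, b, rfl⟩
      refine ⟨L' ++ L, ?_, fun φ γ => ?_⟩
      · intro x hx
        rcases List.mem_append.1 hx with hx | hx
        exacts [hL' x hx, hL x hx]
      · rw [walkAverage_append, hav']
        simp only [hav]
        rw [← Finset.smul_sum, smul_comm]
        congr 1
        set F : (ι → Equiv.Perm (Fin r)) → M :=
          fun g => φ fun e' => if e' ∈ insert e s then g e' * γ e' else γ e' with hF
        have h1 := Fintype.sum_sum_update e F
        rw [Fintype.card_perm, Fintype.card_fin, ← Nat.cast_smul_eq_nsmul ℝ] at h1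
        rw [inv_smul_eq_iff₀ (Nat.cast_ne_zero.2 (Nat.factorial_ne_zero r)), ← h1]
        refine Finset.sum_congr rfl fun h _ => Finset.sum_congr rfl fun g _ => ?_
        rw [hF]
        refine congrArg φ (funext fun e' => ?_)
        rcases eq_or_ne e' e with rfl | hne
        · simp [he]
        · simp [hne, Finset.mem_insert]
  obtain ⟨L, hL, hav⟩ := key Finset.univ
  exact ⟨L, hL, fun φ γ => by rw [hav]; simp; rfl⟩

end UniformWalk

/-! ### Sums of alternating functions over permutations -/

section AlternatingPair

variable {α : Type*} [DecidableEq α]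

/-- The elements of `K` which `σ` does not map into `I`. -/
def excess (I K : Finset α) (σ : Equiv.Perm α) : Finset α := K.filter fun k => σ k ∉ I

theorem mem_excess {I K : Finset α} {σ : Equiv.Perm α} {k : α} :
    k ∈ excess I K σ ↔ k ∈ K ∧ σ k ∉ I := Finset.mem_filter

theorem excess_congr {I K : Finset α} {σ τ : Equiv.Perm α}
    (h : ∀ k ∈ K, (σ k ∈ I ↔ τ k ∈ I)) : excess I K σ = excess I K τ :=
  Finset.filter_congr fun k hk => not_congr (h k hk)

/-- The elements of `K` sent into `I` correspond under `σ` to the elements of `I` that come from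
`K`. -/
theorem card_sdiff_excess (I K : Finset α) (σ : Equiv.Perm α) :
    K.card + (excess K I σ⁻¹).card = I.card + (excess I K σ).card := by
  have h1 : (K.filter fun k => σ k ∈ I).card = (I.filter fun i => σ⁻¹ i ∈ K).card :=
    Finset.card_bij' (fun k _ => σ k) (fun i _ => σ⁻¹ i)
      (fun k hk => by simp at hk ⊢; exact ⟨hk.2, hk.1⟩)
      (fun i hi => by simp at hi ⊢; exact ⟨hi.2, hi.1⟩) (by simp) (by simp)
  have h2 := Finset.card_filter_add_card_filter_not (s := K) (fun k => σ k ∈ I)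
  have h3 := Finset.card_filter_add_card_filter_not (s := I) (fun i => σ⁻¹ i ∈ K)
  simp only [excess]
  omega

variable [Fintype α]

/-- Exchanging the value of `σ` at `a` with `l`, while remembering the old value, is an involution
of the pairs `(σ, l)`. -/
theorem Equiv.Perm.sum_swap_mul {M : Type*} [AddCommMonoid M] (a : α)
    (G : Equiv.Perm α → α → M) :
    ∑ σ : Equiv.Perm α, ∑ l, G (Equiv.swap (σ a) l * σ) (σ a) = ∑ σ, ∑ l, G σ l := by
  let E : Equiv.Perm α × α ≃ Equiv.Perm α × α :=
    { toFun := fun x => (Equiv.swap (x.1 a) x.2 * x.1, x.1 a)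
      invFun := fun x => (Equiv.swap (x.1 a) x.2 * x.1, x.1 a)
      left_inv := fun x => by
        ext1
        · simp [← mul_assoc, Equiv.swap_comm x.2]
        · simp
      right_inv := fun x => by
        ext1
        · simp [← mul_assoc, Equiv.swap_comm x.2]
        · simp }
  have := E.sum_comp fun x => G x.1 x.2
  rw [Fintype.sum_prod_type, Fintype.sum_prod_type] at this
  exact this

/-- A function of two maps which, as a function of either of them, is the evaluation of an
alternating form, with arguments indexed by `I` and `K`, at vectors with zero sum. -/
structure AlternatingPair (I K : Finset α) (c : (α → α) → (α → α) → ℝ) : Prop where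
  congr_left : ∀ g g' h, (∀ i ∈ I, g i = g' i) → c g h = c g' h
  congr_right : ∀ g h h', (∀ k ∈ K, h k = h' k) → c g h = c g h'
  eq_zero_left : ∀ g h, ∀ i ∈ I, ∀ j ∈ I, i ≠ j → g i = g j → c g h = 0
  eq_zero_right : ∀ g h, ∀ i ∈ K, ∀ j ∈ K, i ≠ j → h i = h j → c g h = 0
  swap_left : ∀ g h, ∀ i ∈ I, ∀ j ∈ I, i ≠ j → c (g ∘ Equiv.swap i j) h = -c g h
  swap_right : ∀ g h, ∀ i ∈ K, ∀ j ∈ K, i ≠ j → c g (h ∘ Equiv.swap i j) = -c g h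
  sum_left : ∀ g h, ∀ i ∈ I, ∑ l, c (Function.update g i l) h = 0
  sum_right : ∀ g h, ∀ i ∈ K, ∑ l, c g (Function.update h i l) = 0

/-- The permutations with given excesses. -/
def excessClass (I K A B : Finset α) : Finset (Equiv.Perm α) :=
  Finset.univ.filter fun σ => excess I K σ = A ∧ excess K I σ⁻¹ = B

theorem mem_excessClass {I K A B : Finset α} {σ : Equiv.Perm α} :
    σ ∈ excessClass I K A B ↔ excess I K σ = A ∧ excess K I σ⁻¹ = B := by
  simp [excessClass]

theorem mem_excessClass_flip {I K A B : Finset α} {σ : Equiv.Perm α} :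
    σ⁻¹ ∈ excessClass K I B A ↔ σ ∈ excessClass I K A B := by
  rw [mem_excessClass, mem_excessClass, inv_inv, and_comm]

theorem sum_excessClass_flip {M : Type*} [AddCommMonoid M] (I K A B : Finset α)
    (F : Equiv.Perm α → M) :
    ∑ σ ∈ excessClass K I B A, F σ⁻¹ = ∑ σ ∈ excessClass I K A B, F σ :=
  Finset.sum_bij' (fun σ _ => σ⁻¹) (fun σ _ => σ⁻¹)
    (fun σ h => by rw [← mem_excessClass_flip, inv_inv]; exact h)
    (fun σ h => mem_excessClass_flip.2 h) (fun _ _ => inv_inv _) (fun _ _ => inv_inv _)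
    (fun _ _ => rfl)

theorem swap_mem_excessClass {I K B : Finset α} {a l : α} {σ : Equiv.Perm α}
    (hσ : σ ∈ excessClass I K {a} B) (hl : l ∉ I) :
    Equiv.swap (σ a) l * σ ∈ excessClass I K {a} B := by
  rw [mem_excessClass] at hσ ⊢
  have ha : σ a ∉ I := (mem_excess.1 (hσ.1 ▸ Finset.mem_singleton_self a)).2
  rw [← hσ.1, ← hσ.2]
  constructor
  · refine excess_congr fun k _ => ?_
    rw [Equiv.Perm.mul_apply, Equiv.swap_apply_def]
    split_ifs with h1 h2
    · rw [h1]; exact iff_of_false hl ha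
    · rw [h2]; exact iff_of_false ha hl
    · rfl
  · refine excess_congr fun i hi => ?_
    rw [mul_inv_rev, Equiv.swap_inv, Equiv.Perm.mul_apply, Equiv.swap_apply_of_ne_of_ne]
    · rintro rfl; exact ha hi
    · rintro rfl; exact hl hi

theorem sum_excessClass_swap {M : Type*} [AddCommMonoid M] (I K B : Finset α) (a : α)
    (F : Equiv.Perm α → M) :
    ∑ σ ∈ excessClass I K {a} B, ∑ l ∈ Iᶜ, F (Equiv.swap (σ a) l * σ) =
      Iᶜ.card • ∑ σ ∈ excessClass I K {a} B, F σ := by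
  have key := Equiv.Perm.sum_swap_mul a fun σ l =>
    if σ ∈ excessClass I K {a} B ∧ l ∉ I then F σ else 0
  have h1 : ∀ σ : Equiv.Perm α, ∑ l, (if σ ∈ excessClass I K {a} B ∧ l ∉ I then F σ else 0) =
      if σ ∈ excessClass I K {a} B then Iᶜ.card • F σ else 0 := by
    intro σ
    split_ifs with h
    · simp [h, Finset.sum_ite, Finset.filter_not, Finset.compl_eq_univ_sdiff]
    · simp [h]
  have h2 : ∀ σ : Equiv.Perm α, ∑ l, (if Equiv.swap (σ a) l * σ ∈ excessClass I K {a} B ∧ σ a ∉ I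
      then F (Equiv.swap (σ a) l * σ) else 0) =
      if σ ∈ excessClass I K {a} B then ∑ l ∈ Iᶜ, F (Equiv.swap (σ a) l * σ) else 0 := by
    intro σ
    split_ifs with h
    · have ha : σ a ∉ I :=
        (mem_excess.1 ((mem_excessClass.1 h).1 ▸ Finset.mem_singleton_self a)).2
      refine (Finset.sum_subset_zero_on_sdiff (Finset.subset_univ Iᶜ) (fun l hl => ?_)
        fun l hl => ?_).symm
      · have hl : l ∈ I := by simpa using hl
        rw [if_neg]
        rintro ⟨h', -⟩
        have := (mem_excess.1 ((mem_excessClass.1 h').1 ▸ Finset.mem_singleton_self a)).2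
        simp [hl] at this
      · rw [if_pos ⟨swap_mem_excessClass h (Finset.mem_compl.1 hl), ha⟩]
    · refine Finset.sum_eq_zero fun l _ => ?_
      rw [if_neg]
      rintro ⟨h', ha⟩
      refine h ?_
      have := swap_mem_excessClass h' ha
      simpa [← mul_assoc, Equiv.swap_comm l] using this
  simp only [h1, h2] at key
  rw [← Finset.sum_filter, ← Finset.sum_filter, Finset.filter_univ_mem, ← Finset.smul_sum] at key
  exact key

namespace AlternatingPair

variable {I K : Finset α} {c : (α → α) → (α → α) → ℝ}

theorem flip (H : AlternatingPair I K c) : AlternatingPair K I fun g h => c h g :=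
  ⟨fun g g' h => H.congr_right h g g', fun g h h' => H.congr_left h h' g,
    fun g h => H.eq_zero_right h g, fun g h => H.eq_zero_left h g,
    fun g h => H.swap_right h g, fun g h => H.swap_left h g,
    fun g h => H.sum_right h g, fun g h => H.sum_left h g⟩

/-- Composing with the transposition of two elements of `A` is a sign-reversing involution. It
exchanges two arguments on the right, while on the left nothing changes, because `σ⁻¹` does not take
these values on `I`. -/
theorem sum_eq_zero_of_one_lt_card (H : AlternatingPair I K c) {A B : Finset α}
    (hA : 1 < A.card) : ∑ σ ∈ excessClass I K A B, c ⇑σ⁻¹ ⇑σ = 0 := by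
  obtain ⟨a, ha, b, hb, hab⟩ := Finset.one_lt_card.1 hA
  have hmem : ∀ σ ∈ excessClass I K A B, (a ∈ K ∧ σ a ∉ I) ∧ (b ∈ K ∧ σ b ∉ I) := by
    intro σ hσ
    have h := (mem_excessClass.1 hσ).1
    exact ⟨mem_excess.1 (h ▸ ha), mem_excess.1 (h ▸ hb)⟩
  have hcl : ∀ σ ∈ excessClass I K A B, σ * Equiv.swap a b ∈ excessClass I K A B := by
    intro σ hσ
    obtain ⟨⟨haK, haI⟩, hbK, hbI⟩ := hmem σ hσ
    rw [mem_excessClass] at hσ ⊢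
    rw [← hσ.1, ← hσ.2]
    constructor
    · refine excess_congr fun k _ => ?_
      rw [Equiv.Perm.mul_apply, Equiv.swap_apply_def]
      split_ifs with h1 h2
      · rw [h1]; exact iff_of_false hbI haI
      · rw [h2]; exact iff_of_false haI hbI
      · rfl
    · refine excess_congr fun i _ => ?_
      rw [mul_inv_rev, Equiv.swap_inv, Equiv.Perm.mul_apply, Equiv.swap_apply_def]
      split_ifs with h1 h2
      · rw [h1]; exact iff_of_true hbK haK
      · rw [h2]; exact iff_of_true haK hbK
      · rfl
  have hneg : ∀ σ ∈ excessClass I K A B,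
      c ⇑(σ * Equiv.swap a b)⁻¹ ⇑(σ * Equiv.swap a b) = -c ⇑σ⁻¹ ⇑σ := by
    intro σ hσ
    obtain ⟨⟨haK, haI⟩, hbK, hbI⟩ := hmem σ hσ
    rw [Equiv.Perm.coe_mul, H.swap_right _ _ a haK b hbK hab, H.congr_left _ (⇑σ⁻¹)]
    intro i hi
    rw [mul_inv_rev, Equiv.swap_inv, Equiv.Perm.mul_apply, Equiv.swap_apply_of_ne_of_ne]
    · rintro h; rw [← h] at haI; simp [hi] at haI
    · rintro h; rw [← h] at hbI; simp [hi] at hbI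
  have : ∑ σ ∈ excessClass I K A B, c ⇑σ⁻¹ ⇑σ = -∑ σ ∈ excessClass I K A B, c ⇑σ⁻¹ ⇑σ := by
    rw [← Finset.sum_neg_distrib]
    refine Finset.sum_bij' (fun σ _ => σ * Equiv.swap a b) (fun σ _ => σ * Equiv.swap a b)
      hcl hcl ?_ ?_ ?_
    · intro σ _; simp [mul_assoc]
    · intro σ _; simp [mul_assoc]
    · intro σ hσ; rw [hneg σ hσ, neg_neg]
  linarith

/-- Let the value at `a` run over the complement of `I`. As the sum over all values vanishes, this
is minus the sum over the values in `I`. A value already taken on `K` repeats an argument and gives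
zero, so only the values in `B` remain. -/
theorem card_mul_sum_singleton (H : AlternatingPair I K c) (a : α) (B : Finset α) :
    (Iᶜ.card : ℝ) * ∑ σ ∈ excessClass I K {a} B, c ⇑σ⁻¹ ⇑σ =
      -∑ σ ∈ excessClass I K {a} B, ∑ b ∈ B, c ⇑σ⁻¹ (Function.update σ a b) := by
  rw [← nsmul_eq_mul, ← sum_excessClass_swap, eq_neg_iff_add_eq_zero, ← Finset.sum_add_distrib]
  refine Finset.sum_eq_zero fun σ hσ => ?_
  obtain ⟨hA, hB⟩ := mem_excessClass.1 hσ
  obtain ⟨haK, haI⟩ := mem_excess.1 (hA ▸ Finset.mem_singleton_self a)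
  have hBI : B ⊆ I := by rw [← hB]; exact Finset.filter_subset _ _
  rw [← H.sum_right ⇑σ⁻¹ σ a haK, ← Finset.sum_compl_add_sum I]
  congr 1
  · refine Finset.sum_congr rfl fun l hl => ?_
    have hl := Finset.mem_compl.1 hl
    rw [H.congr_left _ ⇑σ⁻¹, H.congr_right _ _ (Function.update σ a l)]
    · intro k hk
      rcases eq_or_ne k a with rfl | hka
      · simp
      · have hkI : σ k ∈ I := by
          by_contra hcon
          exact hka (Finset.mem_singleton.1 (hA ▸ mem_excess.2 ⟨hk, hcon⟩))
        rw [Function.update_of_ne hka, Equiv.Perm.mul_apply, Equiv.swap_apply_of_ne_of_ne]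
        · exact fun h => hka (σ.injective h)
        · rintro rfl; exact hl hkI
    · intro i hi
      rw [mul_inv_rev, Equiv.swap_inv, Equiv.Perm.mul_apply, Equiv.swap_apply_of_ne_of_ne]
      · rintro rfl; exact haI hi
      · rintro rfl; exact hl hi
  · refine (Finset.sum_subset hBI fun l hlI hlB => ?_)
    have hlK : σ⁻¹ l ∈ K := by
      by_contra hcon
      exact hlB (hB ▸ mem_excess.2 ⟨hlI, hcon⟩)
    have hne : σ⁻¹ l ≠ a := by
      rintro rfl; simp [hlI] at haI
    refine H.eq_zero_right _ _ _ hlK a haK hne ?_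
    rw [Function.update_of_ne hne, Function.update_self]
    simp

/-- The same replacement on the left: the argument of `σ⁻¹` at `b` runs over the complement of `K`,
and the only surviving value in `K` is `a`. -/
theorem card_mul_sum_update (H : AlternatingPair I K c) (a b : α) (ha : a ∈ K) :
    (Kᶜ.card : ℝ) * ∑ σ ∈ excessClass I K {a} {b}, c ⇑σ⁻¹ (Function.update σ a b) =
      -∑ σ ∈ excessClass I K {a} {b}, c (Function.update ⇑σ⁻¹ b a) (Function.update σ a b) := by
  rw [← sum_excessClass_flip I K {a} {b} fun σ => c ⇑σ⁻¹ (Function.update σ a b),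
    ← sum_excessClass_flip I K {a} {b} fun σ =>
      c (Function.update ⇑σ⁻¹ b a) (Function.update σ a b),
    ← nsmul_eq_mul, ← sum_excessClass_swap, eq_neg_iff_add_eq_zero, ← Finset.sum_add_distrib]
  refine Finset.sum_eq_zero fun σ hσ => ?_
  obtain ⟨hB, hA⟩ := mem_excessClass.1 hσ
  obtain ⟨hbI, hbK⟩ := mem_excess.1 (hB ▸ Finset.mem_singleton_self b)
  simp only [inv_inv]
  rw [← H.sum_left σ (Function.update ⇑σ⁻¹ a b) b hbI, ← Finset.sum_compl_add_sum K]
  congr 1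
  · refine Finset.sum_congr rfl fun l hl => ?_
    have hl := Finset.mem_compl.1 hl
    rw [H.congr_left _ (Function.update σ b l), H.congr_right _ _ (Function.update ⇑σ⁻¹ a b)]
    · intro k hk
      rcases eq_or_ne k a with rfl | hka
      · simp
      · rw [Function.update_of_ne hka, Function.update_of_ne hka, mul_inv_rev, Equiv.swap_inv,
          Equiv.Perm.mul_apply, Equiv.swap_apply_of_ne_of_ne]
        · rintro rfl; exact hbK hk
        · rintro rfl; exact hl hk
    · intro i hi
      rcases eq_or_ne i b with rfl | hib
      · simp
      · have hiK : σ i ∈ K := by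
          by_contra hcon
          exact hib (Finset.mem_singleton.1 (hB ▸ mem_excess.2 ⟨hi, hcon⟩))
        rw [Function.update_of_ne hib, Equiv.Perm.mul_apply, Equiv.swap_apply_of_ne_of_ne]
        · exact fun h => hib (σ.injective h)
        · rintro rfl; exact hl hiK
  · rw [Finset.sum_eq_single_of_mem a ha]
    intro l hlK hla
    have hlI : σ⁻¹ l ∈ I := by
      by_contra hcon
      exact hla (Finset.mem_singleton.1 (hA ▸ mem_excess.2 ⟨hlK, hcon⟩))
    have hne : σ⁻¹ l ≠ b := by
      rintro rfl; simp [hlK] at hbK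
    refine H.eq_zero_left _ _ _ hlI b hbI hne ?_
    rw [Function.update_of_ne hne, Function.update_self]
    simp

theorem mem_excessClass_empty {σ : Equiv.Perm α} :
    σ ∈ excessClass I K ∅ ∅ ↔ (∀ k ∈ K, σ k ∈ I) ∧ ∀ i ∈ I, σ⁻¹ i ∈ K := by
  simp [mem_excessClass, excess, Finset.filter_eq_empty_iff]

theorem swap_mem_excessClass_empty {a b : α} (ha : a ∈ K) (hb : b ∈ I) {σ : Equiv.Perm α} :
    Equiv.swap (σ a) b * σ ∈ excessClass I K ∅ ∅ ∧ σ a ∉ I ↔ σ ∈ excessClass I K {a} {b} := by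
  constructor
  · rintro ⟨h, haI⟩
    obtain ⟨h1, h2⟩ := mem_excessClass_empty.1 h
    rw [mem_excessClass]
    constructor
    · ext k
      rw [mem_excess, Finset.mem_singleton]
      constructor
      · rintro ⟨hk, hkI⟩
        by_contra hka
        have := h1 k hk
        rw [Equiv.Perm.mul_apply, Equiv.swap_apply_of_ne_of_ne (fun h => hka (σ.injective h))
          (by rintro rfl; exact hkI hb)] at this
        exact hkI this
      · rintro rfl; exact ⟨ha, haI⟩
    · ext i
      rw [mem_excess, Finset.mem_singleton]
      constructor
      · rintro ⟨hi, hiK⟩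
        by_contra hib
        have := h2 i hi
        rw [mul_inv_rev, Equiv.swap_inv, Equiv.Perm.mul_apply,
          Equiv.swap_apply_of_ne_of_ne (by rintro rfl; exact haI hi) hib] at this
        exact hiK this
      · rintro rfl
        refine ⟨hb, fun hcon => ?_⟩
        have := h1 _ hcon
        rw [Equiv.Perm.mul_apply, ← Equiv.Perm.mul_apply σ, mul_inv_cancel, Equiv.Perm.one_apply,
          Equiv.swap_apply_right] at this
        exact haI this
  · intro hσ
    obtain ⟨hA, hB⟩ := mem_excessClass.1 hσ
    have haI := (mem_excess.1 (hA ▸ Finset.mem_singleton_self a)).2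
    have hbK := (mem_excess.1 (hB ▸ Finset.mem_singleton_self b)).2
    refine ⟨mem_excessClass_empty.2 ⟨fun k hk => ?_, fun i hi => ?_⟩, haI⟩
    · rcases eq_or_ne k a with rfl | hka
      · simpa using hb
      · have hkI : σ k ∈ I := by
          by_contra hcon
          exact hka (Finset.mem_singleton.1 (hA ▸ mem_excess.2 ⟨hk, hcon⟩))
        rw [Equiv.Perm.mul_apply, Equiv.swap_apply_of_ne_of_ne (fun h => hka (σ.injective h))]
        · exact hkI
        · rintro rfl; simp [hk] at hbK
    · rw [mul_inv_rev, Equiv.swap_inv, Equiv.Perm.mul_apply]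
      rcases eq_or_ne i b with rfl | hib
      · simpa using ha
      · have hiK : σ⁻¹ i ∈ K := by
          by_contra hcon
          exact hib (Finset.mem_singleton.1 (hB ▸ mem_excess.2 ⟨hi, hcon⟩))
        rw [Equiv.swap_apply_of_ne_of_ne (by rintro rfl; exact haI hi) hib]
        exact hiK

/-- After both updates the arguments are those of a permutation `τ` mapping `K` onto `I` with `τ a =
b`. The old value `σ a`, an arbitrary element outside `I`, is forgotten, which gives the factor. -/
theorem sum_update_update (H : AlternatingPair I K c) {a b : α} (ha : a ∈ K) (hb : b ∈ I) :
    ∑ σ ∈ excessClass I K {a} {b}, c (Function.update ⇑σ⁻¹ b a) (Function.update σ a b) =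
      (Iᶜ.card : ℝ) * ∑ τ ∈ (excessClass I K ∅ ∅).filter (fun τ => τ a = b), c ⇑τ⁻¹ ⇑τ := by
  have key := Equiv.Perm.sum_swap_mul a fun σ l =>
    if σ ∈ (excessClass I K ∅ ∅).filter (fun τ => τ a = b) ∧ l ∉ I then c ⇑σ⁻¹ ⇑σ else 0
  have h1 : ∀ σ : Equiv.Perm α, ∑ l,
      (if σ ∈ (excessClass I K ∅ ∅).filter (fun τ => τ a = b) ∧ l ∉ I then c ⇑σ⁻¹ ⇑σ else 0) =
      if σ ∈ (excessClass I K ∅ ∅).filter (fun τ => τ a = b) then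
        (Iᶜ.card : ℝ) * c ⇑σ⁻¹ ⇑σ else 0 := by
    intro σ
    split_ifs with h
    · simp only [h, true_and]
      rw [Finset.sum_ite, Finset.sum_const_zero, add_zero, Finset.sum_const, nsmul_eq_mul]
      congr 2
      refine congrArg _ ?_
      ext; simp
    · simp [h]
  have h2 : ∀ σ : Equiv.Perm α, ∑ l, (if Equiv.swap (σ a) l * σ ∈
      (excessClass I K ∅ ∅).filter (fun τ => τ a = b) ∧ σ a ∉ I then
        c ⇑(Equiv.swap (σ a) l * σ)⁻¹ ⇑(Equiv.swap (σ a) l * σ) else 0) =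
      if σ ∈ excessClass I K {a} {b} then
        c (Function.update ⇑σ⁻¹ b a) (Function.update σ a b) else 0 := by
    intro σ
    rw [Finset.sum_eq_single b]
    · have hiff : (Equiv.swap (σ a) b * σ ∈ (excessClass I K ∅ ∅).filter (fun τ => τ a = b) ∧
          σ a ∉ I) ↔ σ ∈ excessClass I K {a} {b} := by
        rw [← swap_mem_excessClass_empty ha hb, Finset.mem_filter]
        simp
      rw [if_congr hiff rfl rfl]
      split_ifs with hσ
      · obtain ⟨hA, hB⟩ := mem_excessClass.1 hσ
        have haI := (mem_excess.1 (hA ▸ Finset.mem_singleton_self a)).2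
        have hbK := (mem_excess.1 (hB ▸ Finset.mem_singleton_self b)).2
        rw [H.congr_left _ (Function.update ⇑σ⁻¹ b a), H.congr_right _ _ (Function.update σ a b)]
        · intro k hk
          rcases eq_or_ne k a with rfl | hka
          · simp
          · rw [Function.update_of_ne hka, Equiv.Perm.mul_apply,
              Equiv.swap_apply_of_ne_of_ne (fun h => hka (σ.injective h))]
            rintro rfl; simp [hk] at hbK
        · intro i hi
          rcases eq_or_ne i b with rfl | hib
          · simp
          · rw [Function.update_of_ne hib, mul_inv_rev, Equiv.swap_inv, Equiv.Perm.mul_apply,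
              Equiv.swap_apply_of_ne_of_ne (by rintro rfl; exact haI hi) hib]
      · rfl
    · intro l _ hlb
      rw [if_neg]
      rintro ⟨h, -⟩
      have := (Finset.mem_filter.1 h).2
      simp only [Equiv.Perm.mul_apply, Equiv.swap_apply_left] at this
      exact hlb this
    · simp
  simp only [h1, h2] at key
  rw [← Finset.sum_filter, ← Finset.sum_filter, Finset.filter_univ_mem, Finset.filter_univ_mem,
    ← Finset.mul_sum] at key
  exact key

/-- The two replacements each contribute a minus sign, and these cancel. The complements have equal
size when `I.card = K.card`; otherwise no permutation occurs on either side. -/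
theorem card_mul_sum_singleton_singleton (H : AlternatingPair I K c) {a b : α} (ha : a ∈ K)
    (hb : b ∈ I) (hI : I.card < Fintype.card α) :
    (Iᶜ.card : ℝ) * ∑ σ ∈ excessClass I K {a} {b}, c ⇑σ⁻¹ ⇑σ =
      ∑ τ ∈ (excessClass I K ∅ ∅).filter (fun τ => τ a = b), c ⇑τ⁻¹ ⇑τ := by
  by_cases hIK : I.card = K.card
  · have h1 := H.card_mul_sum_singleton a {b}
    have h2 := H.card_mul_sum_update a b ha
    rw [H.sum_update_update ha hb] at h2
    simp only [Finset.sum_singleton] at h1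
    have hc : (Kᶜ.card : ℝ) = Iᶜ.card := by rw [Finset.card_compl, Finset.card_compl, hIK]
    have hpos : (Iᶜ.card : ℝ) ≠ 0 := by
      rw [Finset.card_compl]; exact Nat.cast_ne_zero.2 (by omega)
    rw [hc] at h2
    rw [h1]
    refine mul_left_cancel₀ hpos ?_
    linarith
  · rw [Finset.sum_eq_zero, Finset.sum_eq_zero, mul_zero]
    · intro τ hτ
      obtain ⟨hA, hB⟩ := mem_excessClass.1 (Finset.mem_filter.1 hτ).1
      have := card_sdiff_excess I K τ
      rw [hA, hB] at this
      simp at this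
      omega
    · intro τ hτ
      obtain ⟨hA, hB⟩ := mem_excessClass.1 hτ
      have := card_sdiff_excess I K τ
      rw [hA, hB] at this
      simp at this
      omega

/-- The sum over all permutations reduces to the permutations mapping `K` onto `I`. -/
theorem card_mul_sum (H : AlternatingPair I K c) (hI : I.card < Fintype.card α)
    (hK : K.card < Fintype.card α) :
    (Iᶜ.card : ℝ) * ∑ σ : Equiv.Perm α, c ⇑σ⁻¹ ⇑σ =
      Fintype.card α * ∑ τ ∈ excessClass I K ∅ ∅, c ⇑τ⁻¹ ⇑τ := by
  set S : Finset α → Finset α → ℝ := fun A B => ∑ σ ∈ excessClass I K A B, c ⇑σ⁻¹ ⇑σ with hS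
  have hIc : (Iᶜ.card : ℝ) ≠ 0 := by
    rw [Finset.card_compl]; exact Nat.cast_ne_zero.2 (by omega)
  have hKc : (Kᶜ.card : ℝ) ≠ 0 := by
    rw [Finset.card_compl]; exact Nat.cast_ne_zero.2 (by omega)
  have hflip : ∀ A B, S A B = ∑ σ ∈ excessClass K I B A, c ⇑σ ⇑σ⁻¹ := by
    intro A B
    rw [hS]
    simp only
    rw [← sum_excessClass_flip]
    simp
  have hA : ∀ A B, 1 < A.card → S A B = 0 := fun A B h => H.sum_eq_zero_of_one_lt_card h
  have hB : ∀ A B, 1 < B.card → S A B = 0 := fun A B h => by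
    rw [hflip]
    exact H.flip.sum_eq_zero_of_one_lt_card h
  have hA0 : ∀ a, S {a} ∅ = 0 := fun a => by
    have := H.card_mul_sum_singleton a ∅
    simp only [Finset.sum_empty, Finset.sum_const_zero, neg_zero] at this
    exact (mul_eq_zero.1 this).resolve_left hIc
  have hB0 : ∀ b, S ∅ {b} = 0 := fun b => by
    have := H.flip.card_mul_sum_singleton b ∅
    simp only [Finset.sum_empty, Finset.sum_const_zero, neg_zero] at this
    rw [hflip]
    exact (mul_eq_zero.1 this).resolve_left hKc
  have htot : ∑ σ : Equiv.Perm α, c ⇑σ⁻¹ ⇑σ = ∑ A ∈ K.powerset, ∑ B ∈ I.powerset, S A B := by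
    rw [← Finset.sum_product', ← Finset.sum_fiberwise_of_maps_to
      (g := fun σ : Equiv.Perm α => (excess I K σ, excess K I σ⁻¹)) (t := K.powerset ×ˢ I.powerset)
      (fun σ _ => by simp [excess, Finset.filter_subset])]
    refine Finset.sum_congr rfl fun x _ => ?_
    rw [hS]
    refine Finset.sum_congr ?_ fun _ _ => rfl
    ext σ
    simp [mem_excessClass, Prod.ext_iff]
  have hrow : ∀ A ∈ K.powerset, ∑ B ∈ I.powerset, S A B =
      if A = ∅ then S ∅ ∅ else if A.card = 1 then ∑ b ∈ I, S A {b} else 0 := by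
    intro A hAK
    rcases Nat.lt_trichotomy A.card 1 with h | h | h
    · obtain rfl : A = ∅ := Finset.card_eq_zero.1 (by omega)
      rw [if_pos rfl]
      refine Finset.sum_eq_single_of_mem ∅ (by simp) fun B _ hB' => ?_
      rcases Nat.lt_or_ge 1 B.card with h' | h'
      · exact hB _ _ h'
      · obtain ⟨b, rfl⟩ := Finset.card_eq_one.1
          (le_antisymm h' (Finset.card_pos.2 (Finset.nonempty_iff_ne_empty.2 hB')))
        exact hB0 b
    · obtain ⟨a, rfl⟩ := Finset.card_eq_one.1 h
      rw [if_neg (Finset.singleton_ne_empty a), if_pos h]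
      rw [← Finset.sum_subset (s₁ := I.image fun b => ({b} : Finset α))]
      · rw [Finset.sum_image]
        intro x _ y _ hxy
        exact Finset.singleton_injective hxy
      · intro B hB'
        obtain ⟨b, hb, rfl⟩ := Finset.mem_image.1 hB'
        simpa using hb
      · intro B hBI hB'
        rcases Nat.lt_trichotomy B.card 1 with h' | h' | h'
        · obtain rfl : B = ∅ := Finset.card_eq_zero.1 (by omega)
          exact hA0 a
        · obtain ⟨b, rfl⟩ := Finset.card_eq_one.1 h'
          exact absurd (Finset.mem_image.2 ⟨b, by simpa using hBI, rfl⟩) hB'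
        · exact hB _ _ h'
    · rw [if_neg (by rintro rfl; simp at h), if_neg (by omega)]
      exact Finset.sum_eq_zero fun B _ => hA _ _ h
  -- All other excess classes vanish: those with an excess of two or more by antisymmetry, those
  -- with just one excess a singleton and the other empty by the zero sums.
  have htot' : ∑ σ : Equiv.Perm α, c ⇑σ⁻¹ ⇑σ = S ∅ ∅ + ∑ a ∈ K, ∑ b ∈ I, S {a} {b} := by
    rw [htot, Finset.sum_congr rfl hrow, ← Finset.add_sum_erase _ _ (Finset.empty_mem_powerset K),
      if_pos rfl]
    congr 1
    rw [← Finset.sum_subset (s₁ := K.image fun a => ({a} : Finset α))]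
    · rw [Finset.sum_image]
      · refine Finset.sum_congr rfl fun a _ => ?_
        simp
      · intro x _ y _ hxy
        exact Finset.singleton_injective hxy
    · intro B hB'
      obtain ⟨b, hb, rfl⟩ := Finset.mem_image.1 hB'
      simpa using hb
    · intro A hAK hA'
      rw [if_neg (Finset.ne_of_mem_erase hAK), if_neg]
      intro h
      obtain ⟨a, rfl⟩ := Finset.card_eq_one.1 h
      exact hA' (Finset.mem_image.2 ⟨a, by simpa using Finset.mem_of_mem_erase hAK, rfl⟩)
  -- For each `b` in `I`, a permutation mapping `K` onto `I` has `τ a = b` for exactly one `a` in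
  -- `K`, so it is counted `I.card` times.
  have hdiag : (Iᶜ.card : ℝ) * ∑ a ∈ K, ∑ b ∈ I, S {a} {b} = I.card * S ∅ ∅ := by
    rw [Finset.sum_comm, Finset.mul_sum, ← nsmul_eq_mul, ← Finset.sum_const]
    refine Finset.sum_congr rfl fun b hb => ?_
    rw [Finset.mul_sum, Finset.sum_congr rfl fun a ha =>
      H.card_mul_sum_singleton_singleton ha hb hI]
    have : ∀ a ∈ K, ((excessClass I K ∅ ∅).filter fun τ => τ a = b) =
        (excessClass I K ∅ ∅).filter fun τ => τ⁻¹ b = a := by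
      intro a _
      refine Finset.filter_congr fun τ _ => ?_
      rw [Equiv.Perm.inv_eq_iff_eq, eq_comm]
    rw [Finset.sum_congr rfl fun a ha => by rw [this a ha]]
    exact Finset.sum_fiberwise_of_maps_to (g := fun τ : Equiv.Perm α => τ⁻¹ b)
      (fun τ hτ => (mem_excessClass_empty.1 hτ).2 b hb) _
  rw [htot', mul_add, hdiag, ← add_mul]
  congr 1
  rw [← Nat.cast_add, Finset.card_compl_add_card]

end AlternatingPair

end AlternatingPair

/-- Decompose by the value `a` at `0`. For `a ∈ I` no permutation maps `K` onto `I`, since `0 ∉ K`.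
For each `a` outside `I` the contribution is that of the stabilizer of `0`, because `swap 0 a` fixes
`I`. The number of such `a` cancels the factor in `card_mul_sum`. -/
theorem AlternatingPair.sum_eq_mul_sum_finSucc {d : ℕ} {I K : Finset (Fin (d + 1))}
    {c : (Fin (d + 1) → Fin (d + 1)) → (Fin (d + 1) → Fin (d + 1)) → ℝ}
    (H : AlternatingPair I K c) (hI : 0 ∉ I) (hK : 0 ∉ K) :
    ∑ σ : Equiv.Perm (Fin (d + 1)), c ⇑σ⁻¹ ⇑σ = (d + 1) * ∑ e : Equiv.Perm (Fin d),
      if Equiv.Perm.finSuccHom d e ∈ excessClass I K ∅ ∅ then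
        c ⇑(Equiv.Perm.finSuccHom d e)⁻¹ ⇑(Equiv.Perm.finSuccHom d e) else 0 := by
  have hcard : ∀ J : Finset (Fin (d + 1)), 0 ∉ J → J.card < Fintype.card (Fin (d + 1)) :=
    fun J hJ => Finset.card_lt_univ_of_notMem hJ
  have hIc : (Iᶜ.card : ℝ) ≠ 0 := by
    rw [Finset.card_compl]
    have := hcard I hI
    exact Nat.cast_ne_zero.2 (by omega)
  refine mul_left_cancel₀ hIc ?_
  rw [H.card_mul_sum (hcard I hI) (hcard K hK), Fintype.card_fin, mul_left_comm, Nat.cast_add_one]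
  congr 1
  rw [← Finset.filter_univ_mem (excessClass I K ∅ ∅), Finset.sum_filter, Equiv.Perm.sum_fin_succ,
    ← Finset.sum_subset (Finset.subset_univ Iᶜ), ← nsmul_eq_mul, ← Finset.sum_const]
  · refine Finset.sum_congr rfl fun a ha => Finset.sum_congr rfl fun e _ => ?_
    have ha := Finset.mem_compl.1 ha
    set τ := Equiv.Perm.finSuccHom d e with hτ
    have h0 : τ 0 = 0 := Equiv.Perm.finSuccHom_zero e
    have hsw : ∀ x ∈ I, Equiv.swap 0 a x = x := fun x hx =>
      Equiv.swap_apply_of_ne_of_ne (by rintro rfl; exact hI hx) (by rintro rfl; exact ha hx)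
    have hinv : ∀ i ∈ I, (Equiv.swap 0 a * τ)⁻¹ i = τ⁻¹ i := fun i hi => by
      rw [mul_inv_rev, Equiv.swap_inv, Equiv.Perm.mul_apply, hsw i hi]
    have hmem : Equiv.swap 0 a * τ ∈ excessClass I K ∅ ∅ ↔ τ ∈ excessClass I K ∅ ∅ := by
      rw [AlternatingPair.mem_excessClass_empty, AlternatingPair.mem_excessClass_empty]
      refine and_congr (forall₂_congr fun k hk => ?_) (forall₂_congr fun i hi => by rw [hinv i hi])
      rw [Equiv.Perm.mul_apply]
      constructor
      · intro h
        have := hsw _ h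
        rw [Equiv.swap_apply_self] at this
        rwa [this]
      · intro h; rwa [hsw _ h]
    simp only [Finset.mem_filter, Finset.mem_univ, true_and, hmem]
    split_ifs with h
    · rw [H.congr_left _ _ _ hinv, H.congr_right]
      intro k hk
      rw [Equiv.Perm.mul_apply, hsw _ ((AlternatingPair.mem_excessClass_empty.1 h).1 k hk)]
    · rfl
  · intro a _ ha
    have ha : a ∈ I := by simpa using ha
    refine Finset.sum_eq_zero fun e _ => ?_
    rw [if_neg]
    intro h
    have := (AlternatingPair.mem_excessClass_empty.1 (by simpa using h)).2 a ha
    rw [mul_inv_rev, Equiv.swap_inv, Equiv.Perm.mul_apply, Equiv.swap_apply_right,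
      Equiv.Perm.inv_eq_iff_eq.2 (Equiv.Perm.finSuccHom_zero e).symm] at this
    exact hK this

/-! ### Exchanging the standard representation for signed permutations -/

section Exchange

variable {d : ℕ}

/-- The matrix of a permutation of `d + 1` points on the vectors with zero sum, in the basis of the
differences of the standard basis vectors with the first one. -/
def stdMatrix (σ : Equiv.Perm (Fin (d + 1))) : Matrix (Fin d) (Fin d) ℝ :=
  Matrix.of fun i j => (if σ j.succ = i.succ then 1 else 0) - (if σ 0 = i.succ then 1 else 0)

/-- A signed permutation matrix. -/
def signedPermMatrix (τ : Equiv.Perm (Fin d)) (ε : Fin d → ℤˣ) : Matrix (Fin d) (Fin d) ℝ :=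
  Matrix.of fun i j => if τ j = i then ((ε i : ℤ) : ℝ) else 0

variable {E : Type*} [AddCommGroup E]

/-- The extension of a family of `d` vectors to `d + 1` vectors with zero sum. -/
def zeroSumExtend (b : Fin d → E) : Fin (d + 1) → E := Fin.cons (-∑ j, b j) b

theorem sum_zeroSumExtend (b : Fin d → E) : ∑ l, zeroSumExtend b l = 0 := by
  rw [Fin.sum_univ_succ]
  simp [zeroSumExtend]

variable [Module ℝ E]

/-- In terms of `d + 1` vectors with zero sum, the standard representation just permutes them. This
is what makes `AlternatingPair` applicable. -/
theorem sum_stdMatrix_smul (σ : Equiv.Perm (Fin (d + 1))) (b : Fin d → E) (i : Fin d) :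
    ∑ j, stdMatrix σ i j • b j = zeroSumExtend b (σ⁻¹ i.succ) := by
  have : ∑ l, (if σ l = i.succ then (1 : ℝ) else 0) • zeroSumExtend b l =
      zeroSumExtend b (σ⁻¹ i.succ) := by
    rw [Finset.sum_eq_single (σ⁻¹ i.succ)]
    · simp
    · intro l _ hl
      rw [if_neg, zero_smul]
      intro h
      exact hl (Equiv.Perm.eq_inv_iff_eq.2 h)
    · simp
  rw [← this, Fin.sum_univ_succ]
  simp only [stdMatrix, Matrix.of_apply, zeroSumExtend, Fin.cons_zero, Fin.cons_succ, sub_smul,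
    Finset.sum_sub_distrib, ← Finset.smul_sum, smul_neg]
  abel

theorem sum_signedPermMatrix_smul (τ : Equiv.Perm (Fin d)) (ε : Fin d → ℤˣ) (b : Fin d → E)
    (i : Fin d) :
    ∑ j, signedPermMatrix τ ε i j • b j = ((ε i : ℤ) : ℝ) • b (τ⁻¹ i) := by
  rw [Finset.sum_eq_single (τ⁻¹ i)]
  · simp [signedPermMatrix]
  · intro j _ hj
    rw [signedPermMatrix, Matrix.of_apply, if_neg, zero_smul]
    rintro rfl
    simp at hj
  · simp

theorem sum_signedPermMatrix_transpose_smul (τ : Equiv.Perm (Fin d)) (ε : Fin d → ℤˣ)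
    (b : Fin d → E) (k : Fin d) :
    ∑ j, (signedPermMatrix τ ε).transpose k j • b j = ((ε (τ k) : ℤ) : ℝ) • b (τ k) := by
  rw [Finset.sum_eq_single (τ k)]
  · simp [signedPermMatrix]
  · intro j _ hj
    rw [Matrix.transpose_apply, signedPermMatrix, Matrix.of_apply, if_neg (Ne.symm hj), zero_smul]
  · simp

variable (D : E [⋀^Fin d ⊕ Fin d]→ₗ[ℝ] ℝ) (a : Fin d ⊕ Fin d → E) (b b' : Fin d → E)

/-- Here `s` is the set of arguments already filled from `a`; the index sets consist of the
remaining ones, shifted by one so that they avoid the point `0`. -/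
theorem alternatingPair_piecewise (s : Finset (Fin d ⊕ Fin d)) :
    AlternatingPair ((Finset.univ.filter fun i => Sum.inl i ∉ s).map (Fin.succEmb d))
      ((Finset.univ.filter fun k => Sum.inr k ∉ s).map (Fin.succEmb d))
      (fun g h => D (s.piecewise a (Sum.elim (fun i => zeroSumExtend b (g i.succ))
        (fun k => zeroSumExtend b' (h k.succ))))) := by
  constructor
  · intro g g' h hg
    refine congrArg D (Finset.piecewise_congr s (fun _ _ => rfl) fun x hx => ?_)
    rcases x with i | k
    · simp [hg i.succ (by simpa using hx)]
    · rfl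
  · intro g h h' hg
    refine congrArg D (Finset.piecewise_congr s (fun _ _ => rfl) fun x hx => ?_)
    rcases x with i | k
    · rfl
    · simp [hg k.succ (by simpa using hx)]
  · intro g h i hi j hj hij hg
    obtain ⟨i, hi', rfl⟩ := Finset.mem_map.1 hi
    obtain ⟨j, hj', rfl⟩ := Finset.mem_map.1 hj
    replace hi := (Finset.mem_filter.1 hi').2
    replace hj := (Finset.mem_filter.1 hj').2
    refine D.map_eq_zero_of_eq _ (i := Sum.inl i) (j := Sum.inl j) ?_ (by
      rintro h; exact hij (by rw [Sum.inl_injective h]))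
    rw [Finset.piecewise_eq_of_notMem _ _ _ hi, Finset.piecewise_eq_of_notMem _ _ _ hj]
    simpa using congrArg _ hg
  · intro g h i hi j hj hij hg
    obtain ⟨i, hi', rfl⟩ := Finset.mem_map.1 hi
    obtain ⟨j, hj', rfl⟩ := Finset.mem_map.1 hj
    replace hi := (Finset.mem_filter.1 hi').2
    replace hj := (Finset.mem_filter.1 hj').2
    refine D.map_eq_zero_of_eq _ (i := Sum.inr i) (j := Sum.inr j) ?_ (by
      rintro h; exact hij (by rw [Sum.inr_injective h]))
    rw [Finset.piecewise_eq_of_notMem _ _ _ hi, Finset.piecewise_eq_of_notMem _ _ _ hj]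
    simpa using congrArg _ hg
  · intro g h i hi j hj hij
    obtain ⟨i, hi', rfl⟩ := Finset.mem_map.1 hi
    obtain ⟨j, hj', rfl⟩ := Finset.mem_map.1 hj
    replace hi := (Finset.mem_filter.1 hi').2
    replace hj := (Finset.mem_filter.1 hj').2
    have hij' : (Sum.inl i : Fin d ⊕ Fin d) ≠ Sum.inl j := by
      rintro h; exact hij (by rw [Sum.inl_injective h])
    rw [← D.map_swap _ hij']
    refine congrArg D (funext fun x => ?_)
    rw [Function.comp_apply]
    have hxs : Equiv.swap (Sum.inl i) (Sum.inl j) x ∈ s ↔ x ∈ s := by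
      rw [Equiv.swap_apply_def]; split_ifs with h1 h2 <;> simp_all
    by_cases hx : x ∈ s
    · rw [Finset.piecewise_eq_of_mem _ _ _ hx, Finset.piecewise_eq_of_mem _ _ _ (hxs.2 hx),
        Equiv.swap_apply_of_ne_of_ne]
      · rintro rfl; exact hi hx
      · rintro rfl; exact hj hx
    · rw [Finset.piecewise_eq_of_notMem _ _ _ hx, Finset.piecewise_eq_of_notMem _ _ _ (by rwa [hxs])]
      rcases x with x | x
      · rw [Sum.inl_injective.swap_apply]
        simp [← (Fin.succ_injective d).swap_apply]
      · rw [Equiv.swap_apply_of_ne_of_ne (by simp) (by simp)]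
        simp
  · intro g h i hi j hj hij
    obtain ⟨i, hi', rfl⟩ := Finset.mem_map.1 hi
    obtain ⟨j, hj', rfl⟩ := Finset.mem_map.1 hj
    replace hi := (Finset.mem_filter.1 hi').2
    replace hj := (Finset.mem_filter.1 hj').2
    have hij' : (Sum.inr i : Fin d ⊕ Fin d) ≠ Sum.inr j := by
      rintro h; exact hij (by rw [Sum.inr_injective h])
    rw [← D.map_swap _ hij']
    refine congrArg D (funext fun x => ?_)
    rw [Function.comp_apply]
    have hxs : Equiv.swap (Sum.inr i) (Sum.inr j) x ∈ s ↔ x ∈ s := by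
      rw [Equiv.swap_apply_def]; split_ifs with h1 h2 <;> simp_all
    by_cases hx : x ∈ s
    · rw [Finset.piecewise_eq_of_mem _ _ _ hx, Finset.piecewise_eq_of_mem _ _ _ (hxs.2 hx),
        Equiv.swap_apply_of_ne_of_ne]
      · rintro rfl; exact hi hx
      · rintro rfl; exact hj hx
    · rw [Finset.piecewise_eq_of_notMem _ _ _ hx, Finset.piecewise_eq_of_notMem _ _ _ (by rwa [hxs])]
      rcases x with x | x
      · rw [Equiv.swap_apply_of_ne_of_ne (by simp) (by simp)]
        simp
      · rw [Sum.inr_injective.swap_apply]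
        simp [← (Fin.succ_injective d).swap_apply]
  · intro g h i hi
    obtain ⟨i, hi', rfl⟩ := Finset.mem_map.1 hi
    replace hi := (Finset.mem_filter.1 hi').2
    set m := s.piecewise a (Sum.elim (fun i => zeroSumExtend b (g i.succ))
      (fun k => zeroSumExtend b' (h k.succ))) with hm
    have : ∀ l, s.piecewise a (Sum.elim
        (fun i' => zeroSumExtend b (Function.update g (Fin.succEmb d i) l i'.succ))
        (fun k => zeroSumExtend b' (h k.succ))) =
        Function.update m (Sum.inl i) (zeroSumExtend b l) := by
      intro l
      ext1 x
      rcases eq_or_ne x (Sum.inl i) with rfl | hx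
      · rw [Function.update_self, Finset.piecewise_eq_of_notMem _ _ _ hi]
        simp
      · rw [Function.update_of_ne hx, hm]
        by_cases hxs : x ∈ s
        · simp [hxs]
        · rw [Finset.piecewise_eq_of_notMem _ _ _ hxs, Finset.piecewise_eq_of_notMem _ _ _ hxs]
          rcases x with x | x
          · rw [Sum.elim_inl, Sum.elim_inl, Function.update_of_ne]
            simpa using hx
          · rfl
    simp only [this]
    rw [← D.map_update_sum, sum_zeroSumExtend, D.map_update_zero]
  · intro g h i hi
    obtain ⟨i, hi', rfl⟩ := Finset.mem_map.1 hi
    replace hi := (Finset.mem_filter.1 hi').2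
    set m := s.piecewise a (Sum.elim (fun i => zeroSumExtend b (g i.succ))
      (fun k => zeroSumExtend b' (h k.succ))) with hm
    have : ∀ l, s.piecewise a (Sum.elim
        (fun i' => zeroSumExtend b (g i'.succ))
        (fun k => zeroSumExtend b' (Function.update h (Fin.succEmb d i) l k.succ))) =
        Function.update m (Sum.inr i) (zeroSumExtend b' l) := by
      intro l
      ext1 x
      rcases eq_or_ne x (Sum.inr i) with rfl | hx
      · rw [Function.update_self, Finset.piecewise_eq_of_notMem _ _ _ hi]
        simp
      · rw [Function.update_of_ne hx, hm]
        by_cases hxs : x ∈ s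
        · simp [hxs]
        · rw [Finset.piecewise_eq_of_notMem _ _ _ hxs, Finset.piecewise_eq_of_notMem _ _ _ hxs]
          rcases x with x | x
          · rfl
          · rw [Sum.elim_inr, Sum.elim_inr, Function.update_of_ne]
            simpa using hx
    simp only [this]
    rw [← D.map_update_sum, sum_zeroSumExtend, D.map_update_zero]

theorem sum_units_int_cast : ∑ u : ℤˣ, ((u : ℤ) : ℝ) = 0 := by
  rw [show (Finset.univ : Finset ℤˣ) = {1, -1} from rfl]
  simp

/-- The sign at `τ k` multiplies the arguments `inl (τ k)` and `inr k`. Its sum is `2` if both or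
neither are taken from `a`, and `0` if exactly one is. -/
theorem sum_signs_piecewise (s : Finset (Fin d ⊕ Fin d)) (τ : Equiv.Perm (Fin d)) :
    ∑ ε : Fin d → ℤˣ, D (s.piecewise a (Sum.elim (fun i => ((ε i : ℤ) : ℝ) • b (τ⁻¹ i))
      (fun k => ((ε (τ k) : ℤ) : ℝ) • b' (τ k)))) =
    if ∀ k, Sum.inl (τ k) ∈ s ↔ Sum.inr k ∈ s then
      2 ^ d * D (s.piecewise a (Sum.elim (fun i => b (τ⁻¹ i)) (fun k => b' (τ k)))) else 0 := by
  set m := s.piecewise a (Sum.elim (fun i => b (τ⁻¹ i)) (fun k => b' (τ k))) with hm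
  set f : Fin d → ℤˣ → ℝ := fun i u => (if Sum.inl i ∈ s then 1 else ((u : ℤ) : ℝ)) *
    (if Sum.inr (τ⁻¹ i) ∈ s then 1 else ((u : ℤ) : ℝ)) with hf
  have h1 : ∀ ε : Fin d → ℤˣ, D (s.piecewise a (Sum.elim (fun i => ((ε i : ℤ) : ℝ) • b (τ⁻¹ i))
      (fun k => ((ε (τ k) : ℤ) : ℝ) • b' (τ k)))) = (∏ i, f i (ε i)) * D m := by
    intro ε
    set w : Fin d ⊕ Fin d → ℝ := fun x => if x ∈ s then 1 else
      Sum.elim (fun i => ((ε i : ℤ) : ℝ)) (fun k => ((ε (τ k) : ℤ) : ℝ)) x with hw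
    have hx : s.piecewise a (Sum.elim (fun i => ((ε i : ℤ) : ℝ) • b (τ⁻¹ i))
      (fun k => ((ε (τ k) : ℤ) : ℝ) • b' (τ k))) = fun x => w x • m x := by
      ext1 x
      by_cases hxs : x ∈ s
      · simp [hm, hw, hxs]
      · rw [Finset.piecewise_eq_of_notMem _ _ _ hxs, hm, Finset.piecewise_eq_of_notMem _ _ _ hxs]
        rcases x with x | x <;> simp [hw, hxs]
    rw [hx, ← D.coe_multilinearMap, MultilinearMap.map_smul_univ, smul_eq_mul]
    congr 1
    rw [Fintype.prod_sum_type, ← Equiv.prod_comp τ⁻¹ fun k => w (Sum.inr k),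
      ← Finset.prod_mul_distrib]
    refine Finset.prod_congr rfl fun i _ => ?_
    simp [hw, hf]
  have h2 : ∀ i, ∑ u, f i u = if (Sum.inl i ∈ s ↔ Sum.inr (τ⁻¹ i) ∈ s) then 2 else 0 := by
    intro i
    rw [show (Finset.univ : Finset ℤˣ) = {1, -1} from rfl, Finset.sum_pair (by decide)]
    simp only [hf]
    by_cases h1 : Sum.inl i ∈ s <;> by_cases h2 : Sum.inr (τ⁻¹ i) ∈ s <;>
      simp only [h1, h2, if_true, if_false, iff_true, iff_false, not_true] <;> norm_num
  simp only [h1]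
  rw [← Finset.sum_mul, ← Fintype.prod_sum (f := f), Finset.prod_congr rfl fun i _ => h2 i,
    ← Equiv.prod_comp τ]
  have h3 : ∀ k, τ⁻¹ (τ k) = k := fun k => by simp
  simp only [h3]
  split_ifs with h
  · rw [Finset.prod_congr rfl fun i _ => if_pos (h i)]
    simp
  · push Not at h
    obtain ⟨k, hk⟩ := h
    rw [Finset.prod_eq_zero (Finset.mem_univ k), zero_mul]
    rw [if_neg]
    tauto

/-- The average of an alternating form over the standard representation of the symmetric group on
`d + 1` points agrees with its average over the signed permutation matrices of size `d`. -/
theorem average_stdMatrix_eq_average_signedPermMatrix :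
    ((d + 1).factorial : ℝ)⁻¹ * ∑ σ : Equiv.Perm (Fin (d + 1)),
      D (a + Sum.elim (fun i => ∑ j, stdMatrix σ i j • b j)
        (fun k => ∑ j, stdMatrix σ⁻¹ k j • b' j)) =
    (d.factorial * 2 ^ d : ℝ)⁻¹ * ∑ τ : Equiv.Perm (Fin d), ∑ ε : Fin d → ℤˣ,
      D (a + Sum.elim (fun i => ∑ j, signedPermMatrix τ ε i j • b j)
        (fun k => ∑ j, (signedPermMatrix τ ε).transpose k j • b' j)) := by
  simp only [sum_stdMatrix_smul, sum_signedPermMatrix_smul, sum_signedPermMatrix_transpose_smul,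
    inv_inv]
  -- Expand by multilinearity over the set `s` of arguments taken from `a` and compare the terms for
  -- each `s`. On both sides only the permutations matching the remaining right arguments with the
  -- remaining left ones survive: through zero sums for the standard representation, through signs
  -- for the signed matrices.
  simp only [← D.coe_multilinearMap, MultilinearMap.map_add_univ]
  rw [Finset.sum_comm]
  conv_rhs =>
    enter [2, 2, τ]
    rw [Finset.sum_comm]
  conv_rhs =>
    rw [Finset.sum_comm]
  rw [Finset.mul_sum, Finset.mul_sum]
  refine Finset.sum_congr rfl fun s _ => ?_
  simp only [D.coe_multilinearMap, sum_signs_piecewise]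
  have H := (alternatingPair_piecewise D a b b' s).sum_eq_mul_sum_finSucc (by simp) (by simp)
  rw [H, Nat.factorial_succ, mul_inv]
  have h2 : (2 : ℝ) ^ d ≠ 0 := by positivity
  have hd : (d + 1 : ℝ) ≠ 0 := by positivity
  push_cast
  rw [mul_inv, mul_comm (d + 1 : ℝ)⁻¹, mul_assoc, inv_mul_cancel_left₀ hd, mul_assoc]
  congr 1
  rw [Finset.mul_sum]
  refine Finset.sum_congr rfl fun τ _ => ?_
  have hmem : Equiv.Perm.finSuccHom d τ ∈ excessClass
      ((Finset.univ.filter fun i => Sum.inl i ∉ s).map (Fin.succEmb d))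
      ((Finset.univ.filter fun k => Sum.inr k ∉ s).map (Fin.succEmb d)) ∅ ∅ ↔
      ∀ k, Sum.inl (τ k) ∈ s ↔ Sum.inr k ∈ s := by
    rw [AlternatingPair.mem_excessClass_empty, ← map_inv]
    simp only [Finset.mem_map, Finset.mem_filter, Finset.mem_univ, true_and, Fin.coe_succEmb,
      forall_exists_index, and_imp, forall_apply_eq_imp_iff₂, Equiv.Perm.finSuccHom_succ,
      Fin.succ_inj, exists_eq_right]
    constructor
    · rintro ⟨h1, h2⟩ k
      have h1 := h1 k
      have h2 := h2 (τ k)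
      rw [show τ⁻¹ (τ k) = k by simp] at h2
      tauto
    · intro h
      refine ⟨fun k hk => by rwa [h], fun i hi => ?_⟩
      rw [← h]
      simpa using hi
  rw [if_congr hmem rfl rfl, ← map_inv]
  split_ifs with h
  · rw [inv_mul_cancel_left₀ h2]
    simp only [Equiv.Perm.finSuccHom_succ]
    rfl
  · simp

end Exchange

/-! ### Exchanging the edge matrices one at a time -/

/-- If replacing one coordinate at a time by the values of `f`, or by the values of `g`, gives the
same averages, then so does replacing all coordinates independently. -/
theorem average_pi_eq_average_pi {ι P Q R : Type*} [Fintype ι] [DecidableEq ι] [Fintype P]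
    [Fintype Q] [Nonempty P] [Nonempty Q] (f : P → R) (g : Q → R) (Ψ : (ι → R) → ℝ)
    (h : ∀ e w, (Fintype.card Q : ℝ) * ∑ p, Ψ (Function.update w e (f p)) =
      Fintype.card P * ∑ q, Ψ (Function.update w e (g q))) :
    (Fintype.card (ι → Q) : ℝ) * ∑ σ : ι → P, Ψ (fun e => f (σ e)) =
      Fintype.card (ι → P) * ∑ τ : ι → Q, Ψ (fun e => g (τ e)) := by
  -- Hybrid sums: the coordinates in `s` are already of the first kind, the others still of the
  -- second. The spare variables are summed along to keep the normalization independent of `s`.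
  set S : Finset ι → ℝ := fun s => ∑ σ : ι → P, ∑ τ : ι → Q,
    Ψ fun e => if e ∈ s then f (σ e) else g (τ e) with hS
  have hP : (Fintype.card P : ℝ) ≠ 0 := Nat.cast_ne_zero.2 Fintype.card_ne_zero
  have hQ : (Fintype.card Q : ℝ) ≠ 0 := Nat.cast_ne_zero.2 Fintype.card_ne_zero
  have hstep : ∀ s : Finset ι, S s = S ∅ := by
    intro s
    induction s using Finset.induction_on with
    | empty => rfl
    | insert e s he ih =>
      rw [← ih]
      refine mul_left_cancel₀ (mul_ne_zero hQ hP) ?_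
      have h1 : (Fintype.card P : ℝ) * S (insert e s) = ∑ σ : ι → P, ∑ τ : ι → Q, ∑ p,
          Ψ (Function.update (fun e' => if e' ∈ s then f (σ e') else g (τ e')) e (f p)) := by
        have := Fintype.sum_sum_update e fun σ : ι → P => ∑ τ : ι → Q,
          Ψ fun e' => if e' ∈ insert e s then f (σ e') else g (τ e')
        rw [nsmul_eq_mul] at this
        rw [hS, ← this, Finset.sum_comm]
        refine Finset.sum_congr rfl fun σ _ => ?_
        rw [Finset.sum_comm]
        refine Finset.sum_congr rfl fun τ _ => Finset.sum_congr rfl fun p _ =>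
          congrArg Ψ (funext fun e' => ?_)
        rcases eq_or_ne e' e with rfl | hne
        · simp
        · simp [hne]
      have h2 : (Fintype.card Q : ℝ) * S s = ∑ σ : ι → P, ∑ τ : ι → Q, ∑ q,
          Ψ (Function.update (fun e' => if e' ∈ s then f (σ e') else g (τ e')) e (g q)) := by
        rw [hS, Finset.mul_sum]
        refine Finset.sum_congr rfl fun σ _ => ?_
        have := Fintype.sum_sum_update e fun τ : ι → Q =>
          Ψ fun e' => if e' ∈ s then f (σ e') else g (τ e')
        rw [nsmul_eq_mul] at this
        rw [← this, Finset.sum_comm]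
        refine Finset.sum_congr rfl fun τ _ => Finset.sum_congr rfl fun q _ =>
          congrArg Ψ (funext fun e' => ?_)
        rcases eq_or_ne e' e with rfl | hne
        · simp [he]
        · simp [hne]
      rw [mul_assoc, h1, mul_right_comm, h2, Finset.mul_sum, Finset.sum_mul]
      refine Finset.sum_congr rfl fun σ _ => ?_
      rw [Finset.mul_sum, Finset.sum_mul]
      refine Finset.sum_congr rfl fun τ _ => ?_
      rw [h, mul_comm]
  have := hstep Finset.univ
  simp only [hS, Finset.mem_univ, if_true, Finset.notMem_empty, if_false, Finset.sum_const,
    Finset.card_univ, nsmul_eq_mul] at this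
  rw [Finset.mul_sum]
  exact this

theorem extend_update {ι N M : Type*} [DecidableEq ι] [DecidableEq N] (j : ι ↪ N) (v : ι → M)
    (z : N → M) (i : ι) (x : M) :
    Function.extend j (Function.update v i x) z =
      Function.update (Function.extend j v z) (j i) x := by
  ext1 n
  by_cases h : ∃ k, j k = n
  · obtain ⟨k, rfl⟩ := h
    rw [j.injective.extend_apply, Function.update_apply, Function.update_apply,
      j.injective.extend_apply]
    exact if_congr j.injective.eq_iff.symm rfl rfl
  · rw [Function.extend_apply' _ _ _ h, Function.update_of_ne, Function.extend_apply' _ _ _ h]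
    rintro rfl
    exact h ⟨i, rfl⟩

/-- The determinant as an alternating function of some of the rows. -/
noncomputable def Matrix.detRowsAlternating {N ι : Type*} [Fintype N] [DecidableEq N]
    (j : ι ↪ N) (z : N → N → ℝ) : (N → ℝ) [⋀^ι]→ₗ[ℝ] ℝ where
  toFun v := Matrix.detRowAlternating (Function.extend j v z)
  map_update_add' := fun {_} v i x y => by
    have h : ∀ x, Function.extend j (Function.update v i x) z =
        Function.update (Function.extend j v z) (j i) x := fun x => by
      exact extend_update j v z i x
    rw [h, h, h, AlternatingMap.map_update_add]
  map_update_smul' := fun {_} v i c x => by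
    have h : ∀ x, Function.extend j (Function.update v i x) z =
        Function.update (Function.extend j v z) (j i) x := fun x => by
      exact extend_update j v z i x
    rw [h, h, AlternatingMap.map_update_smul]
  map_eq_zero_of_eq' := fun v i i' hv hne => by
    refine AlternatingMap.map_eq_zero_of_eq _ _ (i := j i) (j := j i') ?_ (j.injective.ne hne)
    rw [j.injective.extend_apply, j.injective.extend_apply, hv]

section BlockMatrix

variable {V E κ : Type*} [Fintype E] [DecidableEq V] (a b : E → V)

/-- The matrix with the block `X e` at `(a e, b e)` and the block `Y e` at `(b e, a e)` for
every `e`. -/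
def blockMatrix (XY : E → Matrix κ κ ℝ × Matrix κ κ ℝ) : Matrix (V × κ) (V × κ) ℝ :=
  Matrix.of fun p q => ∑ e, ((if p.1 = a e ∧ q.1 = b e then (XY e).1 p.2 q.2 else 0) +
    (if p.1 = b e ∧ q.1 = a e then (XY e).2 p.2 q.2 else 0))

variable [Fintype V] [DecidableEq E] {d : ℕ}

/-- Changing the matrices at one edge affects only the `2 d` rows over its two ends. These are
distinct as the edge is not a loop, and the determinant is alternating in them, so the exchange
applies. -/
theorem average_det_sub_blockMatrix (hab : ∀ e, a e ≠ b e)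
    (M : Matrix (V × Fin d) (V × Fin d) ℝ) :
    (Fintype.card (E → Equiv.Perm (Fin d) × (Fin d → ℤˣ)) : ℝ) *
      ∑ σ : E → Equiv.Perm (Fin (d + 1)),
        (M - blockMatrix a b fun e => (stdMatrix (σ e), stdMatrix (σ e)⁻¹)).det =
    Fintype.card (E → Equiv.Perm (Fin (d + 1))) *
      ∑ τ : E → Equiv.Perm (Fin d) × (Fin d → ℤˣ),
        (M - blockMatrix a b fun e => (signedPermMatrix (τ e).1 (τ e).2,
          (signedPermMatrix (τ e).1 (τ e).2).transpose)).det := by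
  refine average_pi_eq_average_pi
    (fun σ : Equiv.Perm (Fin (d + 1)) => (stdMatrix σ, stdMatrix σ⁻¹))
    (fun τ : Equiv.Perm (Fin d) × (Fin d → ℤˣ) =>
      (signedPermMatrix τ.1 τ.2, (signedPermMatrix τ.1 τ.2).transpose))
    (fun XY => (M - blockMatrix a b XY).det) fun e w => ?_
  let j : Fin d ⊕ Fin d ↪ V × Fin d :=
    ⟨Sum.elim (fun i => (a e, i)) (fun k => (b e, k)), by
      rintro (x | x) (y | y) h
      · simpa using h
      · exact absurd (congrArg Prod.fst h) (hab e)
      · exact absurd (congrArg Prod.fst h) (hab e).symm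
      · simpa using h⟩
  -- The rows when the blocks of `e` are set to zero: the constant part `a` of the exchange is `z ∘
  -- j`, and the blocks add combinations of negated unit vectors.
  set z : V × Fin d → V × Fin d → ℝ :=
    M - blockMatrix a b (Function.update w e (0, 0)) with hz
  have key : ∀ X Y : Matrix (Fin d) (Fin d) ℝ,
      (M - blockMatrix a b (Function.update w e (X, Y))).det =
        Matrix.detRowsAlternating j z (z ∘ j + Sum.elim
          (fun i => ∑ l, X i l • (-Pi.single (b e, l) 1 : V × Fin d → ℝ))
          (fun k => ∑ l, Y k l • (-Pi.single (a e, l) 1 : V × Fin d → ℝ))) := by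
    intro X Y
    change _ = Matrix.det (Function.extend j _ z)
    congr 1
    ext p q
    have hsum : (M - blockMatrix a b (Function.update w e (X, Y))) p q = z p q -
        ((if p.1 = a e ∧ q.1 = b e then X p.2 q.2 else 0) +
          (if p.1 = b e ∧ q.1 = a e then Y p.2 q.2 else 0)) := by
      simp only [hz, Matrix.sub_apply, blockMatrix, Matrix.of_apply]
      rw [← Finset.add_sum_erase _ _ (Finset.mem_univ e),
        ← Finset.add_sum_erase _ (fun e' => ((if p.1 = a e' ∧ q.1 = b e' then
          (Function.update w e (0, 0) e').1 p.2 q.2 else 0) + (if p.1 = b e' ∧ q.1 = a e' then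
          (Function.update w e (0, 0) e').2 p.2 q.2 else 0))) (Finset.mem_univ e)]
      rw [Finset.sum_congr rfl (g := fun e' => ((if p.1 = a e' ∧ q.1 = b e' then
          (Function.update w e (0, 0) e').1 p.2 q.2 else 0) + (if p.1 = b e' ∧ q.1 = a e' then
          (Function.update w e (0, 0) e').2 p.2 q.2 else 0))) fun e' he' => by
        rw [Function.update_of_ne (Finset.ne_of_mem_erase he'),
          Function.update_of_ne (Finset.ne_of_mem_erase he')]]
      simp only [Function.update_self, Matrix.zero_apply, ite_self, zero_add]
      ring
    rw [hsum]
    have hs : ∀ (R : Matrix (Fin d) (Fin d) ℝ) (i : Fin d) (v : V),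
        (∑ l, R i l • (-Pi.single (v, l) 1 : V × Fin d → ℝ)) q =
          -(if q.1 = v then R i q.2 else 0) := by
      intro R i v
      rw [Finset.sum_apply]
      simp only [Pi.smul_apply, Pi.neg_apply, smul_eq_mul, mul_neg, Finset.sum_neg_distrib]
      congr 1
      obtain ⟨q1, q2⟩ := q
      rw [Finset.sum_eq_single q2]
      · by_cases h : q1 = v
        · subst h; simp
        · rw [Pi.single_eq_of_ne (by simp [h])]
          simp [h]
      · intro l _ hl
        rw [Pi.single_eq_of_ne (by simp [Ne.symm hl]), mul_zero]
      · simp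
    by_cases hpa : p.1 = a e
    · obtain ⟨p1, p2⟩ := p
      obtain rfl : p1 = a e := hpa
      refine Eq.trans ?_ (congrFun (j.injective.extend_apply _ z (Sum.inl p2)) q).symm
      rw [Pi.add_apply, Pi.add_apply, Function.comp_apply, Sum.elim_inl, hs]
      simp [j, hab e, sub_eq_add_neg]
      rfl
    · by_cases hpb : p.1 = b e
      · obtain ⟨p1, p2⟩ := p
        obtain rfl : p1 = b e := hpb
        refine Eq.trans ?_ (congrFun (j.injective.extend_apply _ z (Sum.inr p2)) q).symm
        rw [Pi.add_apply, Pi.add_apply, Function.comp_apply, Sum.elim_inr, hs]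
        simp [j, (hab e).symm, sub_eq_add_neg]
        rfl
      · rw [Function.extend_apply']
        · simp [hpa, hpb]
        · rintro ⟨x | x, rfl⟩
          · exact hpa rfl
          · exact hpb rfl
  simp only [key]
  have h := average_stdMatrix_eq_average_signedPermMatrix (Matrix.detRowsAlternating j z) (z ∘ j)
    (fun l => (-Pi.single (b e, l) 1 : V × Fin d → ℝ))
    (fun l => (-Pi.single (a e, l) 1 : V × Fin d → ℝ))
  have hP : (Fintype.card (Equiv.Perm (Fin (d + 1))) : ℝ) = (d + 1).factorial := by
    rw [Fintype.card_perm, Fintype.card_fin]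
  have hQ : (Fintype.card (Equiv.Perm (Fin d) × (Fin d → ℤˣ)) : ℝ) = d.factorial * 2 ^ d := by
    rw [Fintype.card_prod, Fintype.card_perm, Fintype.card_fin, Fintype.card_fun, Fintype.card_fin,
      Fintype.card_units_int]
    push_cast; rfl
  rw [Fintype.sum_prod_type, hP, hQ]
  rw [inv_mul_eq_iff_eq_mul₀ (by positivity)] at h
  rw [h]
  field_simp

end BlockMatrix

/-! ### Matching polynomials as averages over signs -/

theorem Matrix.det_eq_det_of_row_single {N R : Type*} [Fintype N] [DecidableEq N] [CommRing R]
    (M : Matrix N N R) (k l : N) (h : ∀ q, M k q = if q = l then 1 else 0) :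
    M.det = (Matrix.of fun p q => if p ≠ k ∧ q = l then 0 else M p q).det := by
  refine Matrix.det_eq_of_forall_row_eq_smul_add_const (fun p => if p = k then 0 else M p l) k
    (by simp) fun p q => ?_
  simp only [Matrix.of_apply, h, ne_eq, not_true, false_and, if_false]
  by_cases hp : p = k <;> by_cases hq : q = l <;> simp [hp, hq]

theorem sum_signs_eq_zero {F : Type*} [Fintype F] [DecidableEq F] (f f' : F) (hne : f ≠ f')
    (Φ : (F → ℤˣ) → ℝ) (hΦ : ∀ ε u, Φ (Function.update ε f u) = Φ ε) :
    ∑ ε : F → ℤˣ, ((ε f : ℤ) : ℝ) * ((ε f' : ℤ) : ℝ) * Φ ε = 0 := by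
  have h := Fintype.sum_sum_update f fun ε : F → ℤˣ =>
    ((ε f : ℤ) : ℝ) * ((ε f' : ℤ) : ℝ) * Φ ε
  rw [Finset.sum_comm] at h
  simp only [Function.update_self, Function.update_of_ne hne.symm, hΦ] at h
  rw [Fintype.card_units_int, Finset.sum_eq_zero] at h
  · simpa using h.symm
  · intro ε _
    rw [← Finset.sum_mul, ← Finset.sum_mul, sum_units_int_cast]
    ring

section SignedAdjacency

variable {N F : Type*} [DecidableEq N] (s t : F → N)

/-- The number of orientations in which the edge `f` joins `p` to `q`. -/
def edgeCount (f : F) (p q : N) : ℝ :=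
  (if s f = p ∧ t f = q then 1 else 0) + (if t f = p ∧ s f = q then 1 else 0)

variable {s t}

theorem edgeCount_self (hst : ∀ f, s f ≠ t f) (f : F) (p : N) : edgeCount s t f p p = 0 := by
  rw [edgeCount, if_neg, if_neg, add_zero]
  · rintro ⟨rfl, h⟩; exact hst f h
  · rintro ⟨rfl, h⟩; exact hst f h.symm

/-- One end of an edge determines the other, so using the same edge out of `v` and back forces `w =
w'`. -/
theorem edgeCount_mul_edgeCount (hst : ∀ f, s f ≠ t f) (f : F) (v w w' : N) :
    edgeCount s t f v w * edgeCount s t f w' v = if w = w' then edgeCount s t f v w else 0 := by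
  have h1 := hst f
  simp only [edgeCount]
  by_cases h2 : s f = v <;> by_cases h3 : t f = v
  · exact absurd (h2.trans h3.symm) h1
  · by_cases h4 : t f = w <;> by_cases h5 : t f = w' <;> simp_all <;>
      exact fun h => h4 h.symm
  · by_cases h4 : s f = w <;> by_cases h5 : s f = w' <;> simp_all <;>
      exact fun h => h4 h.symm
  · simp [h2, h3]

variable (s t)
variable [Fintype F]

/-- The adjacency matrix with signs. -/
def signedAdjMatrix (ε : F → ℤˣ) : Matrix N N ℝ :=
  Matrix.of fun p q => ∑ f, ((ε f : ℤ) : ℝ) * edgeCount s t f p q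

/-- The characteristic matrix of the signed graph induced on `S`, extended by the identity. -/
def inducedCharmatrix (x : ℝ) (ε : F → ℤˣ) (S : Finset N) : Matrix N N ℝ :=
  Matrix.of fun p q => if p ∈ S ∧ q ∈ S then
    (if p = q then x else 0) - signedAdjMatrix s t ε p q else if p = q then 1 else 0

/-- The matrix obtained from the characteristic matrix by replacing two rows and one column. -/
def reducedCharmatrix (x : ℝ) (ε : F → ℤˣ) (S : Finset N) (v w w' : N) : Matrix N N ℝ :=
  Matrix.of fun p q => if p = v then (if q = w then 1 else 0) else
    if p = w' then (if q = v then 1 else 0) else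
      if q = v then 0 else inducedCharmatrix s t x ε S p q

variable {s t}

/-- The edges at `v` only enter row and column `v`, which have been replaced by constants. -/
theorem reducedCharmatrix_update [DecidableEq F] (x : ℝ) (ε : F → ℤˣ) (S : Finset N) {v w w' : N} {f : F}
    (hf : s f = v ∨ t f = v) (u : ℤˣ) :
    reducedCharmatrix s t x (Function.update ε f u) S v w w' =
      reducedCharmatrix s t x ε S v w w' := by
  ext p q
  simp only [reducedCharmatrix, Matrix.of_apply]
  split_ifs with h1 h2 h3 h4 h5
  all_goals try rfl
  have : signedAdjMatrix s t (Function.update ε f u) p q = signedAdjMatrix s t ε p q := by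
    simp only [signedAdjMatrix, Matrix.of_apply]
    refine Finset.sum_congr rfl fun f' _ => ?_
    rcases eq_or_ne f' f with rfl | hne
    · have : edgeCount s t f' p q = 0 := by
        rw [edgeCount, if_neg, if_neg, add_zero]
        · rintro ⟨rfl, rfl⟩
          rcases hf with h | h <;> contradiction
        · rintro ⟨rfl, rfl⟩
          rcases hf with h | h <;> contradiction
      rw [this, mul_zero, mul_zero]
    · rw [Function.update_of_ne hne]
  simp only [inducedCharmatrix, Matrix.of_apply, this]

variable [Fintype N]

theorem det_updateRow_self_inducedCharmatrix (x : ℝ) (ε : F → ℤˣ) (S : Finset N) (v : N) :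
    ((inducedCharmatrix s t x ε S).updateRow v (Pi.single v 1)).det =
      (inducedCharmatrix s t x ε (S.erase v)).det := by
  rw [Matrix.det_eq_det_of_row_single _ v v (fun q => by simp [Pi.single_apply])]
  congr 1
  ext p q
  simp only [Matrix.of_apply, Matrix.updateRow_apply, inducedCharmatrix, Finset.mem_erase,
    Pi.single_apply]
  by_cases hp : p = v <;> by_cases hq : q = v
  · simp [hp, hq]
  · simp [hp, hq, Ne.symm hq]
  · simp [hp, hq]
  · simp [hp, hq]

/-- Exchanging rows `v` and `w`, which costs the sign, makes both of them unit rows on the diagonal.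
-/
theorem det_reducedCharmatrix_self (x : ℝ) (ε : F → ℤˣ) {S : Finset N} {v w : N} (hvw : w ≠ v) :
    (reducedCharmatrix s t x ε S v w w).det =
      -(inducedCharmatrix s t x ε ((S.erase v).erase w)).det := by
  have h1 := Matrix.det_permute (Equiv.swap v w) (reducedCharmatrix s t x ε S v w w)
  rw [Equiv.Perm.sign_swap hvw.symm] at h1
  have h2 : (reducedCharmatrix s t x ε S v w w).det =
      -((reducedCharmatrix s t x ε S v w w).submatrix (Equiv.swap v w) id).det := by
    rw [h1]; simp
  rw [h2, neg_inj]
  rw [Matrix.det_eq_det_of_row_single _ w w (fun q => by simp [reducedCharmatrix])]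
  congr 1
  ext p q
  simp only [Matrix.of_apply, Matrix.submatrix_apply, reducedCharmatrix, inducedCharmatrix,
    Finset.mem_erase, id]
  by_cases hpv : p = v
  · subst hpv
    by_cases hq : q = w
    · simp [hq, hvw, hvw.symm]
    · by_cases hq' : q = p
      · simp [hq', hvw, hvw.symm]
      · simp [hq, hvw, hvw.symm, hq', Ne.symm hq']
  · by_cases hpw : p = w
    · subst hpw
      by_cases hq : q = p
      · simp [hq]
      · simp [hq, Ne.symm hq]
    · rw [Equiv.swap_apply_of_ne_of_ne hpv hpw]
      by_cases hqv : q = v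
      · simp [hqv, hpv, hpw, hvw.symm]
      · by_cases hqw : q = w
        · simp [hqw, hpv, hpw]
        · simp [hqv, hqw, hpv, hpw]

/-- Expansion along row `v` and then, in the off-diagonal cofactors, along column `v`. This isolates
every sign of an edge at `v`. -/
theorem det_inducedCharmatrix (hst : ∀ f, s f ≠ t f) (x : ℝ) (ε : F → ℤˣ) {S : Finset N} {v : N}
    (hv : v ∈ S) :
    (inducedCharmatrix s t x ε S).det = x * (inducedCharmatrix s t x ε (S.erase v)).det +
      ∑ w ∈ S.erase v, ∑ w' ∈ S.erase v, signedAdjMatrix s t ε v w * signedAdjMatrix s t ε w' v *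
        (reducedCharmatrix s t x ε S v w w').det := by
  set K := inducedCharmatrix s t x ε S with hK
  have hdiag : signedAdjMatrix s t ε v v = 0 := by
    simp [signedAdjMatrix, edgeCount_self hst]
  have hoff : ∀ q, q ≠ v → K v q = if q ∈ S then -signedAdjMatrix s t ε v q else 0 := by
    intro q hq
    simp [hK, inducedCharmatrix, hv, Ne.symm hq]
  have hoff' : ∀ p, p ≠ v → K p v = if p ∈ S then -signedAdjMatrix s t ε p v else 0 := by
    intro p hp
    simp [hK, inducedCharmatrix, hv, hp]
  rw [Matrix.det_eq_sum_mul_adjugate_row K v, ← Finset.add_sum_erase _ _ (Finset.mem_univ v),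
    Matrix.adjugate_apply, det_updateRow_self_inducedCharmatrix]
  congr 1
  · simp [hK, inducedCharmatrix, hv, hdiag]
  rw [← Finset.sum_subset (Finset.erase_subset_erase v (Finset.subset_univ S))]
  · refine Finset.sum_congr rfl fun w hw => ?_
    obtain ⟨hwv, hwS⟩ := Finset.mem_erase.1 hw
    rw [hoff w hwv, if_pos hwS, Matrix.adjugate_apply]
    set L := K.updateRow v (Pi.single w 1) with hL
    rw [Matrix.det_eq_sum_mul_adjugate_col L v, ← Finset.add_sum_erase _ _ (Finset.mem_univ v)]
    have hLv : L v v = 0 := by simp [hL, hwv.symm]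
    rw [hLv, zero_mul, zero_add, ← Finset.sum_subset
      (Finset.erase_subset_erase v (Finset.subset_univ S)), Finset.mul_sum]
    · refine Finset.sum_congr rfl fun w' hw' => ?_
      obtain ⟨hwv', hwS'⟩ := Finset.mem_erase.1 hw'
      have hLw : L w' v = -signedAdjMatrix s t ε w' v := by
        rw [hL, Matrix.updateRow_ne hwv', hoff' w' hwv', if_pos hwS']
      have hdet : L.adjugate v w' = (reducedCharmatrix s t x ε S v w w').det := by
        rw [Matrix.adjugate_apply, Matrix.det_eq_det_of_row_single _ w' v
          (fun q => by simp [Pi.single_apply])]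
        congr 1
        ext p q
        simp only [Matrix.of_apply, Matrix.updateRow_apply, reducedCharmatrix, hL, Pi.single_apply]
        by_cases hpv : p = v
        · subst hpv
          by_cases hqp : q = p
          · simp [hqp, hwv'.symm, hwv.symm]
          · simp [hqp, hwv'.symm]
        · by_cases hpw : p = w'
          · simp [hpw, hwv']
          · simp [hpv, hpw, hK]
      rw [hLw, hdet]
      ring
    · intro p hp hpS
      obtain ⟨hpv, -⟩ := Finset.mem_erase.1 hp
      have : p ∉ S := fun h => hpS (Finset.mem_erase.2 ⟨hpv, h⟩)
      rw [hL, Matrix.updateRow_ne hpv, hoff' p hpv, if_neg this, zero_mul]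
  · intro p hp hpS
    obtain ⟨hpv, -⟩ := Finset.mem_erase.1 hp
    have : p ∉ S := fun h => hpS (Finset.mem_erase.2 ⟨hpv, h⟩)
    rw [hoff p hpv, if_neg this, zero_mul]

variable (s t)
variable [DecidableEq F]

/-- The sum over all signs of the characteristic polynomials of the signed graphs induced on `S`; up
to normalization this is the matching polynomial of the induced graph. -/
noncomputable def signedCharpolySum (x : ℝ) (S : Finset N) : ℝ :=
  ∑ ε : F → ℤˣ, (inducedCharmatrix s t x ε S).det

theorem signedCharpolySum_univ (x : ℝ) :
    signedCharpolySum s t x Finset.univ =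
      ∑ ε : F → ℤˣ, (Matrix.scalar N x - signedAdjMatrix s t ε).det := by
  refine Finset.sum_congr rfl fun ε _ => congrArg _ ?_
  ext p q
  simp [inducedCharmatrix, Matrix.diagonal_apply]

theorem signedCharpolySum_empty (x : ℝ) : 0 < signedCharpolySum s t x ∅ := by
  refine Finset.sum_pos (fun ε _ => ?_) Finset.univ_nonempty
  have : inducedCharmatrix s t x ε ∅ = 1 := by
    ext p q
    simp [inducedCharmatrix, Matrix.one_apply]
  rw [this, Matrix.det_one]
  exact one_pos

variable {s t}

/-- The recursion of matching polynomials. -/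
theorem signedCharpolySum_recursion (hst : ∀ f, s f ≠ t f) (x : ℝ) {S : Finset N} {v : N}
    (hv : v ∈ S) :
    signedCharpolySum s t x S = x * signedCharpolySum s t x (S.erase v) -
      ∑ w ∈ S.erase v, ∑ f, edgeCount s t f v w *
        signedCharpolySum s t x ((S.erase v).erase w) := by
  simp only [signedCharpolySum]
  rw [Finset.sum_congr rfl fun ε _ => det_inducedCharmatrix hst x ε hv, Finset.sum_add_distrib,
    ← Finset.mul_sum, sub_eq_add_neg]
  congr 1
  rw [Finset.sum_comm, ← Finset.sum_neg_distrib]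
  refine Finset.sum_congr rfl fun w hw => ?_
  obtain ⟨hwv, hwS⟩ := Finset.mem_erase.1 hw
  rw [Finset.sum_comm]
  have key : ∀ w', ∑ ε : F → ℤˣ, signedAdjMatrix s t ε v w * signedAdjMatrix s t ε w' v *
      (reducedCharmatrix s t x ε S v w w').det = ∑ f, (if w = w' then edgeCount s t f v w else 0) *
        ∑ ε : F → ℤˣ, (reducedCharmatrix s t x ε S v w w').det := by
    intro w'
    have h1 : ∀ ε : F → ℤˣ, signedAdjMatrix s t ε v w * signedAdjMatrix s t ε w' v *
        (reducedCharmatrix s t x ε S v w w').det = ∑ f, ∑ f', edgeCount s t f v w *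
          edgeCount s t f' w' v * (((ε f : ℤ) : ℝ) * ((ε f' : ℤ) : ℝ) *
            (reducedCharmatrix s t x ε S v w w').det) := by
      intro ε
      simp only [signedAdjMatrix, Matrix.of_apply]
      rw [Finset.sum_mul_sum, Finset.sum_mul]
      refine Finset.sum_congr rfl fun f _ => ?_
      rw [Finset.sum_mul]
      refine Finset.sum_congr rfl fun f' _ => ?_
      ring
    rw [Finset.sum_congr rfl fun ε _ => h1 ε, Finset.sum_comm]
    refine Finset.sum_congr rfl fun f _ => ?_
    rw [Finset.sum_comm, Finset.sum_eq_single f]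
    · rw [← Finset.mul_sum, edgeCount_mul_edgeCount hst]
      congr 1
      refine Finset.sum_congr rfl fun ε _ => ?_
      have : ((ε f : ℤ) : ℝ) * ((ε f : ℤ) : ℝ) = 1 := by
        rcases Int.units_eq_one_or (ε f) with h | h <;> simp [h]
      rw [this, one_mul]
    · intro f' _ hne
      rw [← Finset.mul_sum]
      -- Cross terms vanish: if `f` meets `v`, the reduced determinant does not depend on its sign,
      -- which averages to zero; if not, `f` does not join `v` to `w`.
      by_cases hf : s f = v ∨ t f = v
      · rw [sum_signs_eq_zero f f' hne.symm, mul_zero]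
        intro ε u
        rw [reducedCharmatrix_update x ε S hf]
      · push Not at hf
        rw [edgeCount, if_neg (by tauto), if_neg (by tauto)]
        ring
    · simp
  rw [Finset.sum_congr rfl fun w' _ => key w', Finset.sum_comm, ← Finset.sum_neg_distrib]
  refine Finset.sum_congr rfl fun f _ => ?_
  rw [Finset.sum_eq_single_of_mem w hw]
  · rw [if_pos rfl, Finset.sum_congr rfl fun ε _ => det_reducedCharmatrix_self x ε hwv,
      Finset.sum_neg_distrib]
    ring
  · intro w' _ hne
    rw [if_neg hne.symm, zero_mul]

end SignedAdjacency

/-! ### A positive supersolution from the resolvent -/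

section Supersolution

open Filter Topology

/-- By Gelfand's formula, `‖a ^ k‖ ≤ y ^ k` for large `k` whenever `y` exceeds the spectral radius;
choosing `y < x` gives a geometric bound. -/
theorem summable_inv_pow_smul_pow {A : Type*} [NormedRing A] [NormedAlgebra ℂ A] [CompleteSpace A]
    (a : A) {x : ℝ} (hx : (spectralRadius ℂ a).toReal < x) :
    Summable fun k : ℕ => ((x : ℂ)⁻¹ ^ (k + 1)) • a ^ k := by
  have hfin : spectralRadius ℂ a ≠ ⊤ :=
    ((spectrum.spectralRadius_le_pow_nnnorm_pow_one_div ℂ a 0).trans_lt (by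
      simpa using ENNReal.mul_lt_top ENNReal.coe_lt_top ENNReal.coe_lt_top)).ne
  have hρ0 : 0 ≤ (spectralRadius ℂ a).toReal := ENNReal.toReal_nonneg
  obtain ⟨y, hy1, hy2⟩ := exists_between hx
  have hy0 : 0 < y := hρ0.trans_lt hy1
  have hx0 : 0 < x := hy0.trans hy2
  have hlt : spectralRadius ℂ a < ENNReal.ofReal y :=
    (ENNReal.lt_ofReal_iff_toReal_lt hfin).2 hy1
  have hev := (spectrum.pow_norm_pow_one_div_tendsto_nhds_spectralRadius a).eventually_lt_const hlt
  refine Summable.of_norm_bounded_eventually_nat (g := fun k => x⁻¹ * (y / x) ^ k)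
    ((summable_geometric_of_lt_one (by positivity) ((div_lt_one hx0).2 hy2)).mul_left _) ?_
  filter_upwards [hev, eventually_gt_atTop 0] with k hk hk0
  have h1 : ‖a ^ k‖ ^ (1 / k : ℝ) ≤ y := ((ENNReal.ofReal_lt_ofReal_iff hy0).1 hk).le
  have h2 : ‖a ^ k‖ ≤ y ^ k := by
    have := pow_le_pow_left₀ (by positivity) h1 k
    rwa [← Real.rpow_natCast, ← Real.rpow_mul (norm_nonneg _), one_div,
      inv_mul_cancel₀ (by positivity), Real.rpow_one] at this
  rw [norm_smul, norm_pow, norm_inv, Complex.norm_real, Real.norm_of_nonneg hx0.le]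
  calc x⁻¹ ^ (k + 1) * ‖a ^ k‖ ≤ x⁻¹ ^ (k + 1) * y ^ k := by gcongr
    _ = _ := by rw [div_pow, pow_succ, inv_pow]; field_simp

/-- Above the spectral radius, a connected graph of bounded degree has a positive function which is
strictly decreased by the adjacency operator divided by `x`. -/
theorem SimpleGraph.exists_pos_supersolution {W : Type*} (T : SimpleGraph W) (hT : T.Connected)
    (D : ℕ) (hfin : ∀ v, (T.neighborSet v).Finite) (hD : ∀ v, (T.neighborSet v).ncard ≤ D)
    {x : ℝ} (hx : T.specRadius < x) :
    ∃ g : W → ℝ, (∀ t, 0 < g t) ∧ ∀ t, ∑ u ∈ (hfin t).toFinset, g u < x * g t := by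
  classical
  obtain ⟨o⟩ := hT.nonempty
  -- The resolvent is taken at `y < x`: it gives `A G ≤ y G`, and the gap makes the inequality at
  -- `x` strict.
  obtain ⟨y, hy1, hyx⟩ := exists_between hx
  set A := T.adjOperator with hAdef
  have hA : T.IsAdjOperator A := by
    have h := T.exists_isAdjOperator D hfin hD
    rw [hAdef, SimpleGraph.adjOperator, dif_pos h]
    exact h.choose_spec
  have hA' : ∀ (f : EllTwo W) (v : W), A f v = ∑ u ∈ (hfin v).toFinset, f u := by
    intro f v
    have := (hfin v).fintype
    have h := hasSum_fintype fun u : T.neighborSet v => f u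
    rw [(hA f v).unique h]
    exact (Finset.sum_subtype _ (by simp) _).symm
  have hy0 : 0 < y := ENNReal.toReal_nonneg.trans_lt hy1
  have hsum := summable_inv_pow_smul_pow A hy1
  set δ : EllTwo W := lp.single 2 o (1 : ℂ) with hδ
  set b : ℕ → EllTwo W := fun k => ((y : ℂ)⁻¹ ^ (k + 1)) • (A ^ k) δ with hb
  have hsb : Summable b := by
    have := hsum.map (ContinuousLinearMap.apply ℂ (EllTwo W) δ)
      (ContinuousLinearMap.apply ℂ (EllTwo W) δ).continuous
    exact this
  set G := ∑' k, b k with hG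
  have hyc : (y : ℂ) ≠ 0 := by exact_mod_cast hy0.ne'
  have hAb : ∀ k, A (b k) = (y : ℂ) • b (k + 1) := by
    intro k
    rw [hb]
    simp only
    rw [map_smul, smul_smul, pow_succ' (y : ℂ)⁻¹ (k + 1), ← mul_assoc, mul_inv_cancel₀ hyc,
      one_mul, pow_succ' A k]
    rfl
  have hAG : A G = (y : ℂ) • G - δ := by
    rw [hG, ContinuousLinearMap.map_tsum A hsb]
    simp only [hAb]
    rw [((summable_nat_add_iff 1).2 hsb).tsum_const_smul, hsb.tsum_eq_zero_add, smul_add, hb]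
    simp only [zero_add, pow_one, pow_zero, one_apply_eq_self, smul_smul,
      mul_inv_cancel₀ hyc, one_smul]
    abel
  have hnn : ∀ k t, 0 ≤ ((A ^ k) δ t).re ∧ ((A ^ k) δ t).im = 0 := by
    intro k
    induction k with
    | zero =>
      intro t
      simp only [pow_zero, one_apply_eq_self, hδ, lp.single_apply]
      by_cases h : t = o
      · subst h; simp
      · rw [Pi.single_eq_of_ne h]; simp
    | succ k ih =>
      intro t
      rw [pow_succ', mul_apply_eq_comp, hA', Complex.re_sum, Complex.im_sum]
      exact ⟨Finset.sum_nonneg fun u _ => (ih u).1, Finset.sum_eq_zero fun u _ => (ih u).2⟩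
  have hGt : ∀ t, HasSum (fun k => y⁻¹ ^ (k + 1) * ((A ^ k) δ t).re) (G t).re := by
    intro t
    have h1 : HasSum (fun k => b k t) (G t) :=
      hsb.hasSum.mapL (lp.evalCLM ℂ (fun _ : W => ℂ) 2 t)
    have h2 := Complex.hasSum_re h1
    have h3 : ∀ k, (b k t).re = y⁻¹ ^ (k + 1) * ((A ^ k) δ t).re := by
      intro k
      have : b k t = ((y⁻¹ ^ (k + 1) : ℝ) : ℂ) * (A ^ k) δ t := by
        rw [Complex.ofReal_pow, Complex.ofReal_inv]
        rfl
      rw [this, Complex.re_ofReal_mul]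
    simpa only [h3] using h2
  have hg0 : ∀ t, 0 ≤ (G t).re := fun t =>
    (hGt t).nonneg fun k => mul_nonneg (by positivity) (hnn k t).1
  have hgo : 0 < (G o).re := by
    refine lt_of_lt_of_le ?_ (le_hasSum (hGt o) 0 fun k _ =>
      mul_nonneg (by positivity) (hnn k o).1)
    simp [hδ, hy0]
  have hle : ∀ t, ∑ u ∈ (hfin t).toFinset, (G u).re ≤ y * (G t).re := by
    intro t
    have h1 := congrArg (fun f : EllTwo W => (f t).re) hAG
    simp only [hA', Complex.re_sum, lp.coeFn_sub, lp.coeFn_smul, Pi.sub_apply, Pi.smul_apply,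
      smul_eq_mul, Complex.sub_re, Complex.re_ofReal_mul] at h1
    rw [h1]
    have h2 : 0 ≤ (δ t).re := by simpa using (hnn 0 t).1
    linarith
  have hpos : ∀ t, 0 < (G t).re := by
    intro t
    -- Strict positivity spreads from `o` along edges, by `A G ≤ y G`.
    have key : ∀ u v, T.Adj u v → 0 < (G v).re → 0 < (G u).re := by
      intro u v h hv
      have h1 : (G v).re ≤ ∑ u' ∈ (hfin u).toFinset, (G u').re :=
        Finset.single_le_sum (f := fun u' => (G u').re) (fun u' _ => hg0 u') (by simpa using h)
      exact pos_of_mul_pos_right (hv.trans_le (h1.trans (hle u))) hy0.le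
    have : ∀ {u v} (p : T.Walk u v), 0 < (G v).re → 0 < (G u).re := by
      intro u v p
      induction p with
      | nil => exact id
      | cons h _ ih => exact fun hw => key _ _ h (ih hw)
    obtain ⟨p⟩ := hT.preconnected t o
    exact this p hgo
  exact ⟨fun t => (G t).re, hpos, fun t => (hle t).trans_lt
    (mul_lt_mul_of_pos_right hyx (hpos t))⟩

end Supersolution

/-! ### Parallel transport on trees and voltage covers -/

section TreeTransport

variable {W ι : Type*} {T : SimpleGraph W}

/-- The product of the permutations attached to the darts of a walk. -/
def SimpleGraph.Walk.holonomy (s : T.Dart → Equiv.Perm ι) :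
    ∀ {u v : W}, T.Walk u v → Equiv.Perm ι
  | _, _, .nil => 1
  | _, _, .cons h p => p.holonomy s * s ⟨(_, _), h⟩

theorem SimpleGraph.Walk.holonomy_concat (s : T.Dart → Equiv.Perm ι) {u v w : W} (p : T.Walk u v)
    (h : T.Adj v w) : (p.concat h).holonomy s = s ⟨(v, w), h⟩ * p.holonomy s := by
  induction p with
  | nil => simp [concat_nil, holonomy]
  | cons h' p ih => simp [concat_cons, holonomy, ih, mul_assoc]

/-- Transport `i` along the unique path from `o`. For adjacent vertices one of the two paths extends
the other by the edge. -/
theorem SimpleGraph.IsTree.exists_parallel (hT : T.IsTree) (s : T.Dart → Equiv.Perm ι)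
    (hs : ∀ d, s d.symm = (s d)⁻¹) (o : W) (i : ι) :
    ∃ f : W → ι, f o = i ∧ ∀ d : T.Dart, f d.snd = s d (f d.fst) := by
  choose p hp _ using fun v => hT.existsUnique_path o v
  have hacyc := hT.isAcyclic
  refine ⟨fun v => (p v).holonomy s i, ?_, ?_⟩
  · have h : p o = .nil := SimpleGraph.Walk.isPath_iff_nil.1 (hp o) |>.eq_nil
    simp [h, SimpleGraph.Walk.holonomy]
  · have key : ∀ d : T.Dart, d.fst ∈ (p d.snd).support →
        (p d.snd).holonomy s i = s d ((p d.fst).holonomy s i) := by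
      intro d hd
      rw [hacyc.path_concat (hp _) (hp _) d.adj hd, SimpleGraph.Walk.holonomy_concat]
      rfl
    intro d
    by_cases hd : d.fst ∈ (p d.snd).support
    · exact key d hd
    · have h2 := key d.symm
        (hacyc.mem_support_of_ne_mem_support_of_adj_of_isPath (hp _) (hp _) d.adj hd)
      simp only [hs] at h2
      change (p d.fst).holonomy s i = (s d)⁻¹ ((p d.snd).holonomy s i) at h2
      simp only [h2, Equiv.Perm.inv_def, Equiv.apply_symm_apply]

end TreeTransport

namespace Multigraph

variable {V : Type*} {W : Type*} {ι : Type*}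

theorem src_rev (G : Multigraph V) (e : G.Dart) : G.src (G.rev e) = G.tgt e := rfl

theorem tgt_rev (G : Multigraph V) (e : G.Dart) : G.tgt (G.rev e) = G.src e := by
  rw [tgt, G.rev_rev]

/-- The covering graph given by permutation voltages on the darts. -/
def voltageCover (G : Multigraph V) (s : G.Dart → Equiv.Perm ι)
    (hs : ∀ e, s (G.rev e) = (s e)⁻¹) : Multigraph (V × ι) where
  Dart := G.Dart × ι
  src p := (G.src p.1, p.2)
  rev p := (G.rev p.1, s p.1 p.2)
  rev_rev p := by simp [G.rev_rev, hs]
  rev_ne p h := G.rev_ne p.1 (Prod.ext_iff.1 h).1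

section VoltageCover

variable {G : Multigraph V} {s : G.Dart → Equiv.Perm ι} {hs : ∀ e, s (G.rev e) = (s e)⁻¹}

theorem IsSimple.voltageCover (h : G.IsSimple) : (G.voltageCover s hs).IsSimple := by
  refine ⟨fun e he => h.1 e.1 (Prod.ext_iff.1 he).1, fun e e' h1 h2 => ?_⟩
  have h3 := Prod.ext_iff.1 h1
  exact Prod.ext (h.2 _ _ h3.1 (Prod.ext_iff.1 h2).1) h3.2

/-- A parallel function for the voltages pulled back to the tree supplies the sheet coordinate of
the lifted covering map. -/
theorem Covering.exists_voltageCover {T : SimpleGraph W} (hT : T.IsTree)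
    (π : Covering (ofSimple T) G) (o : W) (i : ι) :
    ∃ π' : Covering (ofSimple T) (G.voltageCover s hs), π'.onVert o = (π.onVert o, i) := by
  obtain ⟨f, hfo, hf⟩ := hT.exists_parallel (fun d => s (π.onDart d))
    (fun d => (congrArg s (π.rev_onDart d)).symm.trans (hs _)) o i
  refine ⟨{ onVert := fun t => (π.onVert t, f t)
            onDart := fun d => (π.onDart d, f ((ofSimple T).src d))
            src_onDart := fun d => Prod.ext (π.src_onDart d) rfl
            rev_onDart := fun d => Prod.ext (π.rev_onDart d) (hf d).symm
            bijOn_star := fun t => ⟨?_, ?_, ?_⟩ }, by simp [hfo]⟩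
  · intro d hd
    exact Prod.ext ((π.bijOn_star t).mapsTo hd) (congrArg f hd)
  · intro d hd d' hd' h
    exact (π.bijOn_star t).injOn hd hd' (Prod.ext_iff.1 h).1
  · rintro ⟨e, j⟩ he
    have he' := Prod.ext_iff.1 he
    obtain ⟨d, hd, hde⟩ := (π.bijOn_star t).surjOn he'.1
    refine ⟨d, hd, Prod.ext hde ?_⟩
    rw [show j = f t from he'.2]
    exact congrArg f hd

theorem IsInFamily.voltageCover [Finite ι] {T : SimpleGraph W} (h : G.IsInFamily T) :
    (G.voltageCover s hs).IsInFamily T where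
  isTree := h.isTree
  finite_vert := by
    have := h.finite_vert
    infer_instance
  finite_dart := by
    have := h.finite_dart
    exact inferInstanceAs (Finite (G.Dart × ι))
  covered := by
    rintro ⟨v, i⟩
    obtain ⟨π, o, rfl⟩ := h.covered v
    obtain ⟨π', h'⟩ := π.exists_voltageCover (s := s) (hs := hs) h.isTree o i
    exact ⟨π', o, h'⟩

end VoltageCover

/-! ### Positivity of matching polynomials above the spectral radius -/

section Degrees

variable {T : SimpleGraph W} {G : Multigraph V}

/-- The darts of a simple graph starting at `t`, as neighbours of `t`. -/
def starEquivNeighborSet (T : SimpleGraph W) (t : W) :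
    {d : (ofSimple T).Dart // (ofSimple T).src d = t} ≃ T.neighborSet t where
  toFun d := ⟨(ofSimple T).tgt d.1, (congrArg (T.Adj · _) d.2).mp d.1.adj⟩
  invFun u := ⟨(⟨(t, u.1), u.2⟩ : T.Dart), rfl⟩
  left_inv := by
    rintro ⟨d, rfl⟩
    rfl
  right_inv _ := rfl

theorem Covering.card_tgt_eq (π : Covering (ofSimple T) G) (t : W) (w : V) :
    Nat.card {e : G.Dart // G.src e = π.onVert t ∧ G.tgt e = w} =
      Nat.card {u : T.neighborSet t // π.onVert u = w} := by
  refine (Nat.card_congr ?_).symm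
  refine (((starEquivNeighborSet T t).symm.trans
    (π.bijOn_star t).equiv).subtypeEquiv (q := fun e : {e | G.src e = π.onVert t} => G.tgt e.1 = w) fun u => ?_).trans
    (Equiv.subtypeSubtypeEquivSubtypeInter (fun e => G.src e = π.onVert t) fun e => G.tgt e = w)
  have : G.tgt (π.onDart ((starEquivNeighborSet T t).symm u).1) = π.onVert u := by
    rw [tgt, π.rev_onDart, π.src_onDart]
    rfl
  rw [← this]
  rfl

theorem Covering.finite_neighborSet [Finite G.Dart] (π : Covering (ofSimple T) G) (t : W) :
    (T.neighborSet t).Finite :=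
  Finite.of_equiv _ ((π.bijOn_star t).equiv.symm.trans (starEquivNeighborSet T t))

theorem Covering.ncard_neighborSet (π : Covering (ofSimple T) G) (t : W) :
    (T.neighborSet t).ncard = Nat.card {e : G.Dart // G.src e = π.onVert t} :=
  Nat.card_congr ((starEquivNeighborSet T t).symm.trans (π.bijOn_star t).equiv)

/-- Stars are mapped bijectively, so edges from `π.onVert t`, counted with multiplicity, are the
tree edges at `t`. This transfers the matching recursion to the tree. -/
theorem Covering.sum_adjMatrix_mul [DecidableEq V] (π : Covering (ofSimple T) G) (t : W)
    (hfin : (T.neighborSet t).Finite) (S : Finset V) (φ : V → ℝ) :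
    ∑ w ∈ S, G.adjMatrix (π.onVert t) w * φ w =
      ∑ u ∈ hfin.toFinset with π.onVert u ∈ S, φ (π.onVert u) := by
  rw [← Finset.sum_fiberwise_of_maps_to (t := S) (g := π.onVert) (by simp)]
  refine Finset.sum_congr rfl fun w hw => ?_
  rw [Finset.sum_congr rfl (g := fun _ => φ w) (by simp +contextual), Finset.sum_const,
    nsmul_eq_mul, adjMatrix, Matrix.of_apply, π.card_tgt_eq]
  congr 2
  rw [Nat.card_congr (Equiv.subtypeSubtypeEquivSubtypeInter _ fun u => π.onVert u = w)]
  refine Nat.subtype_card _ fun u => ?_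
  simp only [Finset.mem_filter, Set.Finite.mem_toFinset]
  exact ⟨fun h => ⟨h.1.1, h.2⟩, fun h => ⟨⟨h.1, h.2 ▸ hw⟩, h.2⟩⟩

/-- The positivity of a function on the sets of vertices which satisfies the recursion of the
matching polynomial, above the spectral radius of the universal covering tree. -/
theorem IsInFamily.pos_of_recursion [DecidableEq V] (hG : G.IsInFamily T)
    (hfin : ∀ t, (T.neighborSet t).Finite) {x : ℝ} {g : W → ℝ} (hg : ∀ t, 0 < g t)
    (hgx : ∀ t, ∑ u ∈ (hfin t).toFinset, g u < x * g t) (m : Finset V → ℝ) (h0 : 0 < m ∅)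
    (hrec : ∀ S, ∀ v ∈ S, m S = x * m (S.erase v) -
      ∑ w ∈ S.erase v, G.adjMatrix v w * m ((S.erase v).erase w)) (S : Finset V) : 0 < m S := by
  classical
  -- Strengthened induction: `m S / m (S \ v) ≥ g t' / g t` for `t` over `v` having a neighbour `t'`
  -- over a removed vertex. In the recursion at `v` this bounds each ratio `m (S \ v \ w) / m (S \
  -- v)` by `g u / g t`, with `t` as the removed neighbour of `u`.
  suffices h : 0 < m S ∧ ∀ π : Covering (ofSimple T) G, ∀ t t', π.onVert t ∈ S → T.Adj t t' →
      π.onVert t' ∉ S → g t' * m (S.erase (π.onVert t)) ≤ g t * m S from h.1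
  induction S using Finset.strongInduction with
  | H S ih =>
  have key : ∀ π : Covering (ofSimple T) G, ∀ t, π.onVert t ∈ S →
      0 < m (S.erase (π.onVert t)) ∧ m (S.erase (π.onVert t)) *
        (x * g t - ∑ u ∈ (hfin t).toFinset with π.onVert u ∈ S.erase (π.onVert t), g u) ≤
        g t * m S := by
    intro π t ht
    obtain ⟨h1, h2⟩ := ih _ (Finset.erase_ssubset ht)
    refine ⟨h1, ?_⟩
    rw [hrec S _ ht, π.sum_adjMatrix_mul t (hfin t), mul_sub, mul_sub, Finset.mul_sum,
      Finset.mul_sum]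
    have : ∑ u ∈ (hfin t).toFinset with π.onVert u ∈ S.erase (π.onVert t),
          g t * m ((S.erase (π.onVert t)).erase (π.onVert u)) ≤
        ∑ u ∈ (hfin t).toFinset with π.onVert u ∈ S.erase (π.onVert t),
          m (S.erase (π.onVert t)) * g u := by
      refine Finset.sum_le_sum fun u hu => ?_
      simp only [Finset.mem_filter, Set.Finite.mem_toFinset, SimpleGraph.mem_neighborSet] at hu
      rw [mul_comm _ (g u)]
      exact h2 π u t hu.2 hu.1.symm (by simp)
    linarith
  refine ⟨?_, fun π t t' ht htt' ht' => ?_⟩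
  · obtain rfl | ⟨v, hv⟩ := S.eq_empty_or_nonempty
    · exact h0
    obtain ⟨π, t, rfl⟩ := hG.covered v
    obtain ⟨h1, h2⟩ := key π t hv
    refine pos_of_mul_pos_right ((mul_pos h1 ?_).trans_le h2) (hg t).le
    refine sub_pos.2 (lt_of_le_of_lt ?_ (hgx t))
    exact Finset.sum_le_sum_of_subset_of_nonneg (Finset.filter_subset _ _) fun u _ _ => (hg u).le
  -- The neighbour `t'` does not occur in the filtered sum, so the supersolution inequality leaves
  -- at least `g t'`.
  · obtain ⟨h1, h2⟩ := key π t ht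
    refine le_trans ?_ h2
    rw [mul_comm]
    refine mul_le_mul_of_nonneg_left (le_sub_iff_add_le'.2 (le_trans ?_ (hgx t).le)) h1.le
    rw [add_comm, ← Finset.sum_insert (f := g)
      (fun h => ht' (Finset.mem_of_mem_erase (Finset.mem_filter.1 h).2) :
        t' ∉ (hfin t).toFinset.filter fun u => π.onVert u ∈ S.erase (π.onVert t))]
    refine Finset.sum_le_sum_of_subset_of_nonneg ?_ fun u _ _ => (hg u).le
    exact Finset.insert_subset (by simpa using htt') (Finset.filter_subset _ _)

end Degrees

end Multigraph

/-! ### Covers of bipartite graphs and their average new factor -/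

namespace Multigraph

variable {V : Type*} {W : Type*} {ι : Type*} (G : Multigraph V)

/-- The darts of `G` starting at a vertex of the colour `true`. -/
abbrev TrueDart (c : V → Bool) : Type _ := {e : G.Dart // c (G.src e) = true}

variable {G} {c : V → Bool}

theorem color_src_rev (hc : ∀ e, c (G.src e) ≠ c (G.tgt e)) {e : G.Dart} (h : c (G.src e) ≠ true) : c (G.src (G.rev e)) = true := by
  have := hc e
  rw [src_rev]
  cases h1 : c (G.src e) <;> cases h2 : c (G.tgt e) <;> simp_all

theorem sum_dart_eq_sum_trueDart [Fintype G.Dart] [Fintype (G.TrueDart c)]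
    (hc : ∀ e, c (G.src e) ≠ c (G.tgt e)) {M : Type*} [AddCommMonoid M] (f : G.Dart → M) :
    ∑ e, f e = ∑ e : G.TrueDart c, (f e + f (G.rev e)) := by
  classical
  rw [Finset.sum_add_distrib, ← Finset.sum_filter_add_sum_filter_not Finset.univ
    fun e => c (G.src e) = true]
  congr 1
  · exact (Finset.sum_subtype _ (by simp) f)
  · refine (Finset.sum_nbij' (fun e => G.rev e.1)
      (fun e => if h : c (G.src e) = true then ⟨e, h⟩ else
        ⟨G.rev e, color_src_rev hc h⟩) ?_ ?_ ?_ ?_ ?_).symm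
    · intro e _
      have := hc e
      simp only [Finset.mem_filter, Finset.mem_univ, true_and, src_rev]
      rw [e.2] at this
      exact this.symm
    · simp
    · intro e _
      have := hc e
      rw [e.2] at this
      rw [dif_neg (by rw [src_rev]; exact this.symm)]
      exact Subtype.ext (G.rev_rev _)
    · intro e he
      rw [dif_neg (Finset.mem_filter.1 he).2]
      exact G.rev_rev _
    · simp

theorem adjMatrix_apply_eq_sum [Fintype G.Dart] [DecidableEq V] (u v : V) :
    G.adjMatrix u v = ∑ e, if G.src e = u ∧ G.tgt e = v then (1 : ℝ) else 0 := by
  classical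
  rw [adjMatrix, Matrix.of_apply, Nat.card_eq_fintype_card, Fintype.card_subtype,
    Finset.sum_boole]

/-- The voltages which are given on the darts starting at a vertex of the colour `true`. -/
def voltageOf (hc : ∀ e, c (G.src e) ≠ c (G.tgt e))
    (σ : G.TrueDart c → Equiv.Perm ι) (e : G.Dart) : Equiv.Perm ι :=
  if h : c (G.src e) = true then (σ ⟨e, h⟩)⁻¹ else σ ⟨G.rev e, color_src_rev hc h⟩

theorem voltageOf_trueDart (hc : ∀ e, c (G.src e) ≠ c (G.tgt e))
    (σ : G.TrueDart c → Equiv.Perm ι) (e : G.TrueDart c) : voltageOf hc σ e = (σ e)⁻¹ :=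
  dif_pos e.2

theorem voltageOf_rev_trueDart (hc : ∀ e, c (G.src e) ≠ c (G.tgt e))
    (σ : G.TrueDart c → Equiv.Perm ι) (e : G.TrueDart c) : voltageOf hc σ (G.rev e) = σ e := by
  have := hc e
  rw [e.2] at this
  rw [voltageOf, dif_neg (by rw [src_rev]; exact this.symm)]
  exact congrArg σ (Subtype.ext (G.rev_rev _))

theorem voltageOf_rev (hc : ∀ e, c (G.src e) ≠ c (G.tgt e))
    (σ : G.TrueDart c → Equiv.Perm ι) (e : G.Dart) :
    voltageOf hc σ (G.rev e) = (voltageOf hc σ e)⁻¹ := by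
  by_cases h : c (G.src e) = true
  · rw [voltageOf_rev_trueDart hc σ ⟨e, h⟩, voltageOf_trueDart hc σ ⟨e, h⟩, inv_inv]
  · have h' := color_src_rev hc h
    have h1 := voltageOf_trueDart hc σ ⟨_, h'⟩
    have h2 := voltageOf_rev_trueDart hc σ ⟨_, h'⟩
    simp only [G.rev_rev] at h2
    rw [h1, h2]

/-- The covering graph given by permutations on the darts starting at a vertex of the colour
`true`. -/
def bipartiteCover (hc : ∀ e, c (G.src e) ≠ c (G.tgt e)) (σ : G.TrueDart c → Equiv.Perm ι) :
    Multigraph (V × ι) :=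
  G.voltageCover (voltageOf hc σ) (voltageOf_rev hc σ)

variable [Fintype (G.TrueDart c)] [DecidableEq V] [DecidableEq ι]

theorem adjMatrix_bipartiteCover [Finite G.Dart] [Finite ι]
    (hc : ∀ e, c (G.src e) ≠ c (G.tgt e)) (σ : G.TrueDart c → Equiv.Perm ι) :
    (bipartiteCover hc σ).adjMatrix =
      blockMatrix (fun e : G.TrueDart c => G.src e) (fun e => G.tgt e) fun e =>
        (Matrix.of fun i j => if σ e j = i then 1 else 0,
          Matrix.of fun i j => if (σ e)⁻¹ j = i then 1 else 0) := by
  have := Fintype.ofFinite G.Dart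
  have := Fintype.ofFinite ι
  let : Fintype (bipartiteCover hc σ).Dart := inferInstanceAs (Fintype (G.Dart × ι))
  ext ⟨u, i⟩ ⟨v, j⟩
  rw [adjMatrix_apply_eq_sum, blockMatrix, Matrix.of_apply]
  refine (Fintype.sum_prod_type (α₁ := G.Dart) (α₂ := ι) fun e =>
    if (bipartiteCover hc σ).src e = (u, i) ∧ (bipartiteCover hc σ).tgt e = (v, j)
      then (1 : ℝ) else 0).trans ?_
  rw [sum_dart_eq_sum_trueDart (c := c) hc]
  refine Finset.sum_congr rfl fun e _ => congrArg₂ _ ?_ ?_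
  · rw [Finset.sum_eq_single i]
    · change (if (G.src e, i) = (u, i) ∧ (G.tgt e, voltageOf hc σ e i) = (v, j) then (1 : ℝ)
        else 0) = _
      simp only [voltageOf_trueDart, Prod.mk.injEq, Matrix.of_apply]
      grind [Equiv.Perm.inv_eq_iff_eq]
    · intro k _ hk
      refine if_neg fun h => hk (Prod.ext_iff.1 h.1).2
    · simp
  · rw [Finset.sum_eq_single i]
    · change (if (G.src (G.rev e), i) = (u, i) ∧
        (G.tgt (G.rev e), voltageOf hc σ (G.rev e) i) = (v, j) then (1 : ℝ) else 0) = _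
      simp only [voltageOf_rev_trueDart, Prod.mk.injEq, Matrix.of_apply, src_rev, tgt_rev]
      grind [Equiv.Perm.inv_eq_iff_eq]
    · intro k _ hk
      refine if_neg fun h => hk (Prod.ext_iff.1 h.1).2
    · simp

end Multigraph

/-- The permutation parts define a `d`-sheeted cover, and the signs are independent signs on its
edges; so summing over the signs yields its matching polynomial. -/
theorem signedAdjMatrix_eq_blockMatrix {V E : Type*} [DecidableEq V] [Fintype E] {d : ℕ}
    (a b : E → V) (τ : E → Equiv.Perm (Fin d)) (ε : E → Fin d → ℤˣ) :
    signedAdjMatrix (fun f : E × Fin d => (a f.1, f.2)) (fun f => (b f.1, (τ f.1)⁻¹ f.2))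
      (fun f => ε f.1 f.2) =
    blockMatrix a b fun e =>
      (signedPermMatrix (τ e) (ε e), (signedPermMatrix (τ e) (ε e)).transpose) := by
  ext ⟨u, i⟩ ⟨v, j⟩
  rw [signedAdjMatrix, Matrix.of_apply, Fintype.sum_prod_type, blockMatrix, Matrix.of_apply]
  refine Finset.sum_congr rfl fun e _ => ?_
  simp only [edgeCount, mul_add, Finset.sum_add_distrib]
  congr 1
  · rw [Finset.sum_eq_single i]
    · simp only [signedPermMatrix, Matrix.of_apply, Prod.mk.injEq, Equiv.Perm.inv_eq_iff_eq]
      grind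
    · intro k _ hk
      rw [if_neg fun h => hk (Prod.ext_iff.1 h.1).2, mul_zero]
    · simp
  · rw [Finset.sum_eq_single j]
    · simp only [signedPermMatrix, Matrix.of_apply, Prod.mk.injEq, Equiv.Perm.inv_eq_iff_eq,
        Matrix.transpose_apply]
      grind
    · intro k _ hk
      rw [if_neg fun h => hk (Prod.ext_iff.1 h.2).2, mul_zero]
    · simp

namespace Multigraph

variable {V W : Type*} {G : Multigraph V} {T : SimpleGraph W} {c : V → Bool}

theorem IsInFamily.exists_supersolution [Nonempty V] (hG : G.IsInFamily T) {x : ℝ}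
    (hx : T.specRadius < x) : ∃ hfin : ∀ t, (T.neighborSet t).Finite, ∃ g : W → ℝ,
      (∀ t, 0 < g t) ∧ ∀ t, ∑ u ∈ (hfin t).toFinset, g u < x * g t := by
  have := hG.finite_dart
  obtain ⟨v⟩ := ‹Nonempty V›
  obtain ⟨π, -⟩ := hG.covered v
  exact ⟨π.finite_neighborSet, T.exists_pos_supersolution hG.isTree.connected (Nat.card G.Dart)
    π.finite_neighborSet (fun t => (π.ncard_neighborSet t).trans_le
      (Nat.card_le_card_of_injective _ Subtype.val_injective)) hx⟩

variable [Fintype V] [DecidableEq V] [Fintype (G.TrueDart c)] [DecidableEq (G.TrueDart c)] {d : ℕ}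

theorem IsInFamily.sum_signs_det_pos (hG : G.IsInFamily T)
    (hc : ∀ e, c (G.src e) ≠ c (G.tgt e)) (τ : G.TrueDart c → Equiv.Perm (Fin d)) {x : ℝ}
    (hx : T.specRadius < x) :
    0 < ∑ ε : G.TrueDart c → Fin d → ℤˣ, (Matrix.scalar (V × Fin d) x -
      blockMatrix (fun e : G.TrueDart c => G.src e) (fun e => G.tgt e) fun e =>
        (signedPermMatrix (τ e) (ε e), (signedPermMatrix (τ e) (ε e)).transpose)).det := by
  have := hG.finite_dart
  simp only [← signedAdjMatrix_eq_blockMatrix]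
  obtain h | h := isEmpty_or_nonempty V
  · refine Finset.sum_pos (fun ε _ => ?_) Finset.univ_nonempty
    rw [Matrix.det_isEmpty]
    exact one_pos
  obtain ⟨hfin, g, hg, hgx⟩ := hG.exists_supersolution hx
  set s : G.TrueDart c × Fin d → V × Fin d := fun f => (G.src f.1, f.2) with hs
  set t : G.TrueDart c × Fin d → V × Fin d := fun f => (G.tgt f.1, (τ f.1)⁻¹ f.2) with ht
  have hst : ∀ f, s f ≠ t f := fun f h => hc f.1 (congrArg c (Prod.ext_iff.1 h).1)
  have hadj : ∀ v w, ∑ f, edgeCount s t f v w = (bipartiteCover hc τ).adjMatrix v w := by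
    intro v w
    have h1 := congrFun₂ (signedAdjMatrix_eq_blockMatrix (fun e : G.TrueDart c => G.src e)
      (fun e => G.tgt e) τ fun _ _ => 1) v w
    rw [signedAdjMatrix, Matrix.of_apply] at h1
    simp only [Units.val_one, Int.cast_one, one_mul] at h1
    rw [adjMatrix_bipartiteCover, h1]
    simp only [signedPermMatrix, Units.val_one, Int.cast_one, blockMatrix, Matrix.of_apply,
      Matrix.transpose_apply, Equiv.Perm.inv_eq_iff_eq]
    grind
  have hpos := (hG.voltageCover (s := voltageOf hc τ) (hs := voltageOf_rev hc τ)).pos_of_recursion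
    hfin hg hgx (signedCharpolySum s t x) (signedCharpolySum_empty s t x) (fun S v hv => by
      rw [signedCharpolySum_recursion hst x hv]
      simp only [← Finset.sum_mul, hadj]
      rfl) Finset.univ
  rw [signedCharpolySum_univ] at hpos
  refine hpos.trans_eq ?_
  exact Fintype.sum_equiv (Equiv.curry _ _ _) _ _ fun ε => rfl

/-- The exchange turns this sum, up to positive factors, into a sum over `d`-sheeted covers of sign
sums, each of which is positive. -/
theorem IsInFamily.sum_det_stdMatrix_pos (hG : G.IsInFamily T)
    (hc : ∀ e, c (G.src e) ≠ c (G.tgt e)) {x : ℝ} (hx : T.specRadius < x) :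
    0 < ∑ σ : G.TrueDart c → Equiv.Perm (Fin (d + 1)), (Matrix.scalar (V × Fin d) x -
      blockMatrix (fun e : G.TrueDart c => G.src e) (fun e => G.tgt e) fun e =>
        (stdMatrix (σ e), stdMatrix (σ e)⁻¹)).det := by
  have h := average_det_sub_blockMatrix (fun e : G.TrueDart c => G.src e) (fun e => G.tgt e)
    (fun e h => hc e (congrArg c h)) (Matrix.scalar (V × Fin d) x)
  refine pos_of_mul_pos_right (b := _) (h.symm ▸ mul_pos (by simp [Fintype.card_pos]) ?_)
    (Nat.cast_nonneg _)
  rw [← (Equiv.arrowProdEquivProdArrow _ (fun _ => Equiv.Perm (Fin d))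
    fun _ => (Fin d → ℤˣ)).symm.sum_comp, Fintype.sum_prod_type]
  exact Finset.sum_pos (fun τ _ => hG.sum_signs_det_pos hc τ hx) Finset.univ_nonempty

end Multigraph

/-! ### Splitting off the old eigenvalues and selecting a cover -/

section VoltageAction

variable {V E ι : Type*} [DecidableEq V] [DecidableEq ι] (a : E → V)

/-- The action of the permutations on the fibre of `v`. -/
def fibrePerm (v : V) : Equiv.Perm ι →* Equiv.Perm (V × ι) where
  toFun := Equiv.Perm.prodExtendRight v
  map_one' := by
    ext ⟨w, i⟩ <;> by_cases h : w = v <;> simp [Equiv.Perm.prodExtendRight, h]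
  map_mul' σ τ := by
    ext ⟨w, i⟩ <;> by_cases h : w = v <;> simp [Equiv.Perm.prodExtendRight, h]

theorem fibrePerm_swap (v : V) (i j : ι) :
    fibrePerm v (Equiv.swap i j) = Equiv.swap (v, i) (v, j) := by
  ext ⟨w, k⟩ : 1
  by_cases h : w = v
  · subst h
    simp only [fibrePerm, MonoidHom.coe_mk, OneHom.coe_mk, Equiv.Perm.prodExtendRight_apply_eq,
      Equiv.swap_apply_def, Prod.mk.injEq, true_and]
    split_ifs <;> rfl
  · simp only [fibrePerm, MonoidHom.coe_mk, OneHom.coe_mk]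
    rw [Equiv.Perm.prodExtendRight_apply_ne _ h, Equiv.swap_apply_of_ne_of_ne] <;>
    simp [h]

/-- The actions of the voltages on the edges. -/
def voltageAction (ι : Type*) : Option E → (E → Equiv.Perm ι) →* Equiv.Perm (V × ι)
  | none => 1
  | some e => (fibrePerm (a e)).comp (Pi.evalMonoidHom _ e)

theorem isSwapStep_voltageAction [DecidableEq E] (e : E) (i j : ι) :
    IsSwapStep (voltageAction a ι) (Pi.mulSingle e (Equiv.swap i j)) := by
  refine ⟨some e, (a e, i), (a e, j), ?_, ?_⟩
  · simp [voltageAction, fibrePerm_swap]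
  · rintro (_ | e') he
    · rfl
    · have : e' ≠ e := fun h => he (by rw [h])
      simp [voltageAction, this]

end VoltageAction

section CoverDeterminant

open Matrix Kronecker

variable {V E κ : Type*} [Fintype E] [DecidableEq V] (a b : E → V)

theorem blockMatrix_eq_sum_kronecker (XY : E → Matrix κ κ ℝ × Matrix κ κ ℝ) :
    blockMatrix a b XY = ∑ e, (Matrix.single (a e) (b e) (1 : ℝ) ⊗ₖ (XY e).1 +
      Matrix.single (b e) (a e) (1 : ℝ) ⊗ₖ (XY e).2) := by
  ext p q
  simp only [blockMatrix, Matrix.of_apply, Matrix.sum_apply, Matrix.add_apply,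
    Matrix.kroneckerMap_apply, Matrix.single_apply, ite_mul, one_mul, zero_mul]
  grind

theorem blockMatrix_mul_kronecker [Fintype V] [Fintype κ]
    (XY : E → Matrix κ κ ℝ × Matrix κ κ ℝ) (B : Matrix κ κ ℝ) :
    blockMatrix a b XY * ((1 : Matrix V V ℝ) ⊗ₖ B) =
      blockMatrix a b fun e => ((XY e).1 * B, (XY e).2 * B) := by
  simp only [blockMatrix_eq_sum_kronecker, Finset.sum_mul, add_mul, ← mul_kronecker_mul, mul_one]

theorem kronecker_mul_blockMatrix [Fintype V] [Fintype κ]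
    (XY : E → Matrix κ κ ℝ × Matrix κ κ ℝ) (B : Matrix κ κ ℝ) :
    ((1 : Matrix V V ℝ) ⊗ₖ B) * blockMatrix a b XY =
      blockMatrix a b fun e => (B * (XY e).1, B * (XY e).2) := by
  simp only [blockMatrix_eq_sum_kronecker, Finset.mul_sum, mul_add, ← mul_kronecker_mul, one_mul]

variable {d : ℕ}

/-- The matrix of a permutation. -/
def permBlock {ι : Type*} [DecidableEq ι] (σ : Equiv.Perm ι) : Matrix ι ι ℝ :=
  Matrix.of fun i j => if σ j = i then 1 else 0

/-- The basis of the constant vector and the differences of the standard basis vectors with the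
first one. -/
def stdBasisMatrix (d : ℕ) : Matrix (Fin (d + 1)) (Fin (d + 1)) ℝ :=
  Matrix.of fun i j => if j = 0 then 1 else (if i = j then 1 else 0) - (if i = 0 then 1 else 0)

theorem isUnit_det_stdBasisMatrix (d : ℕ) : IsUnit (stdBasisMatrix d).det := by
  refine Matrix.isUnit_det_of_left_inverse (B := Matrix.of fun i k =>
    if i = 0 then ((d : ℝ) + 1)⁻¹ else (if k = i then 1 else 0) - ((d : ℝ) + 1)⁻¹) ?_
  have hd : (d : ℝ) + 1 ≠ 0 := by positivity
  ext i j
  simp only [Matrix.mul_apply, stdBasisMatrix, Matrix.of_apply, Matrix.one_apply]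
  by_cases hi : i = 0 <;> by_cases hj : j = 0
  · simp [hi, hj, hd]
  · simp [hi, hj, Ne.symm hj, mul_sub, Finset.sum_sub_distrib]
  · simp [hi, hj, hd, Finset.sum_sub_distrib]
  · simp only [hi, hj, if_false, sub_mul, mul_sub, Finset.sum_sub_distrib]
    simp [hi, eq_comm]

/-- A matrix bordered by a diagonal entry. -/
def borderMatrix (c : ℝ) (X : Matrix (Fin d) (Fin d) ℝ) : Matrix (Fin (d + 1)) (Fin (d + 1)) ℝ :=
  Matrix.of fun i j => Fin.cases (Fin.cases c (fun _ => 0) j)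
    (fun i => Fin.cases 0 (fun j => X i j) j) i

/-- The permutation representation is the trivial one plus the standard one; the change of basis
does not depend on `σ`, so it acts on all edges simultaneously. -/
theorem permBlock_mul_stdBasisMatrix (σ : Equiv.Perm (Fin (d + 1))) :
    permBlock σ * stdBasisMatrix d = stdBasisMatrix d * borderMatrix 1 (stdMatrix σ) := by
  ext i j
  have h1 : ∀ k, (permBlock σ * stdBasisMatrix d) i k = stdBasisMatrix d (σ⁻¹ i) k := by
    intro k
    simp only [Matrix.mul_apply, permBlock, Matrix.of_apply, ite_mul, one_mul, zero_mul]
    rw [Finset.sum_eq_single (σ⁻¹ i)]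
    · simp
    · intro l _ hl
      rw [if_neg fun h => hl (by simp [← h])]
    · simp
  rw [h1, Matrix.mul_apply, Fin.sum_univ_succ]
  refine Fin.cases ?_ (fun j => ?_) j
  · simp [stdBasisMatrix, borderMatrix]
  · simp only [borderMatrix, Matrix.of_apply, Fin.cases_zero, Fin.cases_succ, mul_zero, zero_add]
    have h2 : ∑ l : Fin d, stdMatrix σ l j =
        (if σ 0 = 0 then 1 else 0) - (if σ j.succ = 0 then 1 else 0) := by
      have h3 : ∀ m : Fin (d + 1), ∑ l : Fin d, (if m = l.succ then (1 : ℝ) else 0) =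
          1 - if m = 0 then 1 else 0 := by
        intro m
        have := Fin.sum_univ_succ fun l : Fin (d + 1) => if m = l then (1 : ℝ) else 0
        rw [Finset.sum_ite_eq, if_pos (Finset.mem_univ _)] at this
        linarith
      simp only [stdMatrix, Matrix.of_apply, Finset.sum_sub_distrib, h3]
      ring
    simp only [stdBasisMatrix, Matrix.of_apply, Fin.succ_ne_zero, if_false, sub_mul,
      Finset.sum_sub_distrib, ← Finset.mul_sum, h2]
    refine Fin.cases ?_ (fun i => ?_) i
    · simp only [Equiv.Perm.inv_eq_iff_eq]
      simp [(Fin.succ_ne_zero _).symm]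
      grind
    · simp only [Equiv.Perm.inv_eq_iff_eq]
      simp [stdMatrix]
      grind

theorem ones_mul_stdBasisMatrix :
    (Matrix.of fun _ _ => (1 : ℝ)) * stdBasisMatrix d =
      stdBasisMatrix d * borderMatrix ((d : ℝ) + 1) 0 := by
  ext i j
  rw [Matrix.mul_apply, Matrix.mul_apply, Fin.sum_univ_succ, Fin.sum_univ_succ]
  refine Fin.cases ?_ (fun j => ?_) j
  · simp [stdBasisMatrix, borderMatrix, add_comm]
  · simp [stdBasisMatrix, borderMatrix, Fin.succ_ne_zero, (Fin.succ_ne_zero _).symm]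

/-- The first point of every fibre, and the other ones. -/
def sumProdEquivProdFin (V : Type*) (d : ℕ) : V ⊕ V × Fin d ≃ V × Fin (d + 1) where
  toFun := Sum.elim (fun v => (v, 0)) fun p => (p.1, p.2.succ)
  invFun p := Fin.cases (Sum.inl p.1) (fun j => Sum.inr (p.1, j)) p.2
  left_inv := by rintro (v | p) <;> rfl
  right_inv := by
    rintro ⟨v, j⟩
    refine Fin.cases ?_ (fun j => ?_) j <;> rfl

/-- In the adapted basis of every fibre, the all-ones matrix is `d + 1` on the constants and `0` on
the rest. The penalty therefore shifts the old factor only. -/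
theorem det_sub_blockMatrix_permBlock [Fintype V] (σ : E → Equiv.Perm (Fin (d + 1))) (x c : ℝ) :
    (Matrix.scalar (V × Fin (d + 1)) x - (blockMatrix a b
        (fun e => (permBlock (σ e), permBlock (σ e)⁻¹)) -
        c • ((1 : Matrix V V ℝ) ⊗ₖ Matrix.of fun _ _ => (1 : ℝ)))).det =
      (Matrix.scalar V (x + c * (d + 1)) - Matrix.of fun u v => ∑ e,
        ((if u = a e ∧ v = b e then (1 : ℝ) else 0) + if u = b e ∧ v = a e then 1 else 0)).det *
      (Matrix.scalar (V × Fin d) x - blockMatrix a b fun e =>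
        (stdMatrix (σ e), stdMatrix (σ e)⁻¹)).det := by
  set B := (1 : Matrix V V ℝ) ⊗ₖ stdBasisMatrix d with hB
  have hBu : IsUnit B.det := by
    rw [hB, Matrix.det_kronecker, Matrix.det_one, one_pow, one_mul]
    exact (isUnit_det_stdBasisMatrix d).pow _
  set N := Matrix.scalar (V × Fin (d + 1)) x - (blockMatrix a b (fun e =>
      (borderMatrix 1 (stdMatrix (σ e)), borderMatrix 1 (stdMatrix (σ e)⁻¹))) -
      c • ((1 : Matrix V V ℝ) ⊗ₖ borderMatrix ((d : ℝ) + 1) 0)) with hN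
  have h1 : (Matrix.scalar (V × Fin (d + 1)) x - (blockMatrix a b
        (fun e => (permBlock (σ e), permBlock (σ e)⁻¹)) -
        c • ((1 : Matrix V V ℝ) ⊗ₖ Matrix.of fun _ _ => (1 : ℝ)))) * B = B * N := by
    rw [hN, hB, sub_mul, sub_mul, mul_sub, mul_sub, blockMatrix_mul_kronecker,
      kronecker_mul_blockMatrix, smul_mul_assoc, mul_smul_comm, ← mul_kronecker_mul,
      ← mul_kronecker_mul, ones_mul_stdBasisMatrix]
    simp only [permBlock_mul_stdBasisMatrix]
    rw [(Matrix.scalar_commute x (fun _ => mul_comm _ _) _).eq]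
  have h2 := congrArg Matrix.det h1
  rw [Matrix.det_mul, Matrix.det_mul, mul_comm] at h2
  rw [hBu.mul_left_cancel h2, ← Matrix.det_submatrix_equiv_self (sumProdEquivProdFin V d),
    ← Matrix.det_fromBlocks_zero₁₂ _ 0]
  congr 1
  ext (u | ⟨u, i⟩) (v | ⟨v, j⟩)
  · simp [hN, blockMatrix, borderMatrix, sumProdEquivProdFin, Matrix.diagonal_apply,
      Matrix.one_apply]
    split_ifs <;> ring
  · simp [hN, blockMatrix, borderMatrix, sumProdEquivProdFin,
      Matrix.one_apply, (Fin.succ_ne_zero _).symm]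
  · simp [hN, blockMatrix, borderMatrix, sumProdEquivProdFin,
      Matrix.one_apply, (Fin.succ_ne_zero _)]
  · simp [hN, blockMatrix, borderMatrix, sumProdEquivProdFin, Matrix.diagonal_apply,
      Matrix.one_apply]

variable {ι : Type*} [DecidableEq ι]

/-- The adjacency matrix of the trivial cover of the edge `e`. -/
def edgeBlock (ι : Type*) [DecidableEq ι] (e : E) : Matrix (V × ι) (V × ι) ℝ :=
  Matrix.of fun p q => (if p.1 = a e ∧ q.1 = b e then if q.2 = p.2 then 1 else 0 else 0) +
    (if p.1 = b e ∧ q.1 = a e then if q.2 = p.2 then 1 else 0 else 0)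

theorem sum_submatrix_edgeBlock (hab : ∀ e, a e ≠ b e) (σ : E → Equiv.Perm ι) :
    ∑ e, (edgeBlock a b ι e).submatrix (fibrePerm (a e) (σ e)).symm (fibrePerm (a e) (σ e)).symm =
      blockMatrix a b fun e => (permBlock (σ e), permBlock (σ e)⁻¹) := by
  ext ⟨u, i⟩ ⟨v, j⟩
  have h1 : ∀ e k, (fibrePerm (a e) (σ e)).symm (a e, k) = (a e, (σ e)⁻¹ k) := by
    intro e k
    rw [Equiv.symm_apply_eq]
    simp [fibrePerm]
  have h2 : ∀ e w k, w ≠ a e → (fibrePerm (a e) (σ e)).symm (w, k) = (w, k) := by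
    intro e w k h
    rw [Equiv.symm_apply_eq]
    exact (Equiv.Perm.prodExtendRight_apply_ne _ h _).symm
  rw [Matrix.sum_apply, blockMatrix, Matrix.of_apply]
  refine Finset.sum_congr rfl fun e _ => ?_
  rw [Matrix.submatrix_apply]
  by_cases hu : u = a e <;> by_cases hv : v = a e
  · subst hv
    rw [hu, h1, h1]
    simp [edgeBlock, hab]
  · rw [hu, h1, h2 _ _ _ hv]
    simp only [edgeBlock, permBlock, Matrix.of_apply, hab, hv, and_false, if_false,
      Equiv.Perm.eq_inv_iff_eq]
  · rw [hv, h1, h2 _ _ _ hu]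
    simp only [edgeBlock, permBlock, Matrix.of_apply, hab, hu, and_false, if_false]
  · rw [h2 _ _ _ hu, h2 _ _ _ hv]
    simp [edgeBlock, hu, hv]

/-- The penalty for the constant functions on the fibres, and the edges. -/
def penalizedBlocks (ι : Type*) [DecidableEq ι] (c : ℝ) : Option E → Matrix (V × ι) (V × ι) ℝ
  | none => -c • ((1 : Matrix V V ℝ) ⊗ₖ Matrix.of fun _ _ => (1 : ℝ))
  | some e => edgeBlock a b ι e

theorem sum_conjFamily_penalizedBlocks (hab : ∀ e, a e ≠ b e) (c : ℝ) (σ : E → Equiv.Perm ι) :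
    ∑ e, conjFamily (voltageAction a ι) σ (penalizedBlocks a b ι c) e =
      blockMatrix a b (fun e => (permBlock (σ e), permBlock (σ e)⁻¹)) -
        c • ((1 : Matrix V V ℝ) ⊗ₖ Matrix.of fun _ _ => (1 : ℝ)) := by
  rw [Fintype.sum_option, ← sum_submatrix_edgeBlock a b hab σ, sub_eq_neg_add, ← neg_smul]
  rfl

/-- If the average of the new characteristic polynomials of the covers is positive above `ρ`, then
so is the new characteristic polynomial of some cover. -/
theorem exists_det_sub_blockMatrix_stdMatrix_pos [Fintype V] [DecidableEq E]
    (hab : ∀ e, a e ≠ b e) (ρ : ℝ)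
    (h : ∀ x, ρ < x → 0 < ∑ σ : E → Equiv.Perm (Fin (d + 1)), (Matrix.scalar (V × Fin d) x -
      blockMatrix a b fun e => (stdMatrix (σ e), stdMatrix (σ e)⁻¹)).det) :
    ∃ σ : E → Equiv.Perm (Fin (d + 1)), ∀ x, ρ < x → 0 < (Matrix.scalar (V × Fin d) x -
      blockMatrix a b fun e => (stdMatrix (σ e), stdMatrix (σ e)⁻¹)).det := by
  set A : Matrix V V ℝ := Matrix.of fun u v => ∑ e,
    ((if u = a e ∧ v = b e then (1 : ℝ) else 0) + if u = b e ∧ v = a e then 1 else 0) with hA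
  obtain ⟨R, hR⟩ : ∃ R : ℝ, ∀ x, R < x → 0 < (Matrix.scalar V x - A).det := by
    obtain ⟨R, hR⟩ := Polynomial.exists_forall_ge_eval_pos (g := A.charpoly) (by
      rw [A.charpoly_monic.leadingCoeff]; exact one_pos)
    exact ⟨R, fun x hx => Matrix.eval_charpoly A x ▸ hR x hx.le⟩
  -- Chosen so that `c * (d + 1) = R - ρ`: the old factor at `x > ρ` is evaluated beyond `R`, where
  -- it is positive, and the sign is that of the new factor.
  set c : ℝ := (R - ρ) / (d + 1) with hc
  have hcd : ∀ x, ρ < x → 0 < (Matrix.scalar V (x + c * (d + 1)) - A).det := by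
    intro x hx
    refine hR _ ?_
    rw [hc, div_mul_cancel₀ _ (by positivity)]
    linarith
  have hfac : ∀ (σ : E → Equiv.Perm (Fin (d + 1))) (x : ℝ),
      (∑ e, conjFamily (voltageAction a _) σ (penalizedBlocks a b _ c) e).charpoly.eval x =
      (Matrix.scalar V (x + c * (d + 1)) - A).det * (Matrix.scalar (V × Fin d) x -
        blockMatrix a b fun e => (stdMatrix (σ e), stdMatrix (σ e)⁻¹)).det := by
    intro σ x
    rw [Matrix.eval_charpoly, sum_conjFamily_penalizedBlocks a b hab,
      det_sub_blockMatrix_permBlock]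
  obtain ⟨L, hL, hLsum⟩ := exists_walkAverage_pi (M := Polynomial ℝ) (ι := E) (d + 1)
  obtain ⟨σ, hσ⟩ := exists_charpoly_pos (voltageAction a (Fin (d + 1))) L (fun x hx => by
      obtain ⟨⟨e, i, j, hx1⟩, hx2⟩ := hL x hx
      exact ⟨hx1 ▸ isSwapStep_voltageAction a e i j, hx2⟩) ρ (penalizedBlocks a b _ c) (by
      rintro (_ | e)
      · ext p q
        simp only [penalizedBlocks, Matrix.transpose_apply, Matrix.smul_apply,
          Matrix.kroneckerMap_apply, Matrix.one_apply, eq_comm]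
        rfl
      · ext p q
        simp only [penalizedBlocks, edgeBlock, Matrix.transpose_apply, Matrix.of_apply]
        grind) (by
      intro x hx
      rw [expectedCharpoly, hLsum]
      simp only [mul_one]
      rw [Polynomial.eval_smul, Polynomial.eval_finsetSum]
      simp only [hfac, ← Finset.mul_sum]
      have : 0 < Fintype.card (E → Equiv.Perm (Fin (d + 1))) := Fintype.card_pos
      exact mul_pos (by positivity) (mul_pos (hcd x hx) (h x hx)))
  refine ⟨σ, fun x hx => ?_⟩
  have := hσ x hx
  rw [hfac] at this
  exact pos_of_mul_pos_right this (hcd x hx).le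

end CoverDeterminant

/-! ### Spectra of bipartite graphs -/

namespace Multigraph

variable {V W : Type*} [Fintype V] [DecidableEq V] {G : Multigraph V} {T : SimpleGraph W}
  {c : V → Bool}

theorem roots_charpoly_adjMatrix (G : Multigraph V) :
    G.adjMatrix.charpoly.roots = Multiset.map G.eigenvalue Finset.univ.val := by
  refine Eq.trans ?_ (@Matrix.IsHermitian.roots_charpoly_eq_eigenvalues₀ ℝ _ V _ _
    (fun a b => Classical.propDecidable (a = b)) G.adjMatrix_isHermitian)
  congr!

theorem eigenvalue_antitone (G : Multigraph V) : Antitone G.eigenvalue :=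
  G.adjMatrix_isHermitian.eigenvalues₀_antitone

theorem countP_roots_charpoly (G : Multigraph V) (p : ℝ → Prop) [DecidablePred p] :
    G.adjMatrix.charpoly.roots.countP p = (Finset.univ.filter fun i => p (G.eigenvalue i)).card := by
  rw [roots_charpoly_adjMatrix, Multiset.countP_map]
  rfl

theorem map_neg_roots_charpoly (hc : ∀ e, c (G.src e) ≠ c (G.tgt e)) :
    G.adjMatrix.charpoly.roots.map (fun x => -x) = G.adjMatrix.charpoly.roots := by
  -- Changing the sign of functions on one colour class conjugates the adjacency matrix into its
  -- negative.
  set S : Matrix V V ℝ := Matrix.diagonal fun v => if c v then 1 else -1 with hS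
  have hSS : S * S = 1 := by
    rw [hS, Matrix.diagonal_mul_diagonal, ← Matrix.diagonal_one]
    congr 1
    ext v
    split_ifs <;> norm_num
  have hSA : S * G.adjMatrix * S = -G.adjMatrix := by
    ext u v
    rw [hS, Matrix.mul_diagonal, Matrix.diagonal_mul, Matrix.neg_apply]
    by_cases h : c u = c v
    · have : G.adjMatrix u v = 0 := by
        rw [adjMatrix, Matrix.of_apply, Nat.cast_eq_zero, Nat.card_eq_zero]
        exact Or.inl ⟨fun e => hc e.1 (by rw [e.2.1, e.2.2, h])⟩
      rw [this]
      simp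
    · cases hu : c u <;> cases hv : c v <;> simp_all
  have hcomp : G.adjMatrix.charpoly.comp (-Polynomial.X) =
      Polynomial.C ((-1) ^ Fintype.card V) * G.adjMatrix.charpoly := by
    refine Polynomial.funext fun x => ?_
    rw [Polynomial.eval_comp, Polynomial.eval_neg, Polynomial.eval_X, Polynomial.eval_mul,
      Polynomial.eval_C, Matrix.eval_charpoly, Matrix.eval_charpoly, ← Matrix.det_neg]
    have h1 : S * (Matrix.scalar V (-x) - G.adjMatrix) * S =
        -(Matrix.scalar V x - G.adjMatrix) := by
      rw [mul_sub, sub_mul, hSA, ← (Matrix.scalar_commute (-x) (fun _ => mul_comm _ _) S).eq,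
        mul_assoc, hSS, mul_one, map_neg]
      abel
    rw [← h1, Matrix.det_mul, Matrix.det_mul]
    have h2 : S.det * S.det = 1 := by rw [← Matrix.det_mul, hSS, Matrix.det_one]
    linear_combination -(Matrix.scalar V (-x) - G.adjMatrix).det * h2
  rw [← Polynomial.roots_comp_neg_X, hcomp, Polynomial.roots_C_mul _ (by simp)]

/-- By symmetry of the spectrum, the eigenvalues below `-ρ` are as many as those above `ρ`. The
count also handles the last eigenvalue, which the interval condition ignores. -/
theorem forall_eigenvalue_mem_iff (hc : ∀ e, c (G.src e) ≠ c (G.tgt e)) {ρ : ℝ} (hρ : 0 ≤ ρ) :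
    (∀ i : Fin (Fintype.card V), 0 < (i : ℕ) → (i : ℕ) + 1 < Fintype.card V →
      G.eigenvalue i ∈ Set.Icc (-ρ) ρ) ↔ G.adjMatrix.charpoly.roots.countP (ρ < ·) ≤ 1 := by
  rw [countP_roots_charpoly, Finset.card_le_one]
  simp only [Finset.mem_filter, Finset.mem_univ, true_and]
  constructor
  · intro h
    have key : ∀ i, ρ < G.eigenvalue i → (i : ℕ) = 0 := by
      intro i hi
      by_contra h0
      by_cases h1 : (i : ℕ) + 1 < Fintype.card V
      · exact hi.not_ge (h i (Nat.pos_of_ne_zero h0) h1).2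
      · have h2 : -G.eigenvalue i ∈ G.adjMatrix.charpoly.roots := by
          rw [← map_neg_roots_charpoly hc, roots_charpoly_adjMatrix]
          exact Multiset.mem_map_of_mem _ (Multiset.mem_map_of_mem _ (Finset.mem_univ i))
        rw [roots_charpoly_adjMatrix, Multiset.mem_map] at h2
        obtain ⟨j, -, hj⟩ := h2
        have h3 := G.eigenvalue_antitone (show j ≤ i from Fin.le_def.2 (by omega))
        linarith
    exact fun i hi j hj => Fin.ext ((key i hi).trans (key j hj).symm)
  · intro h i hi0 hi1
    refine ⟨?_, ?_⟩
    · by_contra! h1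
      have h2 : G.adjMatrix.charpoly.roots.countP (· < -ρ) ≤ 1 := by
        rw [← map_neg_roots_charpoly hc, Multiset.countP_map]
        simp only [neg_lt_neg_iff]
        rw [← Multiset.countP_eq_card_filter, countP_roots_charpoly, Finset.card_le_one]
        simpa using h
      rw [countP_roots_charpoly, Finset.card_le_one] at h2
      have h3 := h2 i (by simpa using h1) ⟨Fintype.card V - 1, by omega⟩ (by
        simp only [Finset.mem_filter, Finset.mem_univ, true_and]
        exact (G.eigenvalue_antitone (Fin.le_def.2 (by simp only; omega))).trans_lt h1)
      have := congrArg Fin.val h3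
      simp only at this
      omega
    · by_contra! h1
      have h3 := h i h1 ⟨0, by omega⟩ (h1.trans_le (G.eigenvalue_antitone (by simp [Fin.le_def])))
      have := congrArg Fin.val h3
      simp only at this
      omega

theorem specRadius_nonneg (T : SimpleGraph W) : 0 ≤ T.specRadius := ENNReal.toReal_nonneg

theorem IsBipartiteRamanujan.countP_le_one (h : G.IsBipartiteRamanujan T) :
    G.adjMatrix.charpoly.roots.countP (T.specRadius < ·) ≤ 1 := by
  obtain ⟨c, hc⟩ := h.isBipartite
  exact (forall_eigenvalue_mem_iff hc (specRadius_nonneg T)).1 h.eigenvalue_mem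

theorem isBipartiteRamanujan_of_countP (hT : G.IsInFamily T) (hG : G.IsBipartite)
    (h : G.adjMatrix.charpoly.roots.countP (T.specRadius < ·) ≤ 1) :
    G.IsBipartiteRamanujan T := by
  obtain ⟨c, hc⟩ := hG
  exact ⟨hT, ⟨c, hc⟩, (forall_eigenvalue_mem_iff hc (specRadius_nonneg T)).2 h⟩

/-- Some `(d + 1)`-sheeted cover has no new eigenvalues above the spectral radius of the universal
covering tree. -/
theorem IsInFamily.exists_bipartiteCover (hG : G.IsInFamily T)
    (hc : ∀ e, c (G.src e) ≠ c (G.tgt e)) (d : ℕ) :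
    ∃ σ : G.TrueDart c → Equiv.Perm (Fin (d + 1)),
      (bipartiteCover hc σ).adjMatrix.charpoly.roots.countP (T.specRadius < ·) =
        G.adjMatrix.charpoly.roots.countP (T.specRadius < ·) := by
  classical
  have := hG.finite_dart
  have := Fintype.ofFinite G.Dart
  obtain ⟨σ, hσ⟩ := exists_det_sub_blockMatrix_stdMatrix_pos (d := d)
    (fun e : G.TrueDart c => G.src e) (fun e => G.tgt e) (fun e h => hc e (congrArg c h))
    T.specRadius fun x hx => hG.sum_det_stdMatrix_pos hc hx
  refine ⟨σ, ?_⟩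
  set N := blockMatrix (fun e : G.TrueDart c => G.src e) (fun e => G.tgt e) fun e =>
        (stdMatrix (σ e), stdMatrix (σ e)⁻¹) with hN
  have h1 : (bipartiteCover hc σ).adjMatrix.charpoly = G.adjMatrix.charpoly * N.charpoly := by
    refine Polynomial.funext fun x => ?_
    rw [Polynomial.eval_mul, Matrix.eval_charpoly, Matrix.eval_charpoly, Matrix.eval_charpoly,
      adjMatrix_bipartiteCover]
    have h2 := det_sub_blockMatrix_permBlock (fun e : G.TrueDart c => G.src e)
      (fun e => G.tgt e) σ x 0
    rw [zero_smul, sub_zero, zero_mul, add_zero] at h2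
    refine h2.trans ?_
    congr 3
    ext u v
    rw [adjMatrix_apply_eq_sum, sum_dart_eq_sum_trueDart hc]
    simp only [src_rev, tgt_rev, eq_comm, Matrix.of_apply]
  rw [h1, Polynomial.roots_mul (mul_ne_zero G.adjMatrix.charpoly_monic.ne_zero
    N.charpoly_monic.ne_zero), Multiset.countP_add, Nat.add_eq_left, Multiset.countP_eq_zero]
  intro x hx hρ
  have h2 := hσ x hρ
  rw [← Matrix.eval_charpoly, (Polynomial.mem_roots'.1 hx).2.eq_zero] at h2
  exact lt_irrefl _ h2

end Multigraph

/-! ### Connectedness of covers -/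

namespace Multigraph

variable {V W : Type*} {G : Multigraph V} {T : SimpleGraph W}

/-- The vertices joined by an edge. -/
abbrev Step (G : Multigraph V) (x y : V) : Prop := ∃ e, G.src e = x ∧ G.tgt e = y

theorem Step.symm {x y : V} (h : G.Step x y) : G.Step y x := by
  obtain ⟨e, h1, h2⟩ := h
  exact ⟨G.rev e, h2, by rw [tgt_rev, h1]⟩

section Disconnected

theorem adjMatrix_eq_zero {u v : V} (h : ¬ G.Step u v) : G.adjMatrix u v = 0 := by
  rw [adjMatrix, Matrix.of_apply, Nat.cast_eq_zero, Nat.card_eq_zero]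
  exact Or.inl ⟨fun e => h ⟨e.1, e.2⟩⟩

variable [Fintype V] [DecidableEq V]

/-- An eigenvector which does not vanish on either part of a disconnected graph shows that its
eigenvalue is multiple. -/
theorem two_le_countP_roots (C : V → Prop) [DecidablePred C]
    (hC : ∀ x y, G.Step x y → (C x ↔ C y)) (f : V → ℝ) {x : ℝ}
    (hf : G.adjMatrix.mulVec f = x • f) (h1 : ∃ v, C v ∧ f v ≠ 0) (h2 : ∃ v, ¬ C v ∧ f v ≠ 0)
    (p : ℝ → Prop) [DecidablePred p] (hp : p x) :
    2 ≤ G.adjMatrix.charpoly.roots.countP p := by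
  have hblock : G.adjMatrix.submatrix (Equiv.sumCompl C) (Equiv.sumCompl C) =
      Matrix.fromBlocks (G.adjMatrix.submatrix Subtype.val Subtype.val) 0 0
        (G.adjMatrix.submatrix (Subtype.val : {v // ¬ C v} → V) Subtype.val) := by
    refine Matrix.ext fun i j => ?_
    rw [Matrix.submatrix_apply]
    rcases i with u | u <;> rcases j with v | v
    · rw [Matrix.fromBlocks_apply₁₁, Matrix.submatrix_apply, Equiv.sumCompl_apply_inl,
        Equiv.sumCompl_apply_inl]
    · rw [Matrix.fromBlocks_apply₁₂, Equiv.sumCompl_apply_inl, Equiv.sumCompl_apply_inr]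
      exact adjMatrix_eq_zero fun h => v.2 ((hC _ _ h).1 u.2)
    · rw [Matrix.fromBlocks_apply₂₁, Equiv.sumCompl_apply_inl, Equiv.sumCompl_apply_inr]
      exact adjMatrix_eq_zero fun h => u.2 ((hC _ _ h).2 v.2)
    · rw [Matrix.fromBlocks_apply₂₂, Matrix.submatrix_apply, Equiv.sumCompl_apply_inr,
        Equiv.sumCompl_apply_inr]
  have hchar := (Matrix.charpoly_reindex (Equiv.sumCompl C).symm G.adjMatrix).symm
  rw [Matrix.reindex_apply, Equiv.symm_symm, hblock, Matrix.charpoly_fromBlocks_zero₁₂] at hchar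
  have hroot : ∀ (q : V → Prop) [DecidablePred q], (∀ x y, G.Step x y → (q x ↔ q y)) →
      (∃ v, q v ∧ f v ≠ 0) → 1 ≤ (G.adjMatrix.submatrix (Subtype.val : {v // q v} → V)
        Subtype.val).charpoly.roots.countP p := by
    intro q _ hq ⟨v, hv, hfv⟩
    refine Multiset.countP_pos.2 ⟨x, ?_, hp⟩
    refine (Polynomial.mem_roots (Matrix.charpoly_monic _).ne_zero).2 ?_
    rw [Polynomial.IsRoot, Matrix.eval_charpoly]
    refine Matrix.exists_mulVec_eq_zero_iff.1 ⟨fun u => f u, fun h => hfv (congrFun h ⟨v, hv⟩), ?_⟩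
    ext u
    have h3 := congrFun hf u
    rw [Matrix.mulVec, dotProduct, ← Fintype.sum_subtype_add_sum_subtype q,
      Finset.sum_eq_zero (s := (Finset.univ : Finset {v // ¬ q v})) fun w _ => by
        rw [adjMatrix_eq_zero fun h => w.2 ((hq _ _ h).1 u.2), zero_mul], add_zero] at h3
    rw [Matrix.sub_mulVec, Pi.sub_apply, Matrix.scalar_apply, Matrix.mulVec_diagonal]
    exact sub_eq_zero.2 h3.symm
  rw [hchar, Polynomial.roots_mul (mul_ne_zero (Matrix.charpoly_monic _).ne_zero
    (Matrix.charpoly_monic _).ne_zero), Multiset.countP_add]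
  exact add_le_add (hroot C hC h1) (hroot (fun v => ¬ C v) (fun x y h => not_congr (hC x y h)) h2)

end Disconnected

section VoltageCover

variable {ι : Type*} {s : G.Dart → Equiv.Perm ι} {hs : ∀ e, s (G.rev e) = (s e)⁻¹}

theorem adjMatrix_voltageCover_mulVec [Fintype V] [DecidableEq V] [Finite G.Dart] [Fintype ι]
    [DecidableEq ι] (f : V × ι → ℝ) (p : V × ι) [Fintype G.Dart] :
    (G.voltageCover s hs).adjMatrix.mulVec f p =
      ∑ e, if G.src e = p.1 then f (G.tgt e, s e p.2) else 0 := by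
  classical
  let : Fintype (G.voltageCover s hs).Dart := inferInstanceAs (Fintype (G.Dart × ι))
  rw [Matrix.mulVec, dotProduct]
  simp only [adjMatrix_apply_eq_sum, Finset.sum_mul, ite_mul, one_mul, zero_mul]
  rw [Finset.sum_comm]
  refine (Fintype.sum_prod_type (α₁ := G.Dart) (α₂ := ι) fun e => ∑ q : V × ι,
    if (G.voltageCover s hs).src e = p ∧ (G.voltageCover s hs).tgt e = q then f q else 0).trans ?_
  refine Finset.sum_congr rfl fun e _ => ?_
  rw [Finset.sum_eq_single p.2]
  · rw [Finset.sum_eq_single (G.tgt e, s e p.2)]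
    · refine if_congr ⟨fun h => (Prod.ext_iff.1 h.1).1, fun h => ⟨Prod.ext h rfl, rfl⟩⟩ rfl rfl
    · exact fun q _ hq => if_neg fun h => hq h.2.symm
    · simp
  · intro i _ hi
    exact Finset.sum_eq_zero fun q _ => if_neg fun h => hi (Prod.ext_iff.1 h.1).2
  · simp

theorem adjMatrix_mulVec [Fintype V] [DecidableEq V] [Fintype G.Dart] (f : V → ℝ) (v : V) :
    G.adjMatrix.mulVec f v = ∑ e, if G.src e = v then f (G.tgt e) else 0 := by
  rw [Matrix.mulVec, dotProduct]
  simp only [adjMatrix_apply_eq_sum, Finset.sum_mul, ite_mul, one_mul, zero_mul]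
  rw [Finset.sum_comm]
  refine Finset.sum_congr rfl fun e _ => ?_
  rw [Finset.sum_eq_single (G.tgt e)]
  · simp
  · exact fun q _ hq => if_neg fun h => hq h.2.symm
  · simp

theorem exists_reachable_over (hG : G.Connected) (p : V × ι) (v : V) :
    ∃ i, Relation.ReflTransGen (G.voltageCover s hs).Step p (v, i) := by
  have h := hG.2 p.1 v
  induction h with
  | refl => exact ⟨p.2, .refl⟩
  | tail _ h ih =>
    obtain ⟨i, hi⟩ := ih
    obtain ⟨e, rfl, rfl⟩ := h
    exact ⟨s e i, hi.tail ⟨(e, i), rfl, rfl⟩⟩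

/-- A cover without multiple eigenvalues above `ρ` of a connected graph which has an eigenvalue
above `ρ` is connected. -/
theorem Connected.voltageCover [Fintype V] [DecidableEq V] [Finite G.Dart] [Fintype ι]
    [DecidableEq ι] [Nonempty ι] (hG : G.Connected) {ρ x : ℝ} (hx : x ∈ G.adjMatrix.charpoly.roots)
    (hρ : ρ < x) (h : (G.voltageCover s hs).adjMatrix.charpoly.roots.countP (ρ < ·) ≤ 1) :
    (G.voltageCover s hs).Connected := by
  classical
  have := Fintype.ofFinite G.Dart
  obtain ⟨v₀⟩ := hG.1
  refine ⟨⟨(v₀, Classical.arbitrary ι)⟩, fun p q => ?_⟩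
  by_contra hpq
  refine absurd h (not_le.2 ?_)
  rw [Polynomial.mem_roots (Matrix.charpoly_monic _).ne_zero, Polynomial.IsRoot,
    Matrix.eval_charpoly] at hx
  obtain ⟨f, hf0, hf⟩ := Matrix.exists_mulVec_eq_zero_iff.2 hx
  obtain ⟨v, hv⟩ := Function.ne_iff.1 hf0
  obtain ⟨i, hi⟩ := exists_reachable_over (s := s) (hs := hs) hG p v
  obtain ⟨j, hj⟩ := exists_reachable_over (s := s) (hs := hs) hG q v
  refine two_le_countP_roots (Relation.ReflTransGen (G.voltageCover s hs).Step p)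
    (fun y z hyz => ⟨fun h => h.tail hyz, fun h => h.tail hyz.symm⟩) (fun p => f p.1) (x := x) ?_
    ⟨(v, i), hi, hv⟩ ⟨(v, j), fun h' => hpq (h'.trans ?_), hv⟩ (ρ < ·) hρ
  · ext p
    rw [adjMatrix_voltageCover_mulVec, ← adjMatrix_mulVec f p.1]
    have h3 := congrFun hf p.1
    rw [Matrix.sub_mulVec, Pi.sub_apply, Matrix.scalar_apply, Matrix.mulVec_diagonal] at h3
    exact (sub_eq_zero.1 h3).symm
  · have hsymm : Std.Symm (G.voltageCover s hs).Step := ⟨fun _ _ h => Step.symm h⟩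
    exact (Relation.ReflTransGen.stdSymm (r := (G.voltageCover s hs).Step)).symm _ _ hj

/-- If the eigenvalues of a graph are at most `ρ`, then so are those of its covers. -/
theorem countP_voltageCover_eq_zero [Fintype V] [DecidableEq V] [Finite G.Dart] [Fintype ι]
    [DecidableEq ι] {ρ : ℝ} (h : G.adjMatrix.charpoly.roots.countP (ρ < ·) = 0) :
    (G.voltageCover s hs).adjMatrix.charpoly.roots.countP (ρ < ·) = 0 := by
  classical
  have := Fintype.ofFinite G.Dart
  rw [Multiset.countP_eq_zero] at h ⊢
  intro x hx hρ
  rw [Polynomial.mem_roots (Matrix.charpoly_monic _).ne_zero, Polynomial.IsRoot,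
    Matrix.eval_charpoly] at hx
  obtain ⟨f, hf0, hf⟩ := Matrix.exists_mulVec_eq_zero_iff.2 hx
  -- The quadratic form of `G` is at most `ρ`. Summing the absolute values of an eigenfunction for
  -- `x` over the fibres gives `F ≥ 0` with `x F ≤ A F`, so `x > ρ` forces `F = 0`.
  have hpsd : (Matrix.scalar V ρ - G.adjMatrix).PosSemidef := by
    refine Matrix.posSemidef_iff_isHermitian_and_spectrum_nonneg.2 ⟨?_, ?_⟩
    · refine Matrix.IsHermitian.sub ?_ G.adjMatrix_isHermitian
      exact Matrix.isHermitian_diagonal _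
    · intro y hy
      have h1 : ρ - y ∈ spectrum ℝ G.adjMatrix := by
        have : algebraMap ℝ (Matrix V V ℝ) ρ - G.adjMatrix = Matrix.scalar V ρ - G.adjMatrix := rfl
        rw [← this, ← spectrum.singleton_sub_eq] at hy
        obtain ⟨_, rfl, z, hz, rfl⟩ := hy
        simpa using hz
      rw [Matrix.mem_spectrum_iff_isRoot_charpoly,
        ← Polynomial.mem_roots (Matrix.charpoly_monic _).ne_zero] at h1
      have := h _ h1
      simp only [Set.mem_ofPred_eq]
      linarith
  set F : V → ℝ := fun v => ∑ i, |f (v, i)| with hF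
  have hF0 : ∀ v, 0 ≤ F v := fun v => Finset.sum_nonneg fun i _ => abs_nonneg _
  have h2 := hpsd.dotProduct_mulVec_nonneg F
  have hAF : ∀ v, x * F v ≤ G.adjMatrix.mulVec F v := by
    intro v
    have hx0 : ∀ i, x * |f (v, i)| ≤ ∑ e, if G.src e = v then |f (G.tgt e, s e i)| else 0 := by
      intro i
      have h3 := congrFun hf (v, i)
      rw [Matrix.sub_mulVec, Pi.sub_apply, Matrix.scalar_apply, Matrix.mulVec_diagonal,
        adjMatrix_voltageCover_mulVec] at h3
      calc x * |f (v, i)| ≤ |x * f (v, i)| := by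
            rw [abs_mul]; exact mul_le_mul_of_nonneg_right (le_abs_self x) (abs_nonneg _)
        _ = |∑ e, if G.src e = v then f (G.tgt e, s e i) else 0| := by
            rw [sub_eq_zero.1 h3]
        _ ≤ _ := (Finset.abs_sum_le_sum_abs _ _).trans_eq
            (Finset.sum_congr rfl fun e _ => by split_ifs <;> simp)
    rw [adjMatrix_mulVec, hF, Finset.mul_sum]
    refine (Finset.sum_le_sum fun i _ => hx0 i).trans_eq ?_
    rw [Finset.sum_comm]
    refine Finset.sum_congr rfl fun e _ => ?_
    split_ifs
    · exact Equiv.sum_comp (s e) fun i => |f (G.tgt e, i)|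
    · simp
  have h3 : (x - ρ) * ∑ v, F v * F v ≤ 0 := by
    rw [Matrix.sub_mulVec, dotProduct_sub, Matrix.scalar_apply] at h2
    have h4 : ∑ v, F v * (x * F v) ≤ dotProduct F (G.adjMatrix.mulVec F) :=
      Finset.sum_le_sum fun v _ => mul_le_mul_of_nonneg_left (hAF v) (hF0 v)
    have h5 : dotProduct F ((Matrix.diagonal fun _ => ρ).mulVec F) = ρ * ∑ v, F v * F v := by
      simp only [dotProduct, Matrix.mulVec_diagonal, Finset.mul_sum]
      exact Finset.sum_congr rfl fun v _ => by ring
    have h6 : ∑ v, F v * (x * F v) = x * ∑ v, F v * F v := by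
      rw [Finset.mul_sum]
      exact Finset.sum_congr rfl fun v _ => by ring
    rw [star_trivial, h5] at h2
    linarith
  have h4 : ∑ v, F v * F v ≤ 0 := nonpos_of_mul_nonpos_right h3 (sub_pos.2 hρ)
  refine hf0 (funext fun p => ?_)
  have h5 := (Finset.sum_eq_zero_iff_of_nonneg fun v _ => mul_self_nonneg (F v)).1
    (h4.antisymm (Finset.sum_nonneg fun v _ => mul_self_nonneg (F v))) p.1 (Finset.mem_univ _)
  have h6 := (Finset.sum_eq_zero_iff_of_nonneg fun i _ => abs_nonneg (f (p.1, i))).1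
    (mul_self_eq_zero.1 h5) p.2 (Finset.mem_univ _)
  exact abs_eq_zero.1 h6

end VoltageCover

end Multigraph

namespace Multigraph

variable {V W : Type*} {G : Multigraph V} {T : SimpleGraph W}

theorem Covering.tgt_onDart (π : Covering (ofSimple T) G) (d : (ofSimple T).Dart) :
    G.tgt (π.onDart d) = π.onVert ((ofSimple T).tgt d) := by
  rw [tgt, π.rev_onDart, π.src_onDart]
  rfl

/-- A finite graph whose universal covering tree is infinite has an edge which is not a bridge. -/
theorem Covering.exists_not_bridge [Finite V] [Infinite W] (hT : T.IsTree)
    (π : Covering (ofSimple T) G) : ∃ e₀ : G.Dart,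
      Relation.ReflTransGen (fun x y => ∃ e, e ≠ e₀ ∧ e ≠ G.rev e₀ ∧ G.src e = x ∧ G.tgt e = y)
        (G.tgt e₀) (G.src e₀) := by
  classical
  -- Take two distinct tree vertices with the same image at minimal distance. By minimality the path
  -- between them maps to a closed walk without other repeated vertices, and the rest of this walk
  -- bypasses its first edge.
  have hex : ∃ n, ∃ s t, s ≠ t ∧ π.onVert s = π.onVert t ∧ T.dist s t = n := by
    obtain ⟨s, t, h1, h2⟩ := Finite.exists_ne_map_eq_of_infinite π.onVert
    exact ⟨_, s, t, h1, h2, rfl⟩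
  obtain ⟨s, t, hst, hπ, hm⟩ := Nat.find_spec hex
  have hmin : ∀ u v, u ≠ v → π.onVert u = π.onVert v → Nat.find hex ≤ T.dist u v :=
    fun u v h1 h2 => Nat.find_min' hex ⟨u, v, h1, h2, rfl⟩
  obtain ⟨p, hp, hlen⟩ := hT.connected.exists_path_of_dist s t
  rw [← hm, ← hlen] at hmin
  have hdist : ∀ i k, i + k ≤ p.length → T.dist (p.getVert i) (p.getVert (i + k)) ≤ k := by
    intro i k
    induction k with
    | zero => simp
    | succ k ih =>
      intro h
      have h1 := p.adj_getVert_succ (i := i + k) (by omega)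
      have h2 := hT.connected.dist_triangle (u := p.getVert i) (v := p.getVert (i + k))
        (w := p.getVert (i + k + 1))
      rw [SimpleGraph.dist_eq_one_iff_adj.2 h1] at h2
      have := ih (by omega)
      rw [← add_assoc]
      omega
  have hinj : ∀ i j, i < j → j ≤ p.length → p.getVert i ≠ p.getVert j := fun i j hij hj h =>
    hij.ne (hp.getVert_injOn (hij.le.trans hj) hj h)
  have hkey : ∀ i j, i < j → j ≤ p.length → π.onVert (p.getVert i) = π.onVert (p.getVert j) →
      i = 0 ∧ j = p.length := by
    intro i j hij hj h
    have h1 := hmin _ _ (hinj i j hij hj) h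
    have h2 := hdist i (j - i) (by omega)
    rw [Nat.add_sub_cancel' hij.le] at h2
    omega
  have hpos : 0 < p.length := by
    rw [Nat.pos_iff_ne_zero]
    exact fun h => hst (SimpleGraph.Walk.eq_of_length_eq_zero h)
  let d : ∀ k, k < p.length → (ofSimple T).Dart :=
    fun k hk => (⟨(p.getVert k, p.getVert (k + 1)), p.adj_getVert_succ hk⟩ : T.Dart)
  have hsrc : ∀ k hk, G.src (π.onDart (d k hk)) = π.onVert (p.getVert k) :=
    fun k hk => π.src_onDart _
  have htgt : ∀ k hk, G.tgt (π.onDart (d k hk)) = π.onVert (p.getVert (k + 1)) :=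
    fun k hk => π.tgt_onDart _
  refine ⟨π.onDart (d 0 hpos), ?_⟩
  have hreach : ∀ k, k + 1 ≤ p.length → Relation.ReflTransGen
      (fun x y => ∃ e, e ≠ π.onDart (d 0 hpos) ∧ e ≠ G.rev (π.onDart (d 0 hpos)) ∧
        G.src e = x ∧ G.tgt e = y) (π.onVert (p.getVert 1)) (π.onVert (p.getVert (k + 1))) := by
    intro k
    induction k with
    | zero => exact fun _ => .refl
    | succ k ih =>
      intro hk
      refine (ih (by omega)).tail ⟨π.onDart (d (k + 1) hk), fun h => ?_, fun h => ?_,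
        hsrc _ hk, htgt _ hk⟩
      · have h1 := congrArg G.src h
        rw [hsrc _ hk, hsrc _ hpos] at h1
        have := hkey 0 (k + 1) (by omega) (by omega) h1.symm
        omega
      -- Traversing the first edge backwards is possible only at the second step, where injectivity
      -- on the star of the second vertex excludes it.
      · have h1 := congrArg G.src h
        rw [hsrc _ hk, src_rev, htgt _ hpos] at h1
        have hk0 : k = 0 := by
          by_contra hk0
          have := hkey 1 (k + 1) (by omega) (by omega) h1.symm
          omega
        subst hk0
        rw [π.rev_onDart] at h
        have h2 := (π.bijOn_star (p.getVert 1)).injOn (show d (0 + 1) hk ∈ _ from rfl)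
          (show (ofSimple T).rev (d 0 hpos) ∈ _ from rfl) h
        have h3 := congrArg (ofSimple T).tgt h2
        rw [tgt_rev] at h3
        exact hinj 0 2 (by omega) (by omega) h3.symm
  have h := hreach (p.length - 1) (by omega)
  rw [Nat.sub_add_cancel hpos, p.getVert_length, ← hπ] at h
  rw [htgt _ hpos, hsrc _ hpos, p.getVert_zero]
  exact h

/-- The voltages with a cyclic shift on one edge. -/
def cyclicVoltage [DecidableEq G.Dart] (e₀ : G.Dart) (d : ℕ) (e : G.Dart) :
    Equiv.Perm (Fin (d + 1)) :=
  if e = e₀ then finRotate (d + 1) else if e = G.rev e₀ then (finRotate (d + 1))⁻¹ else 1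

theorem cyclicVoltage_rev [DecidableEq G.Dart] (e₀ : G.Dart) (d : ℕ) (e : G.Dart) :
    cyclicVoltage e₀ d (G.rev e) = (cyclicVoltage e₀ d e)⁻¹ := by
  have h1 := G.rev_ne e₀
  by_cases he : e = e₀
  · subst he
    simp [cyclicVoltage, h1]
  by_cases he' : e = G.rev e₀
  · subst he'
    simp [cyclicVoltage, G.rev_rev, h1]
  have h2 : G.rev e ≠ e₀ := fun h => he' (by rw [← h, G.rev_rev])
  have h3 : G.rev e ≠ G.rev e₀ := fun h => he (by rw [← G.rev_rev e, h, G.rev_rev])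
  simp [cyclicVoltage, he, he', h2, h3]

/-- Without `e₀` the graph remains connected and lifts to every sheet; the lifts of `e₀` join each
sheet to the next. -/
theorem Connected.cyclicCover [DecidableEq G.Dart] (hG : G.Connected) (e₀ : G.Dart)
    (h : Relation.ReflTransGen
      (fun x y => ∃ e, e ≠ e₀ ∧ e ≠ G.rev e₀ ∧ G.src e = x ∧ G.tgt e = y) (G.tgt e₀) (G.src e₀))
    (d : ℕ) : (G.voltageCover (cyclicVoltage e₀ d) (cyclicVoltage_rev e₀ d)).Connected := by
  set R : V → V → Prop := fun x y => ∃ e, e ≠ e₀ ∧ e ≠ G.rev e₀ ∧ G.src e = x ∧ G.tgt e = y with hR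
  have hsymm : Std.Symm R := ⟨by
    rintro x y ⟨e, h1, h2, h3, h4⟩
    exact ⟨G.rev e, fun h => h2 (by rw [← h, G.rev_rev]),
      fun h => h1 (by rw [← G.rev_rev e, h, G.rev_rev]), h4, by rw [tgt_rev, h3]⟩⟩
  have hRall : ∀ x y, Relation.ReflTransGen R x y := by
    intro x y
    have hxy := hG.2 x y
    induction hxy with
    | refl => exact .refl
    | tail _ hs ih =>
      refine ih.trans ?_
      obtain ⟨e, rfl, rfl⟩ := hs
      by_cases h1 : e = e₀
      · subst h1
        exact (Relation.ReflTransGen.stdSymm (r := R)).symm _ _ h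
      by_cases h2 : e = G.rev e₀
      · subst h2
        rw [src_rev, tgt_rev]
        exact h
      · exact .single ⟨e, h1, h2, rfl, rfl⟩
  set H := G.voltageCover (cyclicVoltage e₀ d) (cyclicVoltage_rev e₀ d)
  have hlift : ∀ x y i, Relation.ReflTransGen H.Step (x, i) (y, i) := by
    intro x y i
    have hxy := hRall x y
    induction hxy with
    | refl => exact .refl
    | tail _ hs ih =>
      obtain ⟨e, h1, h2, rfl, rfl⟩ := hs
      refine ih.tail ⟨(e, i), rfl, ?_⟩
      change (G.tgt e, cyclicVoltage e₀ d e i) = _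
      simp [cyclicVoltage, h1, h2]
  have hstep : ∀ x i, Relation.ReflTransGen H.Step (x, i) (x, finRotate (d + 1) i) := by
    intro x i
    refine ((hlift x (G.src e₀) i).tail ⟨(e₀, i), rfl, ?_⟩).trans
      (hlift (G.tgt e₀) x (finRotate (d + 1) i))
    change (G.tgt e₀, cyclicVoltage e₀ d e₀ i) = _
    simp only [cyclicVoltage, if_true]
  have hzero : ∀ (x : V) (n : ℕ) (hn : n < d + 1),
      Relation.ReflTransGen H.Step (x, 0) (x, ⟨n, hn⟩) := by
    intro x n
    induction n with
    | zero => exact fun _ => .refl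
    | succ n ih =>
      intro hn
      have := hstep x ⟨n, by omega⟩
      rw [finRotate_of_lt (by omega)] at this
      exact (ih _).trans this
  have hsymm' : Std.Symm H.Step := ⟨fun _ _ h => Step.symm h⟩
  refine ⟨⟨(hG.1.some, 0)⟩, fun p q => ?_⟩
  refine ((Relation.ReflTransGen.stdSymm (r := H.Step)).symm _ _ (hzero p.1 p.2 p.2.2)).trans ?_
  exact (hlift p.1 q.1 0).trans (hzero q.1 q.2 q.2.2)

variable [Fintype V]

theorem IsBipartiteRamanujan.exists_voltageCover (h : G.IsBipartiteRamanujan T) (d : ℕ) :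
    ∃ (s : G.Dart → Equiv.Perm (Fin (d + 1))) (hs : ∀ e, s (G.rev e) = (s e)⁻¹),
      (G.voltageCover s hs).IsBipartiteRamanujan T ∧
        (Infinite W → G.Connected → (G.voltageCover s hs).Connected) := by
  classical
  have hG := h.isInFamily
  have := hG.finite_dart
  have hle := h.countP_le_one
  obtain ⟨c, hc⟩ := h.isBipartite
  have hbip : ∀ (s : G.Dart → Equiv.Perm (Fin (d + 1))) (hs : ∀ e, s (G.rev e) = (s e)⁻¹),
      (G.voltageCover s hs).IsBipartite := fun s hs => ⟨fun p => c p.1, fun e => hc e.1⟩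
  -- Without an eigenvalue above the spectral radius, multiplicities cannot detect components. But
  -- then every cover satisfies the spectral bound, and a cyclic one can be used.
  by_cases hcase : Infinite W ∧ G.Connected ∧
      G.adjMatrix.charpoly.roots.countP (T.specRadius < ·) = 0
  · obtain ⟨hW, hconn, h0⟩ := hcase
    obtain ⟨v⟩ := hconn.1
    obtain ⟨π, -⟩ := hG.covered v
    obtain ⟨e₀, he₀⟩ := π.exists_not_bridge hG.isTree
    refine ⟨cyclicVoltage e₀ d, cyclicVoltage_rev e₀ d, ?_, fun _ _ => hconn.cyclicCover e₀ he₀ d⟩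
    exact isBipartiteRamanujan_of_countP hG.voltageCover (hbip _ _)
      ((countP_voltageCover_eq_zero h0).trans_le zero_le_one)
  · obtain ⟨σ, hσ⟩ := hG.exists_bipartiteCover hc d
    refine ⟨voltageOf hc σ, voltageOf_rev hc σ, ?_, fun hW hconn => ?_⟩
    · exact isBipartiteRamanujan_of_countP hG.voltageCover (hbip _ _) (hσ.trans_le hle)
    · have h0 : G.adjMatrix.charpoly.roots.countP (T.specRadius < ·) ≠ 0 :=
        fun h0 => hcase ⟨hW, hconn, h0⟩
      obtain ⟨x, hx, hxρ⟩ := Multiset.countP_pos.1 (Nat.pos_of_ne_zero h0)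
      exact hconn.voltageCover hx hxρ (hσ.trans_le hle)

end Multigraph

/-! ### Isomorphisms and renaming of vertices -/

namespace Multigraph

variable {V V' W : Type*}

/-- An isomorphism of graphs. -/
structure Iso (G : Multigraph V) (G' : Multigraph V') where
  vert : V ≃ V'
  dart : G.Dart ≃ G'.Dart
  src_dart : ∀ e, G'.src (dart e) = vert (G.src e)
  rev_dart : ∀ e, G'.rev (dart e) = dart (G.rev e)

namespace Iso

variable {G : Multigraph V} {G' : Multigraph V'} {T : SimpleGraph W}

theorem tgt_dart (φ : Iso G G') (e : G.Dart) : G'.tgt (φ.dart e) = φ.vert (G.tgt e) := by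
  rw [tgt, φ.rev_dart, φ.src_dart, src_rev]

theorem isSimple (φ : Iso G G') (h : G.IsSimple) : G'.IsSimple := by
  refine ⟨fun e => ?_, fun e e' => ?_⟩
  · obtain ⟨e, rfl⟩ := φ.dart.surjective e
    rw [φ.src_dart, φ.tgt_dart]
    exact fun he => h.1 e (φ.vert.injective he)
  · obtain ⟨e, rfl⟩ := φ.dart.surjective e
    obtain ⟨e', rfl⟩ := φ.dart.surjective e'
    rw [φ.src_dart, φ.src_dart, φ.tgt_dart, φ.tgt_dart]
    exact fun h1 h2 => congrArg _ (h.2 _ _ (φ.vert.injective h1) (φ.vert.injective h2))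

theorem isBipartite (φ : Iso G G') (h : G.IsBipartite) : G'.IsBipartite := by
  obtain ⟨c, hc⟩ := h
  refine ⟨fun v => c (φ.vert.symm v), fun e => ?_⟩
  obtain ⟨e, rfl⟩ := φ.dart.surjective e
  simpa only [φ.src_dart, φ.tgt_dart, Equiv.symm_apply_apply] using hc e

theorem connected (φ : Iso G G') (h : G.Connected) : G'.Connected := by
  refine ⟨h.1.map φ.vert, fun u v => ?_⟩
  have h1 := (h.2 (φ.vert.symm u) (φ.vert.symm v)).lift φ.vert (p := G'.Step) (by
    rintro x y ⟨e, rfl, rfl⟩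
    exact ⟨φ.dart e, φ.src_dart e, φ.tgt_dart e⟩)
  rwa [Function.onFun, Equiv.apply_symm_apply, Equiv.apply_symm_apply] at h1

theorem isInFamily (φ : Iso G G') (h : G.IsInFamily T) : G'.IsInFamily T where
  isTree := h.isTree
  finite_vert := by
    have := h.finite_vert
    exact .of_equiv _ φ.vert
  finite_dart := by
    have := h.finite_dart
    exact .of_equiv _ φ.dart
  covered v := by
    obtain ⟨π, t, ht⟩ := h.covered (φ.vert.symm v)
    refine ⟨{ onVert := fun t => φ.vert (π.onVert t)
              onDart := fun d => φ.dart (π.onDart d)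
              src_onDart := fun d => by rw [φ.src_dart, π.src_onDart]
              rev_onDart := fun d => by rw [φ.rev_dart, π.rev_onDart]
              bijOn_star := fun t => ?_ }, t, by simp [ht]⟩
    refine Set.BijOn.comp (g := φ.dart) ⟨?_, φ.dart.injective.injOn, ?_⟩ (π.bijOn_star t)
    · intro e he
      exact (φ.src_dart e).trans (congrArg _ he)
    · intro e he
      obtain ⟨e, rfl⟩ := φ.dart.surjective e
      exact ⟨e, φ.vert.injective ((φ.src_dart e).symm.trans he), rfl⟩

theorem card_star (φ : Iso G G') (v : V) :
    Nat.card {e : G'.Dart // G'.src e = φ.vert v} = Nat.card {e : G.Dart // G.src e = v} :=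
  (Nat.card_congr (φ.dart.subtypeEquiv fun e => by
    rw [φ.src_dart, φ.vert.apply_eq_iff_eq])).symm

theorem adjMatrix_eq (φ : Iso G G') : G'.adjMatrix = Matrix.reindex φ.vert φ.vert G.adjMatrix := by
  ext u v
  rw [Matrix.reindex_apply, Matrix.submatrix_apply, adjMatrix, adjMatrix, Matrix.of_apply,
    Matrix.of_apply]
  refine congrArg _ (Nat.card_congr (φ.dart.subtypeEquiv fun e => ?_)).symm
  rw [φ.src_dart, φ.tgt_dart, Equiv.eq_symm_apply, Equiv.eq_symm_apply]

theorem isBipartiteRamanujan [Fintype V] [Fintype V'] (φ : Iso G G') (h : G.IsBipartiteRamanujan T) :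
    G'.IsBipartiteRamanujan T := by
  classical
  refine isBipartiteRamanujan_of_countP (φ.isInFamily h.isInFamily) (φ.isBipartite h.isBipartite) ?_
  rw [φ.adjMatrix_eq, Matrix.charpoly_reindex]
  exact h.countP_le_one

end Iso

/-- The graph with renamed vertices and darts. -/
def transport {D' : Type*} (G : Multigraph V) (f : V ≃ V') (g : G.Dart ≃ D') : Multigraph V' where
  Dart := D'
  src d := f (G.src (g.symm d))
  rev d := g (G.rev (g.symm d))
  rev_rev d := by simp [G.rev_rev]
  rev_ne d h := G.rev_ne (g.symm d) (g.injective (by rw [h, g.apply_symm_apply]))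

/-- Renaming is an isomorphism. -/
def isoTransport {D' : Type*} (G : Multigraph V) (f : V ≃ V') (g : G.Dart ≃ D') :
    Iso G (G.transport f g) where
  vert := f
  dart := g
  src_dart e := congrArg (fun e => f (G.src e)) (g.symm_apply_apply e)
  rev_dart e := congrArg (fun e => g (G.rev e)) (g.symm_apply_apply e)

theorem IsBipartiteRamanujan.exists_cover_fin [Fintype V] {G : Multigraph V} {T : SimpleGraph W}
    (h : G.IsBipartiteRamanujan T) {n r : ℕ} (hn : Fintype.card V = n) (hr : 1 ≤ r) :
    ∃ H : Multigraph.{0, 0} (Fin (n * r)), H.IsBipartiteRamanujan T ∧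
      (G.IsSimple → H.IsSimple) ∧ (Infinite W → G.Connected → H.Connected) := by
  obtain ⟨d, rfl⟩ := Nat.exists_eq_add_of_le' hr
  obtain ⟨s, hs, hR, hC⟩ := h.exists_voltageCover d
  have := hR.isInFamily.finite_dart
  set φ := (G.voltageCover s hs).isoTransport
    (Fintype.equivFinOfCardEq (by simp [hn]) : V × Fin (d + 1) ≃ Fin (n * (d + 1)))
    (Finite.equivFin _)
  exact ⟨_, φ.isBipartiteRamanujan hR, fun hS => φ.isSimple hS.voltageCover,
    fun hW hG => φ.connected (hC hW hG)⟩

section ToSimple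

variable {G : Multigraph V}

/-- A simple graph as a graph without multiple edges. -/
def IsSimple.toSimpleGraph (_ : G.IsSimple) (f : V ≃ V') : SimpleGraph V' where
  Adj u v := u ≠ v ∧ G.Step (f.symm u) (f.symm v)
  symm := ⟨fun _ _ h => ⟨h.1.symm, h.2.symm⟩⟩
  loopless := ⟨fun _ h => h.1 rfl⟩

/-- The isomorphism of a graph without multiple edges with its simple graph. -/
noncomputable def IsSimple.iso (h : G.IsSimple) (f : V ≃ V') :
    Iso G (ofSimple (h.toSimpleGraph f)) where
  vert := f
  dart := Equiv.ofBijective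
    (fun e => (⟨(f (G.src e), f (G.tgt e)), fun he => h.1 e (f.injective he),
      e, (f.symm_apply_apply _).symm, (f.symm_apply_apply _).symm⟩ :
        (h.toSimpleGraph f).Dart)) <| by
    refine ⟨fun e e' he => ?_, fun d => ?_⟩
    · have h1 := congrArg SimpleGraph.Dart.toProd he
      exact h.2 _ _ (f.injective (Prod.ext_iff.1 h1).1) (f.injective (Prod.ext_iff.1 h1).2)
    · obtain ⟨e, h1, h2⟩ := d.adj.2
      refine ⟨e, SimpleGraph.Dart.ext _ _ (Prod.ext ?_ ?_)⟩
      · exact f.eq_symm_apply.1 h1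
      · exact f.eq_symm_apply.1 h2
  src_dart e := rfl
  rev_dart e := by
    refine SimpleGraph.Dart.ext _ _ (Prod.ext rfl ?_)
    change f (G.src e) = f (G.tgt (G.rev e))
    rw [tgt_rev]

theorem connected_of_connected_ofSimple {H : SimpleGraph V} (h : (ofSimple H).Connected) :
    H.Connected := by
  refine (SimpleGraph.connected_iff _).2 ⟨fun u v => ?_, h.1⟩
  refine Relation.ReflTransGen.rec (motive := fun v _ => H.Reachable u v) .rfl ?_ (h.2 u v)
  rintro x y - ⟨e, rfl, rfl⟩ ih
  exact ih.trans (show H.Adj _ _ from e.adj).reachable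

end ToSimple

end Multigraph

/-! ### The universal covering tree as walks without backtracking -/

namespace Multigraph

section UniversalCover

variable {V : Type*} (G : Multigraph V) (o : V)

/-- The end of a walk which starts at `o` and is given by its darts, the last one first. -/
def walkEnd : List G.Dart → V
  | [] => o
  | e :: _ => G.tgt e

/-- A list of darts is a walk from `o` without backtracking, the last dart first. -/
def IsReducedWalk : List G.Dart → Prop
  | [] => True
  | e :: l => IsReducedWalk l ∧ G.src e = G.walkEnd o l ∧ ∀ e' ∈ l.head?, e ≠ G.rev e'

/-- The walks from `o` without backtracking. -/
abbrev ReducedWalk : Type _ := {l : List G.Dart // G.IsReducedWalk o l}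

/-- The universal covering tree. -/
def universalCover : SimpleGraph (G.ReducedWalk o) where
  Adj w w' := (∃ e, w'.1 = e :: w.1) ∨ ∃ e, w.1 = e :: w'.1
  symm := ⟨fun _ _ h => h.symm⟩
  loopless := ⟨by
    rintro w (⟨e, h⟩ | ⟨e, h⟩) <;> simpa using congrArg List.length h⟩

variable {G o}

theorem isTree_universalCover : (G.universalCover o).IsTree := by
  refine ⟨?_, SimpleGraph.isAcyclic_iff_forall_adj_isBridge.2 ?_⟩
  · have h : ∀ l (hl : G.IsReducedWalk o l),
        (G.universalCover o).Reachable ⟨[], trivial⟩ ⟨l, hl⟩ := by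
      intro l
      induction l with
      | nil => exact fun _ => .rfl
      | cons e l ih =>
        intro hl
        refine (ih hl.1).trans (SimpleGraph.Adj.reachable ?_)
        exact Or.inl ⟨e, rfl⟩
    exact (SimpleGraph.connected_iff _).2 ⟨fun u v => (h u.1 u.2).symm.trans (h v.1 v.2),
      ⟨⟨[], trivial⟩⟩⟩
  -- Having `w'` as a suffix is invariant along walks avoiding the edge from `w` to `w'`, as that
  -- edge is the only way to acquire or lose it. But `w` is too short to have it.
  · have key : ∀ (w w' : G.ReducedWalk o) e, w'.1 = e :: w.1 →
        (G.universalCover o).IsBridge s(w, w') := by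
      intro w w' e hw
      rw [SimpleGraph.isBridge_iff]
      rintro ⟨p⟩
      have hinv : ∀ {u v : G.ReducedWalk o}
          (_ : ((G.universalCover o).deleteEdges {s(w, w')}).Walk u v),
          w'.1 <:+ v.1 → w'.1 <:+ u.1 := by
        intro u v p
        induction p with
        | nil => exact id
        | @cons u u' _ h _ ih =>
          intro hv
          have hu' := ih hv
          rw [SimpleGraph.deleteEdges_adj] at h
          obtain ⟨⟨e', he'⟩ | ⟨e', he'⟩, hne⟩ := h
          · rw [he', List.suffix_cons_iff] at hu'
            obtain h1 | h1 := hu'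
            · refine absurd ?_ hne
              have h2 : w' = u' := Subtype.ext (h1.trans he'.symm)
              have h3 : w = u := Subtype.ext (by
                rw [hw] at h1
                exact (List.cons.inj h1).2)
              rw [h2, h3]
              rfl
            · exact h1
          · rw [he', List.suffix_cons_iff]
            exact Or.inr hu'
      have h1 := (hinv p List.suffix_rfl).length_le
      rw [hw, List.length_cons] at h1
      omega
    rintro w w' (⟨e, h⟩ | ⟨e, h⟩)
    · exact key w w' e h
    · rw [Sym2.eq_swap]
      exact key w' w e h

/-- The label is the dart of `G` under `d`: the dart appended when the walk grows, the reverse of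
the one removed when it shrinks. -/
theorem exists_label (d : (ofSimple (G.universalCover o)).Dart) :
    ∃ e, ((ofSimple (G.universalCover o)).tgt d).1 = e :: ((ofSimple (G.universalCover o)).src d).1 ∨
      ((ofSimple (G.universalCover o)).src d).1 =
        G.rev e :: ((ofSimple (G.universalCover o)).tgt d).1 := by
  obtain ⟨e, h⟩ | ⟨e, h⟩ := SimpleGraph.Dart.adj d
  · exact ⟨e, Or.inl h⟩
  · exact ⟨G.rev e, Or.inr (by rw [G.rev_rev]; exact h)⟩

theorem label_unique {w w' : List G.Dart} {e e' : G.Dart} (h : w' = e :: w ∨ w = G.rev e :: w')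
    (h' : w' = e' :: w ∨ w = G.rev e' :: w') : e = e' := by
  obtain h | h := h <;> obtain h' | h' := h'
  · exact (List.cons.inj (h.symm.trans h')).1
  · have := congrArg List.length h
    have := congrArg List.length h'
    simp only [List.length_cons] at *
    omega
  · have := congrArg List.length h
    have := congrArg List.length h'
    simp only [List.length_cons] at *
    omega
  · have := (List.cons.inj (h.symm.trans h')).1
    rw [← G.rev_rev e, this, G.rev_rev]

theorem src_choose_label (d : (ofSimple (G.universalCover o)).Dart) :
    G.src (exists_label d).choose = G.walkEnd o ((ofSimple (G.universalCover o)).src d).1 := by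
  have h := (exists_label d).choose_spec
  set e := (exists_label d).choose
  obtain h | h := h
  · have h1 := ((ofSimple (G.universalCover o)).tgt d).2
    rw [h] at h1
    exact h1.2.1
  · rw [h]
    exact (G.tgt_rev e).symm

/-- The universal covering map. -/
noncomputable def universalCovering : Covering (ofSimple (G.universalCover o)) G where
  onVert w := G.walkEnd o w.1
  onDart d := (exists_label d).choose
  src_onDart := src_choose_label
  rev_onDart d := by
    refine label_unique (h := ?_) (exists_label ((ofSimple (G.universalCover o)).rev d)).choose_spec
    rw [G.rev_rev]
    exact (exists_label d).choose_spec.symm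
  bijOn_star w := by
    refine ⟨?_, ?_, ?_⟩
    · rintro d rfl
      exact src_choose_label d
    · intro d hd d' hd' h
      have h1 := (exists_label d).choose_spec
      have h2 := (exists_label d').choose_spec
      change (exists_label d).choose = (exists_label d').choose at h
      rw [← h] at h2
      set e := (exists_label d).choose
      rw [show (ofSimple (G.universalCover o)).src d = w from hd] at h1
      rw [show (ofSimple (G.universalCover o)).src d' = w from hd'] at h2
      have h3 : ((ofSimple (G.universalCover o)).tgt d).1 =
          ((ofSimple (G.universalCover o)).tgt d').1 := by
        have h4 : ∀ u u' : G.ReducedWalk o, u.1 = e :: w.1 → w.1 = G.rev e :: u'.1 → False := by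
          intro u u' hu hu'
          have h5 := u.2
          rw [hu] at h5
          exact h5.2.2 (G.rev e) (by rw [hu']; rfl) (G.rev_rev e).symm
        obtain h1 | h1 := h1 <;> obtain h2 | h2 := h2
        · rw [h1, h2]
        · exact (h4 _ _ h1 h2).elim
        · exact (h4 _ _ h2 h1).elim
        · exact (List.cons.inj (h1.symm.trans h2)).2
      exact SimpleGraph.Dart.ext _ _ (Prod.ext (hd.trans hd'.symm) (Subtype.ext h3))
    · intro e he
      obtain ⟨u, hu⟩ : ∃ u : G.ReducedWalk o, u.1 = e :: w.1 ∨ w.1 = G.rev e :: u.1 := by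
        by_cases h : ∃ l, w.1 = G.rev e :: l
        · obtain ⟨l, hl⟩ := h
          have := w.2
          rw [hl] at this
          exact ⟨⟨l, this.1⟩, Or.inr hl⟩
        · refine ⟨⟨e :: w.1, w.2, he, fun e' he' h' => h ?_⟩, Or.inl rfl⟩
          rw [h', G.rev_rev]
          exact List.head?_eq_some_iff.1 he'
      have hadj : (G.universalCover o).Adj w u := hu.imp (fun h => ⟨e, h⟩) fun h => ⟨_, h⟩
      refine ⟨(⟨(w, u), hadj⟩ : (G.universalCover o).Dart), rfl, ?_⟩
      exact label_unique (exists_label _).choose_spec hu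

theorem isInFamily_universalCover [Finite V] [Finite G.Dart] (hG : G.Connected) (o : V) :
    G.IsInFamily (G.universalCover o) where
  isTree := isTree_universalCover
  finite_vert := inferInstance
  finite_dart := inferInstance
  covered v := by
    refine ⟨universalCovering, ?_⟩
    refine Relation.ReflTransGen.rec
      (motive := fun v _ => v ∈ Set.range (universalCovering (G := G) (o := o)).onVert)
      ⟨⟨[], trivial⟩, rfl⟩ ?_ (hG.2 o v)
    rintro _ _ - ⟨e, rfl, rfl⟩ ⟨w, hw⟩
    obtain ⟨d, -, hd⟩ := ((universalCovering (G := G) (o := o)).bijOn_star w).surjOn hw.symm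
    exact ⟨_, ((universalCovering (G := G) (o := o)).tgt_onDart d).symm.trans (congrArg G.tgt hd)⟩

end UniversalCover

end Multigraph

/-! ### Complete bipartite graphs and the regular and biregular cases -/

namespace Multigraph

/-- A finite tree with more than one vertex has a leaf, but the degrees of `T` are those of `G`. -/
theorem Covering.infinite {V W : Type*} {G : Multigraph V} {T : SimpleGraph W} [Finite G.Dart]
    (hT : T.IsTree) (π : Covering (ofSimple T) G)
    (h : ∀ v, 2 ≤ Nat.card {e : G.Dart // G.src e = v}) : Infinite W := by
  classical
  by_contra hW
  rw [not_infinite_iff_finite] at hW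
  have := Fintype.ofFinite W
  have hdeg : ∀ t, 2 ≤ T.degree t := by
    intro t
    rw [← SimpleGraph.card_neighborSet_eq_degree, ← Nat.card_eq_fintype_card]
    exact (h _).trans_eq (π.ncard_neighborSet t).symm
  obtain ⟨t⟩ := hT.connected.nonempty
  have : Nontrivial W := by
    obtain ⟨u, hu⟩ := (T.degree_pos_iff_exists_adj t).1 (by have := hdeg t; omega)
    exact ⟨t, u, hu.ne⟩
  obtain ⟨u, hu⟩ := hT.exists_vert_degree_one_of_nontrivial
  have := hdeg u
  omega

theorem isSimple_ofSimple {V : Type*} (G : SimpleGraph V) : (ofSimple G).IsSimple :=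
  ⟨fun e => SimpleGraph.Adj.ne (SimpleGraph.Dart.adj e),
    fun _ _ h1 h2 => SimpleGraph.Dart.ext _ _ (Prod.ext h1 h2)⟩

section CompleteBipartite

open Matrix

/-- The matrix factors through functions on the two colours, so it has at most two nonzero
eigenvalues. By symmetry of the spectrum, half of them are positive. -/
theorem countP_pos_le_one {V : Type*} [Fintype V] [DecidableEq V] {G : Multigraph V} {c : V → Bool}
    (h : ∀ u v, G.adjMatrix u v = if c u = c v then 0 else 1) (hc : ∀ e, c (G.src e) ≠ c (G.tgt e)) :
    G.adjMatrix.charpoly.roots.countP ((0 : ℝ) < ·) ≤ 1 := by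
  have hrank : G.adjMatrix.rank ≤ 2 := by
    have h1 : G.adjMatrix = (Matrix.of fun (u : V) (b : Bool) => if c u = b then (1 : ℝ) else 0) *
        Matrix.of fun (b : Bool) (v : V) => if b = c v then (0 : ℝ) else 1 := by
      ext u v
      rw [h, Matrix.mul_apply]
      cases hu : c u <;> cases hv : c v <;> simp [hu, hv]
    rw [h1]
    exact (Matrix.rank_mul_le_left _ _).trans (Matrix.rank_le_card_width _)
  have h0 : G.adjMatrix.charpoly.roots.countP (· ≠ (0 : ℝ)) ≤ 2 := by
    rw [G.adjMatrix_isHermitian.roots_charpoly_eq_eigenvalues, Multiset.countP_map]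
    rw [G.adjMatrix_isHermitian.rank_eq_card_non_zero_eigs, Fintype.card_subtype] at hrank
    exact hrank
  have hneg : G.adjMatrix.charpoly.roots.countP (· < (0 : ℝ)) =
      G.adjMatrix.charpoly.roots.countP ((0 : ℝ) < ·) := by
    conv_lhs => rw [← map_neg_roots_charpoly hc, Multiset.countP_map]
    simp only [neg_neg_iff_pos, Multiset.countP_eq_card_filter]
  have hsum : ∀ s : Multiset ℝ, s.countP (· < (0 : ℝ)) + s.countP ((0 : ℝ) < ·) =
      s.countP (· ≠ (0 : ℝ)) := by
    intro s
    induction s using Multiset.induction_on with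
    | empty => simp
    | cons a s ih =>
      simp only [Multiset.countP_cons, ← ih]
      obtain h | rfl | h := lt_trichotomy a 0
      · simp [h, h.ne, h.not_gt]; omega
      · simp
      · simp [h, h.ne', h.not_gt]; omega
  have := hsum G.adjMatrix.charpoly.roots
  omega

variable (k l : ℕ)

/-- The complete bipartite graph. -/
abbrev completeBip : Multigraph (Fin k ⊕ Fin l) :=
  ofSimple (completeBipartiteGraph (Fin k) (Fin l))

theorem completeBipartiteGraph_adj_iff {k l : ℕ} (u v : Fin k ⊕ Fin l) :
    (completeBipartiteGraph (Fin k) (Fin l)).Adj u v ↔ u.isRight ≠ v.isRight := by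
  rcases u with u | u <;> rcases v with v | v <;> simp

theorem completeBip_ne (e : (completeBip k l).Dart) :
    ((completeBip k l).src e).isRight ≠ ((completeBip k l).tgt e).isRight :=
  (completeBipartiteGraph_adj_iff _ _).1 (SimpleGraph.Dart.adj e)

theorem card_star_completeBip (v : Fin k ⊕ Fin l) :
    Nat.card {e // (completeBip k l).src e = v} = if v.isRight then k else l := by
  rw [Nat.card_congr (starEquivNeighborSet _ v)]
  rcases v with i | j
  · have h : (completeBipartiteGraph (Fin k) (Fin l)).neighborSet (Sum.inl i) =
        Set.range Sum.inr := by
      ext (v | v) <;> simp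
    rw [h, Nat.card_range_of_injective Sum.inr_injective]
    simp
  · have h : (completeBipartiteGraph (Fin k) (Fin l)).neighborSet (Sum.inr j) =
        Set.range Sum.inl := by
      ext (v | v) <;> simp
    rw [h, Nat.card_range_of_injective Sum.inl_injective]
    simp

theorem adjMatrix_completeBip (u v : Fin k ⊕ Fin l) :
    (completeBip k l).adjMatrix u v = if u.isRight = v.isRight then 0 else 1 := by
  split_ifs with h
  · refine adjMatrix_eq_zero ?_
    rintro ⟨e, rfl, rfl⟩
    exact completeBip_ne k l e h
  · rw [adjMatrix, Matrix.of_apply, Nat.cast_eq_one, Nat.card_eq_one_iff_unique]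
    refine ⟨⟨fun e e' => Subtype.ext ((isSimple_ofSimple _).2 _ _ (e.2.1.trans e'.2.1.symm)
      (e.2.2.trans e'.2.2.symm))⟩, ⟨⟨(⟨(u, v), (completeBipartiteGraph_adj_iff u v).2 h⟩ :
        (completeBipartiteGraph (Fin k) (Fin l)).Dart), rfl, rfl⟩⟩⟩

end CompleteBipartite

theorem connected_completeBip {k l : ℕ} (hk : 1 ≤ k) (hl : 1 ≤ l) :
    (completeBip k l).Connected := by
  have hadj : ∀ i j, (completeBip k l).Step (Sum.inl i) (Sum.inr j) := fun i j =>
    ⟨(⟨(Sum.inl i, Sum.inr j), Or.inl ⟨rfl, rfl⟩⟩ :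
      (completeBipartiteGraph (Fin k) (Fin l)).Dart), rfl, rfl⟩
  refine ⟨⟨Sum.inl ⟨0, hk⟩⟩, ?_⟩
  have h1 : ∀ v, Relation.ReflTransGen (completeBip k l).Step (Sum.inl ⟨0, hk⟩) v := by
    rintro (i | j)
    · exact (Relation.ReflTransGen.single (hadj _ ⟨0, hl⟩)).tail (hadj i ⟨0, hl⟩).symm
    · exact .single (hadj _ j)
  have hsymm : Std.Symm (completeBip k l).Step := ⟨fun _ _ h => Step.symm h⟩
  exact fun u v => ((Relation.ReflTransGen.stdSymm (r := (completeBip k l).Step)).symm _ _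
    (h1 u)).trans (h1 v)

/-- An `r`-sheeted cover of the complete bipartite graph keeps its degrees and simplicity. The base
is bipartite-Ramanujan because at most one of its eigenvalues is positive, let alone above the
spectral radius. -/
theorem exists_biregular {k l r N : ℕ} (hk : 1 ≤ k) (hl : 1 ≤ l) (hr : 1 ≤ r)
    (hN : (k + l) * r = N) :
    ∃ H : SimpleGraph (Fin N), H.IsBiregular k l ∧
      (∃ (W : Type) (T : SimpleGraph W), (ofSimple H).IsBipartiteRamanujan T) ∧
      (2 ≤ k → 2 ≤ l → H.Connected) := by
  classical
  obtain ⟨d, rfl⟩ := Nat.exists_eq_add_of_le' hr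
  set G := completeBip k l with hG
  have : Finite G.Dart := inferInstanceAs (Finite (completeBipartiteGraph (Fin k) (Fin l)).Dart)
  have hconn : G.Connected := connected_completeBip hk hl
  obtain ⟨o⟩ := hconn.1
  have hfam := isInFamily_universalCover hconn o
  set T := G.universalCover o
  have hR : G.IsBipartiteRamanujan T := by
    refine isBipartiteRamanujan_of_countP hfam ⟨Sum.isRight, completeBip_ne k l⟩ ?_
    refine le_trans ?_ (countP_pos_le_one (adjMatrix_completeBip k l) (completeBip_ne k l))
    simp only [Multiset.countP_eq_card_filter]
    exact Multiset.card_le_card (Multiset.monotone_filter_right _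
      fun x hx => (specRadius_nonneg T).trans_lt hx)
  obtain ⟨s, hs, hcov, hcc⟩ := hR.exists_voltageCover d
  have hsimple : (G.voltageCover s hs).IsSimple := (isSimple_ofSimple _).voltageCover
  let f : (Fin k ⊕ Fin l) × Fin (d + 1) ≃ Fin N := Fintype.equivFinOfCardEq (by simp [← hN])
  let φ := hsimple.iso f
  refine ⟨hsimple.toSimpleGraph f, ⟨fun v => (f.symm v).1.isRight, fun u v h => ?_, fun v => ?_⟩,
    ⟨_, T, φ.isBipartiteRamanujan hcov⟩, fun hk2 hl2 => ?_⟩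
  · obtain ⟨-, e, h1, h2⟩ := h
    simp only [← h1, ← h2]
    exact completeBip_ne k l e.1
  · refine ⟨Set.toFinite _, ?_⟩
    obtain ⟨p, rfl⟩ := f.surjective v
    have h1 := φ.card_star p
    have h2 : Nat.card {e // (G.voltageCover s hs).src e = p} =
        Nat.card {e // G.src e = p.1} := by
      refine Nat.card_congr ⟨fun e => ⟨e.1.1, (Prod.ext_iff.1 e.2).1⟩,
        fun e => ⟨(e.1, p.2), Prod.ext e.2 rfl⟩, fun e => ?_, fun e => rfl⟩
      exact Subtype.ext (Prod.ext rfl (Prod.ext_iff.1 e.2).2.symm)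
    rw [h2, card_star_completeBip] at h1
    simp only [f.symm_apply_apply, ← h1]
    exact (Nat.card_congr (starEquivNeighborSet _ _)).symm
  · obtain ⟨π, -⟩ := hfam.covered o
    have hW := π.infinite hfam.isTree fun v => by
      rw [card_star_completeBip]
      split_ifs <;> assumption
    exact connected_of_connected_ofSimple (φ.connected (hcc hW hconn))

end Multigraph

theorem mainTheorem7 :
    (∀ {W : Type*} (T : SimpleGraph W) {V : Type*} [Fintype V] (G : Multigraph V) (n : ℕ),
      Fintype.card V = n → G.IsBipartiteRamanujan T → ∀ r : ℕ, 1 ≤ r →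
        ∃ H : Multigraph.{0, 0} (Fin (n * r)), H.IsBipartiteRamanujan T ∧
          (G.IsSimple → H.IsSimple) ∧ (Infinite W → G.Connected → H.Connected)) ∧
    (∀ k r : ℕ, 1 ≤ k → 1 ≤ r →
      ∃ H : SimpleGraph (Fin (2 * k * r)), H.IsKRegular k ∧
        (∃ (W : Type) (T : SimpleGraph W), (Multigraph.ofSimple H).IsBipartiteRamanujan T) ∧
        (2 ≤ k → H.Connected)) ∧
    (∀ k l r : ℕ, 1 ≤ k → 1 ≤ l → 1 ≤ r →
      ∃ H : SimpleGraph (Fin ((k + l) * r)), H.IsBiregular k l ∧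
        (∃ (W : Type) (T : SimpleGraph W), (Multigraph.ofSimple H).IsBipartiteRamanujan T) ∧
        (2 ≤ k → 2 ≤ l → H.Connected)) := by
  refine ⟨fun T _ _ G n hn hG r hr => hG.exists_cover_fin hn hr, fun k r hk hr => ?_,
    fun k l r hk hl hr => Multigraph.exists_biregular hk hl hr rfl⟩
  obtain ⟨H, ⟨c, -, hc⟩, hT, hconn⟩ := Multigraph.exists_biregular hk hk hr
    (show (k + k) * r = 2 * k * r by ring)
  exact ⟨H, fun v => by simpa using hc v, hT, fun h => hconn h h⟩
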